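/- Query model. Let $G$ be an undirected simple graph with vertex set $[n]$. An algorithm knows $n$ and accesses $G$ only through degree queries (return the degree $d(v)$ of $v$), neighbor queries (return the $i$-th neighbor of $v$, $1\le i\le d(v)$, in an arbitrary fixed ordering of the neighbors of $v$) and pair queries (return whether $\{u,v\}$ is an edge); it may toss coins, and it is charged one unit per query. The arboricity of $G$ is the minimum number of forests into which its edges can be partitioned. Let $\mathcal C_k$ be the set of $k$-cliques of $G$, let $n_k=|\mathcal C_k|$, and let $\log$ be the logarithm to base $2$. Theorem. There are an absolute constant $c$ and a randomized query algorithm Sample-a-clique$(G,n,\alpha,k,\epsilon,\bar n_k,\tau)$ with the following properties. Let $k\ge 2$, let $0<\epsilon<1$, and let $G$ be a graph on $n$ vertices, of arboricity at most the integer $\alpha$, that contains at least one $k$-clique. Suppose that the algorithm is invoked with an estimate $\bar n_k\in[n_k,2n_k]$ and a parameter $\tau$ such that $$\frac{\alpha}{\epsilon}\,(4k\log n)^k\;\le\;\tau\;\le\;\sqrt{n\alpha}.$$ Then: 1. The algorithm either returns a $k$-clique of $G$ or reports failure, and every $k$-clique $C\in\mathcal C_k$ is returned with probability in $\left[\frac{1-\epsilon}{n_k},\frac{1+\epsilon}{n_k}\right]$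 (in particular it fails with probability at most $\epsilon$). Moreover, conditioned on a $k$-clique being returned, the distribution of that clique is pointwise $\epsilon$-close to uniform on $\mathcal C_k$, that is, each $C\in\mathcal C_k$ has conditional probability in $\left[\frac{1-\epsilon}{n_k},\frac{1+\epsilon}{n_k}\right]$. 2. The expected number of queries is at most $$\left(\frac{\log n}{\epsilon}\right)^{ck}\cdot\min\left\{n\alpha,\ \frac{n\alpha\,\tau^{k-2}}{n_k}\right\}.$$ 3. The maximum number of queries, over all outcomes of the coin tosses, is at most $$\left(\frac{\log n}{\epsilon}\right)^{ck}\cdot\max\left\{\frac{\sqrt{n\alpha}}{\tau},\ \min\left\{n\alpha,\ \frac{n\alpha\,\tau^{k-2}}{n_k}\right\}\right\}.$$ -/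

import Mathlib

open scoped ENNReal

namespace CliqueSampling

/-- `G` is the edge-disjoint union of `a` forests (some of them possibly without edges). -/
def HasForestPartition {V : Type*} (G : SimpleGraph V) (a : ℕ) : Prop :=
  ∃ F : Fin a → SimpleGraph V,
    (∀ i, (F i).IsAcyclic) ∧ (∀ i j, i ≠ j → Disjoint (F i) (F j)) ∧ (⨆ i, F i) = G

/-- The arboricity: the minimum number of forests into which the edges can be partitioned
(`⊤` if there is no such finite number, which does not happen for finite graphs). -/
noncomputable def arboricity {V : Type*} (G : SimpleGraph V) : ℕ∞ :=
  ⨅ (a : ℕ) (_ : HasForestPartition G a), (a : ℕ∞)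

/-- The number `n_k` of `k`-cliques of `G`. -/
noncomputable def numCliques {n : ℕ} (G : SimpleGraph (Fin n)) (k : ℕ) : ℕ :=
  (G.cliqueSet k).ncard

/-- The queries of the general graph model: degree, neighbor and pair queries. -/
inductive GraphQuery (n : ℕ) : Type
  | deg (v : Fin n) : GraphQuery n
  | nbr (v : Fin n) (i : ℕ) : GraphQuery n
  | pair (u v : Fin n) : GraphQuery n

/-- The type of the answers to a query. -/
def GraphQuery.Answer {n : ℕ} : GraphQuery n → Type
  | .deg _ => ℕ
  | .nbr _ _ => Option (Fin n)
  | .pair _ _ => Bool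

/-- An arbitrary ordering of the neighbors of every vertex of `G`, to which
neighbor queries refer. -/
structure AdjLists {n : ℕ} (G : SimpleGraph (Fin n)) where
  list : Fin n → List (Fin n)
  nodup : ∀ v, (list v).Nodup
  mem_iff : ∀ v w, w ∈ list v ↔ G.Adj v w

/-- Answers to the queries. The neighbors of `v` are indexed by `0, …, d(v) - 1`; the answer to
a neighbor query whose index is out of range is `none`. -/
def AdjLists.answer {n : ℕ} {G : SimpleGraph (Fin n)} (L : AdjLists G) :
    (q : GraphQuery n) → q.Answer
  | .deg v => (L.list v).length
  | .nbr v i => (L.list v)[i]?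
  | .pair u v => decide (v ∈ L.list u)

/-- Randomized adaptive query algorithms on graphs with vertex set `Fin n`, with outputs in `Ω`:
an algorithm halts with an output, or makes an internal random choice (which costs no query),
or makes a query and proceeds according to the answer. -/
inductive QueryAlg (n : ℕ) (Ω : Type) : Type
  | output (x : Ω) : QueryAlg n Ω
  | toss (μ : PMF ℕ) (next : ℕ → QueryAlg n Ω) : QueryAlg n Ω
  | ask (q : GraphQuery n) (next : q.Answer → QueryAlg n Ω) : QueryAlg n Ω

namespace QueryAlg

variable {n : ℕ} {Ω : Type} {G : SimpleGraph (Fin n)}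

/-- The joint distribution of the output and of the number of queries made, when the algorithm
is run on a graph given by its adjacency lists. -/
noncomputable def run (L : AdjLists G) : QueryAlg n Ω → PMF (Ω × ℕ)
  | .output x => PMF.pure (x, 0)
  | .toss μ next => μ.bind fun r => run L (next r)
  | .ask q next => (run L (next (L.answer q))).map fun p => (p.1, p.2 + 1)

/-- The distribution of the output. -/
noncomputable def outputDist (A : QueryAlg n Ω) (L : AdjLists G) : PMF Ω :=
  (A.run L).map Prod.fst

/-- The expected number of queries. -/
noncomputable def expectedQueries (A : QueryAlg n Ω) (L : AdjLists G) : ℝ≥0∞ :=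
  ∑' p : Ω × ℕ, A.run L p * (p.2 : ℝ≥0∞)

/-- The maximum number of queries over all possible runs. -/
noncomputable def maxQueries (A : QueryAlg n Ω) (L : AdjLists G) : ℝ≥0∞ :=
  ⨆ p ∈ (A.run L).support, (p.2 : ℝ≥0∞)

end QueryAlg

/-- `P` gives every element of the finite set `S` a probability in `(1 ± ε) / |S|`. -/
def PointwiseCloseToUniform {Ω : Type*} (ε : ℝ) (S : Set Ω) (P : Ω → ℝ) : Prop :=
  ∀ x ∈ S, P x ∈ Set.Icc ((1 - ε) * (1 / (S.ncard : ℝ))) ((1 + ε) * (1 / (S.ncard : ℝ)))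

/-- The probability that an algorithm which returns a set of vertices, or fails (`none`),
returns the set `C`. -/
noncomputable def returnProb {n : ℕ} {G : SimpleGraph (Fin n)}
    (A : QueryAlg n (Option (Finset (Fin n)))) (L : AdjLists G) (C : Finset (Fin n)) : ℝ :=
  (A.outputDist L (some C)).toReal

/-- The probability that `C` is returned, conditioned on the event that the algorithm
does not fail. -/
noncomputable def condReturnProb {n : ℕ} {G : SimpleGraph (Fin n)}
    (A : QueryAlg n (Option (Finset (Fin n)))) (L : AdjLists G) (C : Finset (Fin n)) : ℝ :=
  returnProb A L C / (1 - (A.outputDist L none).toReal)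

end CliqueSampling

open CliqueSampling

/-!
Cliques are sampled by adding one vertex at a time, along walks that make the distribution almost
uniform although the number of ways to extend a clique varies.

Faces are the `i`-cliques and cells the `(i + 1)`-cliques; each cell is incident to a fixed number
of its facets: both vertices for `i = 1`, and for `i ≥ 2` the cliques obtained by dropping a vertex
other than the one of minimum degree. A walk starts at an almost uniform face. A *fresh* visit
moves from a face to each incident cell with one fixed small probability, which is possible only if
the face has few cells, and otherwise partly or wholly fails; from a cell the walk goes to another
random facet, and a *continued* visit passes to a uniformly random cell of it, making good what
fresh visits miss at faces with many cells. The two kernels complement each other so that, up to a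
factor close to one, all pairs of a settled face and one of its cells are visited equally often
(`FacetSystem.visits_le`, `FacetSystem.le_visits`); the cell reached after a random number of steps
is reported. Why logarithmically many steps suffice: a face is unsettled only if it has more than
`δ * θ` cells and a fraction `δ` of them has another unsettled facet. A graph of arboricity at most
`a` has an orientation with out-degrees at most `a` (`exists_orientation`), hence a set `U` of
`i`-cliques contains two facets of only `O(i ^ 2 * a * |U|)` cells (`sum_two_facets_le`), and the
unsettled set halves with each step (`FacetSystem.unsettled_eq_empty`).

Extending a clique needs a neighbor of its vertex of minimum degree. If that degree `d` is at most
`√(n * a)`, a random neighbor is drawn, so that each extension has rate `1 / d`; otherwise the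
endpoint of an almost uniform edge is used, whose rate does not depend on `d` (`trial`). Repeated
trials simulate the two kernels (`freshTrials`, `contTrials`). Their expected number depends on `n`
only through logarithms, because the sum of the minimum degrees of the `i`-cliques is at most
`2 * n * a` for `i = 1` and grows at most by a factor `i * a` from `i` to `i + 1` (`sampler_cliqueAlg`).

A single attempt returns each clique with almost the same probability `p`, where `1 / p` is at most
`n * a * τ ^ (k - 2)` up to logarithmic factors. Attempts are repeated until one succeeds or a
budget of queries is exhausted (`loop`); this multiplies the probabilities of all cliques by the
same factor (`exists_loop_factor`), so that the output stays almost uniform, and the budget bounds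
the maximum number of queries. If the estimate of the number of cliques is at most `τ ^ (k - 2)`,
the whole graph is read instead. All further factors are polynomial in `k`, `log n` and `1 / ε`,
except for those that appear once for each vertex added, and the bounds on `τ` force
`6 * k ≤ log n` (`six_mul_le_logb`).
-/

namespace CliqueSampling

namespace QueryAlg

variable {n : ℕ} {Ω Ω' X Y : Type} {G : SimpleGraph (Fin n)}

/-- Sequential composition in which the continuation also sees the number of queries made so
far. -/
noncomputable def bindC : QueryAlg n Ω → (Ω → ℕ → QueryAlg n Ω') → QueryAlg n Ω'
  | .output x, g => g x 0
  | .toss μ next, g => .toss μ fun r => bindC (next r) g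
  | .ask q next, g => .ask q fun a => bindC (next a) fun x c => g x (c + 1)

/-- Sequential composition. -/
noncomputable def bind (A : QueryAlg n Ω) (g : Ω → QueryAlg n Ω') : QueryAlg n Ω' :=
  bindC A fun x _ => g x

/-- Sequential composition of algorithms that may fail (output `none`). -/
noncomputable def bindO (A : QueryAlg n (Option X)) (g : X → QueryAlg n (Option Y)) :
    QueryAlg n (Option Y) :=
  bind A fun o => o.elim (.output none) g

/-- Draw from a distribution on a finite type, without queries. -/
noncomputable def sample [Fintype X] (μ : PMF X) : QueryAlg n X :=
  .toss (μ.map fun x => (Fintype.equivFin X x).val) fun r => .output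
    (if h : r < Fintype.card X then (Fintype.equivFin X).symm ⟨r, h⟩ else μ.support_nonempty.some)

open Classical in
/-- Draw uniformly from a finite set; fail if it is empty. -/
noncomputable def pick [Fintype X] (s : Finset X) : QueryAlg n (Option X) :=
  if h : s.Nonempty then sample ((PMF.uniformOfFinset s h).map some) else .output none

/-- Succeed with probability `a` (truncated to `[0, 1]`). -/
noncomputable def coin (a : ℝ) : QueryAlg n (Option Unit) :=
  sample (PMF.ofFintype (fun o => o.elim (1 - min (ENNReal.ofReal a) 1)
    fun _ => min (ENNReal.ofReal a) 1)
    (by simp [Fintype.sum_option, tsub_add_cancel_of_le (min_le_right (ENNReal.ofReal a) 1)]))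

/-- The probability of an output, as a real number. -/
noncomputable def pr (L : AdjLists G) (A : QueryAlg n Ω) (x : Ω) : ℝ := (A.outputDist L x).toReal

/-- The expected number of queries is at most `c`. -/
def CostLe (L : AdjLists G) (A : QueryAlg n Ω) (c : ℝ) : Prop :=
  A.expectedQueries L ≤ ENNReal.ofReal c

/-- Every run makes at most `m` queries. -/
def MaxLe (L : AdjLists G) (A : QueryAlg n Ω) (m : ℕ) : Prop :=
  ∀ p ∈ (A.run L).support, p.2 ≤ m

/-- On the given graph the algorithm always outputs `x`, and makes at most `m` queries. -/
def Det (L : AdjLists G) (A : QueryAlg n Ω) (x : Ω) (m : ℕ) : Prop :=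
  ∃ c ≤ m, A.run L = PMF.pure (x, c)

theorem tsum_bind_mul {α β : Type*} (μ : PMF α) (f : α → PMF β) (h : β → ℝ≥0∞) :
    ∑' y, (μ.bind f) y * h y = ∑' x, μ x * ∑' y, f x y * h y := by
  simp_rw [PMF.bind_apply, ← ENNReal.tsum_mul_right, ← ENNReal.tsum_mul_left]
  rw [ENNReal.tsum_comm]
  simp_rw [mul_assoc]

theorem tsum_pure_mul {β : Type*} (y : β) (h : β → ℝ≥0∞) :
    ∑' z, (PMF.pure y) z * h z = h y := by
  rw [tsum_eq_single y]
  · simp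
  · intro b hb; simp [PMF.pure_apply, hb]

theorem tsum_map_mul {α β : Type*} (μ : PMF α) (f : α → β) (h : β → ℝ≥0∞) :
    ∑' y, (μ.map f) y * h y = ∑' x, μ x * h (f x) := by
  rw [PMF.map, tsum_bind_mul]
  congr 1; ext x; rw [Function.comp, tsum_pure_mul]

theorem run_bindC (L : AdjLists G) (A : QueryAlg n Ω) (g : Ω → ℕ → QueryAlg n Ω') :
    (bindC A g).run L =
      (A.run L).bind fun p => ((g p.1 p.2).run L).map fun q => (q.1, p.2 + q.2) := by
  induction A generalizing g with
  | output x =>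
    simp only [bindC, run, PMF.pure_bind, zero_add, Prod.mk.eta]
    exact (PMF.map_id _).symm
  | toss μ next ih => simp only [bindC, run, PMF.bind_bind, ih]
  | ask q next ih =>
    simp only [bindC, run, ih, PMF.map_bind, PMF.bind_map, PMF.map_comp]
    congr 1; ext p : 1
    simp only [Function.comp_def]
    congr 1; ext q : 1
    simp; omega

theorem run_bind (L : AdjLists G) (A : QueryAlg n Ω) (g : Ω → QueryAlg n Ω') :
    (bind A g).run L =
      (A.run L).bind fun p => ((g p.1).run L).map fun q => (q.1, p.2 + q.2) := run_bindC L A _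

theorem outputDist_bindC (L : AdjLists G) (A : QueryAlg n Ω) (g : Ω → ℕ → QueryAlg n Ω') :
    (bindC A g).outputDist L = (A.run L).bind fun p => (g p.1 p.2).outputDist L := by
  simp only [outputDist, run_bindC, PMF.map_bind, PMF.map_comp]
  rfl

theorem outputDist_bind (L : AdjLists G) (A : QueryAlg n Ω) (g : Ω → QueryAlg n Ω') :
    (bind A g).outputDist L = (A.outputDist L).bind fun x => (g x).outputDist L := by
  rw [bind, outputDist_bindC, outputDist, PMF.bind_map]; rfl

@[simp] theorem outputDist_output (L : AdjLists G) (x : Ω) :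
    (output x : QueryAlg n Ω).outputDist L = PMF.pure x := by
  simp [outputDist, run, PMF.pure_map]

theorem expectedQueries_bindC (L : AdjLists G) (A : QueryAlg n Ω) (g : Ω → ℕ → QueryAlg n Ω') :
    (bindC A g).expectedQueries L =
      A.expectedQueries L + ∑' p, A.run L p * (g p.1 p.2).expectedQueries L := by
  simp only [expectedQueries, run_bindC, tsum_bind_mul, tsum_map_mul]
  rw [← ENNReal.tsum_add]
  congr 1; ext p
  rw [← mul_add]
  congr 1
  push_cast
  simp_rw [mul_add]
  rw [ENNReal.tsum_add, ENNReal.tsum_mul_right, PMF.tsum_coe, one_mul]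

theorem expectedQueries_bind (L : AdjLists G) (A : QueryAlg n Ω) (g : Ω → QueryAlg n Ω') :
    (bind A g).expectedQueries L =
      A.expectedQueries L + ∑' x, A.outputDist L x * (g x).expectedQueries L := by
  rw [bind, expectedQueries_bindC, outputDist, tsum_map_mul]

@[simp] theorem expectedQueries_output (L : AdjLists G) (x : Ω) :
    (output x : QueryAlg n Ω).expectedQueries L = 0 := by
  simp [expectedQueries, run]

theorem run_sample [Fintype X] (L : AdjLists G) (μ : PMF X) :
    (sample μ : QueryAlg n X).run L = μ.map fun x => (x, 0) := by
  rw [sample, run, PMF.bind_map, PMF.map]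
  refine congrArg _ (funext fun x => ?_)
  simp [run]

@[simp] theorem outputDist_sample [Fintype X] (L : AdjLists G) (μ : PMF X) :
    (sample μ : QueryAlg n X).outputDist L = μ := by
  rw [outputDist, run_sample, PMF.map_comp]; exact PMF.map_id _

/-! ### Probabilities -/

theorem pr_nonneg (L : AdjLists G) (A : QueryAlg n Ω) (x : Ω) : 0 ≤ pr L A x :=
  ENNReal.toReal_nonneg

theorem ofReal_pr (L : AdjLists G) (A : QueryAlg n Ω) (x : Ω) :
    ENNReal.ofReal (pr L A x) = A.outputDist L x :=
  ENNReal.ofReal_toReal (PMF.apply_ne_top _ _)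

theorem sum_pr [Fintype Ω] (L : AdjLists G) (A : QueryAlg n Ω) : ∑ x, pr L A x = 1 := by
  simp only [pr]
  rw [← ENNReal.toReal_sum fun x _ => PMF.apply_ne_top _ _, ← tsum_fintype (L := .unconditional _),
    PMF.tsum_coe, ENNReal.toReal_one]

theorem sum_pr_some [Fintype X] (L : AdjLists G) (A : QueryAlg n (Option X)) :
    ∑ x, pr L A (some x) = 1 - pr L A none := by
  have := sum_pr L A
  rw [Fintype.sum_option] at this
  linarith

theorem sum_pr_some_le_one [Fintype X] (L : AdjLists G) (A : QueryAlg n (Option X)) :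
    ∑ x, pr L A (some x) ≤ 1 := by
  rw [sum_pr_some]; linarith [pr_nonneg L A none]

theorem pr_bind [Fintype Ω] (L : AdjLists G) (A : QueryAlg n Ω) (g : Ω → QueryAlg n Ω')
    (y : Ω') : pr L (bind A g) y = ∑ x, pr L A x * pr L (g x) y := by
  simp only [pr, outputDist_bind, PMF.bind_apply]
  rw [tsum_fintype, ENNReal.toReal_sum]
  · simp_rw [ENNReal.toReal_mul]
  · intro x _
    exact ENNReal.mul_ne_top (PMF.apply_ne_top _ _) (PMF.apply_ne_top _ _)

theorem pr_output [DecidableEq Ω] (L : AdjLists G) (x y : Ω) :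
    pr L (output x : QueryAlg n Ω) y = if y = x then 1 else 0 := by
  rw [pr, outputDist_output, PMF.pure_apply]; split_ifs <;> simp

@[simp] theorem pr_output_none_some (L : AdjLists G) (y : X) :
    pr L (output none : QueryAlg n (Option X)) (some y) = 0 := by
  classical rw [pr_output]; simp

theorem pr_bindO [Fintype X] (L : AdjLists G) (A : QueryAlg n (Option X))
    (g : X → QueryAlg n (Option Y)) (y : Y) :
    pr L (bindO A g) (some y) = ∑ x, pr L A (some x) * pr L (g x) (some y) := by
  rw [bindO, pr_bind, Fintype.sum_option]; simp

theorem pr_pick [Fintype X] [DecidableEq X] (L : AdjLists G) (s : Finset X) (x : X) :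
    pr L (pick s : QueryAlg n (Option X)) (some x) = if x ∈ s then 1 / (s.card : ℝ) else 0 := by
  rw [pick]
  split_ifs with h hx hx
  · rw [pr, outputDist_sample, PMF.map_apply, tsum_eq_single x]
    · simp [PMF.uniformOfFinset_apply, hx]
    · intro b hb; simp [Ne.symm hb]
  · rw [pr, outputDist_sample, PMF.map_apply, tsum_eq_single x]
    · simp [PMF.uniformOfFinset_apply, hx]
    · intro b hb; simp [Ne.symm hb]
  · exact absurd ⟨x, hx⟩ h
  · simp

theorem pr_coin (L : AdjLists G) {a : ℝ} (h0 : 0 ≤ a) (h1 : a ≤ 1) :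
    pr L (coin a : QueryAlg n (Option Unit)) (some ()) = a := by
  have h2 : min (ENNReal.ofReal a) 1 = ENNReal.ofReal a := min_eq_left (by simpa using h1)
  rw [pr, coin, outputDist_sample, PMF.ofFintype_apply, Option.elim_some, h2,
    ENNReal.toReal_ofReal h0]

/-! ### Numbers of queries -/

theorem CostLe.mono {L : AdjLists G} {A : QueryAlg n Ω} {a b : ℝ} (h : CostLe L A a)
    (hab : a ≤ b) : CostLe L A b := h.trans (ENNReal.ofReal_le_ofReal hab)

theorem MaxLe.mono {L : AdjLists G} {A : QueryAlg n Ω} {a b : ℕ} (h : MaxLe L A a)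
    (hab : a ≤ b) : MaxLe L A b := fun p hp => (h p hp).trans hab

theorem MaxLe.output (L : AdjLists G) (x : Ω) (m : ℕ) :
    MaxLe L (output x : QueryAlg n Ω) m := by
  intro p hp; simp [run] at hp; simp [hp]

theorem MaxLe.sample [Fintype X] (L : AdjLists G) (μ : PMF X) (m : ℕ) :
    MaxLe L (sample μ : QueryAlg n X) m := by
  intro p hp
  rw [run_sample, PMF.mem_support_map_iff] at hp
  obtain ⟨a, -, rfl⟩ := hp
  simp

theorem MaxLe.coin (L : AdjLists G) (a : ℝ) (m : ℕ) :
    MaxLe L (coin a : QueryAlg n (Option Unit)) m := MaxLe.sample L _ m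

theorem MaxLe.pick [Fintype X] (L : AdjLists G) (s : Finset X) (m : ℕ) :
    MaxLe L (pick s : QueryAlg n (Option X)) m := by
  rw [QueryAlg.pick]; split_ifs
  · exact MaxLe.sample L _ m
  · exact MaxLe.output L _ m

theorem MaxLe.costLe {L : AdjLists G} {A : QueryAlg n Ω} {m : ℕ} (h : MaxLe L A m) :
    CostLe L A m := by
  rw [CostLe, expectedQueries, ENNReal.ofReal_natCast]
  calc ∑' p, A.run L p * (p.2 : ℝ≥0∞) ≤ ∑' p, A.run L p * (m : ℝ≥0∞) := by
        refine ENNReal.tsum_le_tsum fun p => ?_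
        by_cases hp : p ∈ (A.run L).support
        · gcongr; exact_mod_cast h p hp
        · rw [(PMF.apply_eq_zero_iff _ _).2 hp]; simp
    _ = m := by rw [ENNReal.tsum_mul_right, PMF.tsum_coe, one_mul]

theorem MaxLe.bindC {L : AdjLists G} {A : QueryAlg n Ω} {g : Ω → ℕ → QueryAlg n Ω'} {m : ℕ}
    (h : ∀ p ∈ (A.run L).support, ∃ a, p.2 + a ≤ m ∧ MaxLe L (g p.1 p.2) a) :
    MaxLe L (bindC A g) m := by
  intro q hq
  rw [run_bindC, PMF.mem_support_bind_iff] at hq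
  obtain ⟨p, hp, hq⟩ := hq
  rw [PMF.mem_support_map_iff] at hq
  obtain ⟨q', hq', rfl⟩ := hq
  obtain ⟨a, ha, hm⟩ := h p hp
  exact (Nat.add_le_add_left (hm q' hq') _).trans ha

theorem MaxLe.bind {L : AdjLists G} {A : QueryAlg n Ω} {g : Ω → QueryAlg n Ω'} {a b : ℕ}
    (hA : MaxLe L A a) (hg : ∀ x, A.outputDist L x ≠ 0 → MaxLe L (g x) b) :
    MaxLe L (bind A g) (a + b) := by
  refine MaxLe.bindC fun p hp => ⟨b, Nat.add_le_add_right (hA p hp) _, hg _ ?_⟩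
  rw [← PMF.mem_support_iff, outputDist, PMF.mem_support_map_iff]
  exact ⟨p, hp, rfl⟩

theorem MaxLe.bindO {L : AdjLists G} {A : QueryAlg n (Option X)}
    {g : X → QueryAlg n (Option Y)} {a b : ℕ}
    (hA : MaxLe L A a) (hg : ∀ x, pr L A (some x) ≠ 0 → MaxLe L (g x) b) :
    MaxLe L (bindO A g) (a + b) := by
  refine hA.bind fun o ho => ?_
  cases o with
  | none => exact MaxLe.output L _ _
  | some x => exact hg x fun h => ho (by rw [← ofReal_pr, h, ENNReal.ofReal_zero])

theorem CostLe.bind [Fintype Ω] {L : AdjLists G} {A : QueryAlg n Ω} {g : Ω → QueryAlg n Ω'}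
    {a : ℝ} {h : Ω → ℝ} (ha : 0 ≤ a) (hh : ∀ x, 0 ≤ h x)
    (hA : CostLe L A a) (hg : ∀ x, pr L A x ≠ 0 → CostLe L (g x) (h x)) :
    CostLe L (bind A g) (a + ∑ x, pr L A x * h x) := by
  rw [CostLe, expectedQueries_bind, tsum_fintype, ENNReal.ofReal_add ha
    (Finset.sum_nonneg fun x _ => mul_nonneg (pr_nonneg L A x) (hh x)),
    ENNReal.ofReal_sum_of_nonneg fun x _ => mul_nonneg (pr_nonneg L A x) (hh x)]
  refine add_le_add hA (Finset.sum_le_sum fun x _ => ?_)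
  rw [ENNReal.ofReal_mul (pr_nonneg L A x), ofReal_pr]
  by_cases hx : pr L A x = 0
  · rw [← ofReal_pr, hx]; simp
  · exact mul_le_mul_right (hg x hx) _

theorem CostLe.output (L : AdjLists G) (x : Ω) (a : ℝ) :
    CostLe L (output x : QueryAlg n Ω) a := by simp [CostLe]

theorem CostLe.bindO [Fintype X] {L : AdjLists G} {A : QueryAlg n (Option X)}
    {g : X → QueryAlg n (Option Y)} {a : ℝ} {h : X → ℝ} (ha : 0 ≤ a) (hh : ∀ x, 0 ≤ h x)
    (hA : CostLe L A a) (hg : ∀ x, pr L A (some x) ≠ 0 → CostLe L (g x) (h x)) :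
    CostLe L (bindO A g) (a + ∑ x, pr L A (some x) * h x) := by
  have := CostLe.bind (L := L) (A := A) (g := fun o => o.elim (.output none) g)
    (h := fun o => o.elim 0 h) ha (by rintro (_ | x) <;> simp [hh]) hA
    (by rintro (_ | x) hx
        · exact CostLe.output L _ _
        · exact hg x hx)
  rw [Fintype.sum_option] at this
  simpa [QueryAlg.bindO] using this

/-! ### Deterministic subroutines -/

theorem Det.output (L : AdjLists G) (x : Ω) (m : ℕ) : Det L (output x : QueryAlg n Ω) x m :=
  ⟨0, Nat.zero_le _, rfl⟩

theorem Det.ask {L : AdjLists G} {q : GraphQuery n} {next : q.Answer → QueryAlg n Ω} {x : Ω}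
    {m : ℕ} (h : Det L (next (L.answer q)) x m) : Det L (ask q next) x (m + 1) := by
  obtain ⟨c, hc, h⟩ := h
  exact ⟨c + 1, by omega, by rw [run, h, PMF.pure_map]⟩

theorem Det.run_bind {L : AdjLists G} {A : QueryAlg n Ω} {x : Ω} {m : ℕ} (h : Det L A x m)
    (g : Ω → QueryAlg n Ω') :
    ∃ c ≤ m, (QueryAlg.bind A g).run L = ((g x).run L).map fun q => (q.1, c + q.2) := by
  obtain ⟨c, hc, h⟩ := h
  exact ⟨c, hc, by rw [QueryAlg.run_bind, h, PMF.pure_bind]⟩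

theorem Det.outputDist {L : AdjLists G} {A : QueryAlg n Ω} {x : Ω} {m : ℕ} (h : Det L A x m) :
    A.outputDist L = PMF.pure x := by
  obtain ⟨c, hc, h⟩ := h
  rw [QueryAlg.outputDist, h, PMF.pure_map]

theorem Det.maxLe {L : AdjLists G} {A : QueryAlg n Ω} {x : Ω} {m : ℕ} (h : Det L A x m) :
    MaxLe L A m := by
  obtain ⟨c, hc, h⟩ := h
  intro p hp; rw [h] at hp; simp at hp; simp [hp, hc]

theorem Det.bind {L : AdjLists G} {A : QueryAlg n Ω} {x : Ω} {a b : ℕ} (h : Det L A x a)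
    {g : Ω → QueryAlg n Ω'} {y : Ω'} (hg : Det L (g x) y b) : Det L (bind A g) y (a + b) := by
  obtain ⟨c, hc, e⟩ := h.run_bind g
  obtain ⟨c', hc', e'⟩ := hg
  exact ⟨c + c', by omega, by rw [e, e', PMF.pure_map]⟩

theorem Det.mono {L : AdjLists G} {A : QueryAlg n Ω} {x : Ω} {a b : ℕ} (h : Det L A x a)
    (hab : a ≤ b) : Det L A x b := by
  obtain ⟨c, hc, h⟩ := h
  exact ⟨c, hc.trans hab, h⟩

theorem Det.pr_bind {L : AdjLists G} {A : QueryAlg n Ω} {x : Ω} {m : ℕ} (h : Det L A x m)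
    (g : Ω → QueryAlg n Ω') (y : Ω') : pr L (QueryAlg.bind A g) y = pr L (g x) y := by
  rw [pr, outputDist_bind, h.outputDist, PMF.pure_bind, pr]

theorem Det.maxLe_bind {L : AdjLists G} {A : QueryAlg n Ω} {x : Ω} {a b : ℕ} (h : Det L A x a)
    {g : Ω → QueryAlg n Ω'} (hg : MaxLe L (g x) b) : MaxLe L (QueryAlg.bind A g) (a + b) := by
  refine h.maxLe.bind fun y hy => ?_
  rw [h.outputDist, ← PMF.mem_support_iff, PMF.mem_support_pure_iff] at hy
  exact hy ▸ hg

theorem Det.costLe_bind {L : AdjLists G} {A : QueryAlg n Ω} {x : Ω} {m : ℕ} (h : Det L A x m)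
    {g : Ω → QueryAlg n Ω'} {c : ℝ} (hc : 0 ≤ c) (hg : CostLe L (g x) c) :
    CostLe L (QueryAlg.bind A g) (m + c) := by
  rw [CostLe, expectedQueries_bind, h.outputDist, tsum_pure_mul,
    ENNReal.ofReal_add (Nat.cast_nonneg _) hc]
  exact add_le_add h.maxLe.costLe hg

end QueryAlg

end CliqueSampling

namespace CliqueSampling

/-! ### Bounded orientations and clique counts -/

/-- Root every tree of a forest: each vertex points to the next vertex on the path to the root of
its tree, and every edge is one of these pointers. -/
theorem exists_pointer_of_isAcyclic {V : Type*} {F : SimpleGraph V} (hF : F.IsAcyclic) :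
    ∃ f : V → V, ∀ u v, F.Adj u v → f u = v ∨ f v = u := by
  classical
  have hreach : ∀ v, F.Reachable v (F.connectedComponentMk v).out := fun v =>
    SimpleGraph.ConnectedComponent.exact (Quot.out_eq (F.connectedComponentMk v)).symm
  choose p hp using fun v => (hreach v).exists_isPath
  have key : ∀ (u v : V) (r s : V) (hrs : r = s) (p : F.Walk u r) (q : F.Walk v s), p.IsPath →
      q.IsPath → F.Adj u v → u ∉ q.support → p.snd = v := by
    intro u v r s hrs p q hp hq huv hu
    subst hrs
    have h1 : (SimpleGraph.Walk.cons huv q).IsPath := hq.cons hu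
    have h2 : p = SimpleGraph.Walk.cons huv q :=
      congrArg Subtype.val ((hF.subsingleton_path u r).elim ⟨p, hp⟩ ⟨_, h1⟩)
    rw [h2]; simp
  refine ⟨fun v => (p v).snd, fun u v huv => ?_⟩
  have hc : (F.connectedComponentMk u).out = (F.connectedComponentMk v).out := by
    rw [SimpleGraph.ConnectedComponent.sound huv.reachable]
  by_cases hu : u ∈ (p v).support
  · by_cases hv : v ∈ (p u).support
    · exfalso
      have hlen : ∀ (u v r s : V) (hrs : r = s) (p : F.Walk u r) (q : F.Walk v s), p.IsPath →
          q.IsPath → v ∈ p.support → u ≠ v → q.length < p.length := by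
        intro u v r s hrs p q hp hq hv hne
        subst hrs
        have h2 : q = p.dropUntil v hv :=
          congrArg Subtype.val ((hF.subsingleton_path v r).elim ⟨q, hq⟩ ⟨_, hp.dropUntil hv⟩)
        have h3 := congrArg SimpleGraph.Walk.length (p.take_spec hv)
        rw [SimpleGraph.Walk.length_append, ← h2] at h3
        have h4 : 0 < (p.takeUntil v hv).length := by
          rcases Nat.eq_zero_or_pos (p.takeUntil v hv).length with h | h
          · exact absurd (SimpleGraph.Walk.eq_of_length_eq_zero h) hne
          · exact h
        omega
      have a := hlen u v _ _ hc _ _ (hp u) (hp v) hv huv.ne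
      have b := hlen v u _ _ hc.symm _ _ (hp v) (hp u) hu huv.ne'
      omega
    · exact Or.inr (key v u _ _ hc.symm _ _ (hp v) (hp u) huv.symm hv)
  · exact Or.inl (key u v _ _ hc _ _ (hp u) (hp v) huv hu)

/-- A graph of arboricity at most `a` has an orientation with out-degrees at most `a`. -/
theorem exists_orientation {V : Type*} {G : SimpleGraph V} {a : ℕ}
    (h : arboricity G ≤ (a : ℕ∞)) :
    ∃ N : V → Finset V, (∀ v, (N v).card ≤ a) ∧ ∀ u v, G.Adj u v → v ∈ N u ∨ u ∈ N v := by
  classical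
  obtain ⟨b, hb, hG⟩ : ∃ b : ℕ, b ≤ a ∧ HasForestPartition G b := by
    by_contra hcon
    push Not at hcon
    have : ((a + 1 : ℕ) : ℕ∞) ≤ arboricity G := by
      refine le_iInf fun b => le_iInf fun hb => ?_
      by_contra hlt
      rw [not_le, Nat.cast_lt] at hlt
      exact hcon b (by omega) hb
    have h2 := this.trans h
    rw [Nat.cast_le] at h2
    omega
  obtain ⟨F, hac, -, rfl⟩ := hG
  choose f hf using fun i => exists_pointer_of_isAcyclic (hac i)
  refine ⟨fun v => Finset.univ.image fun i => f i v, fun v => ?_, fun u v huv => ?_⟩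
  · exact Finset.card_image_le.trans (by simpa using hb)
  · rw [SimpleGraph.iSup_adj] at huv
    obtain ⟨i, hi⟩ := huv
    rcases hf i u v hi with h | h
    · exact Or.inl (Finset.mem_image.2 ⟨i, Finset.mem_univ _, h⟩)
    · exact Or.inr (Finset.mem_image.2 ⟨i, Finset.mem_univ _, h⟩)

theorem sum_le_sum_of_forall_exists {ι κ : Type*} {S : Finset ι} {T : Finset κ}
    (f : κ → ι) (g : ι → ℕ) (h : ∀ x ∈ S, ∃ t ∈ T, f t = x) :
    ∑ x ∈ S, g x ≤ ∑ t ∈ T, g (f t) := by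
  classical
  calc ∑ x ∈ S, g x ≤ ∑ x ∈ S, ∑ t ∈ T, if f t = x then g x else 0 := by
        refine Finset.sum_le_sum fun x hx => ?_
        obtain ⟨t, ht, e⟩ := h x hx
        refine le_trans ?_ (Finset.single_le_sum (fun _ _ => Nat.zero_le _) ht)
        simp [e]
    _ = ∑ t ∈ T, ∑ x ∈ S, if f t = x then g x else 0 := Finset.sum_comm
    _ ≤ ∑ t ∈ T, g (f t) := by
        refine Finset.sum_le_sum fun t _ => ?_
        rw [Finset.sum_ite_eq]
        split_ifs <;> simp

section Cliques

variable {n : ℕ} {G : SimpleGraph (Fin n)}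

open Classical in
/-- The finite set of cliques of size `i`. -/
noncomputable def cliques (G : SimpleGraph (Fin n)) (i : ℕ) : Finset (Finset (Fin n)) :=
  Finset.univ.filter fun C => G.IsNClique i C

theorem mem_cliques {i : ℕ} {C : Finset (Fin n)} : C ∈ cliques G i ↔ G.IsNClique i C := by
  simp [cliques]

theorem coe_cliques (i : ℕ) : (cliques G i : Set (Finset (Fin n))) = G.cliqueSet i := by
  ext C; simp [mem_cliques, SimpleGraph.mem_cliqueSet_iff]

theorem card_cliques (i : ℕ) : (cliques G i).card = numCliques G i := by
  rw [numCliques, ← coe_cliques, Set.ncard_coe_finset]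

theorem card_cliques_le {i k : ℕ} (hik : i ≤ k) (hn : 1 ≤ n) : (cliques G i).card ≤ n ^ k := by
  calc (cliques G i).card ≤ ((Finset.univ : Finset (Fin n)).powersetCard i).card := by
        refine Finset.card_le_card fun C hC => ?_
        simp [Finset.mem_powersetCard, (mem_cliques.1 hC).card_eq]
    _ ≤ n ^ i := by
        rw [Finset.card_powersetCard, Finset.card_univ, Fintype.card_fin]
        exact Nat.choose_le_pow n i
    _ ≤ n ^ k := Nat.pow_le_pow_right hn hik

theorem erase_mem_cliques {i : ℕ} {C : Finset (Fin n)} (hC : C ∈ cliques G (i + 1))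
    {w : Fin n} (hw : w ∈ C) : C.erase w ∈ cliques G i := by
  rw [mem_cliques] at hC ⊢
  exact hC.erase_of_mem hw

theorem adj_of_mem_cliques {i : ℕ} {C : Finset (Fin n)} (hC : C ∈ cliques G i)
    {u w : Fin n} (hu : u ∈ C) (hw : w ∈ C) (h : u ≠ w) : G.Adj u w :=
  (mem_cliques.1 hC).isClique hu hw h

/-- Each `(i+1)`-clique arises from an `i`-clique by adding an out-neighbor of one of its
vertices. -/
theorem sum_cliques_succ_le {a i : ℕ} (hi : 1 ≤ i) {N : Fin n → Finset (Fin n)}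
    (hN : ∀ v, (N v).card ≤ a) (hG : ∀ u v, G.Adj u v → v ∈ N u ∨ u ∈ N v)
    (g : Finset (Fin n) → ℕ) (hg : ∀ w K, K.Nonempty → g (insert w K) ≤ g K) :
    ∑ C ∈ cliques G (i + 1), g C ≤ (i * a) * ∑ K ∈ cliques G i, g K := by
  calc ∑ C ∈ cliques G (i + 1), g C
      ≤ ∑ t ∈ (cliques G i).sigma fun K => K.sigma fun u => N u, g (insert t.2.2 t.1) := by
        refine sum_le_sum_of_forall_exists
          (fun t : Σ _ : Finset (Fin n), Σ _ : Fin n, Fin n => insert t.2.2 t.1) g fun C hC => ?_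
        have hc : 1 < C.card := by rw [(mem_cliques.1 hC).card_eq]; omega
        obtain ⟨u, hu, w, hw, huw⟩ := Finset.one_lt_card.1 hc
        have key : ∀ u ∈ C, ∀ w ∈ C, u ≠ w → w ∈ N u →
            ∃ t ∈ (cliques G i).sigma fun K => K.sigma fun u => N u, insert t.2.2 t.1 = C := by
          intro u hu w hw huw hwu
          refine ⟨⟨C.erase w, u, w⟩, ?_, Finset.insert_erase hw⟩
          simp only [Finset.mem_sigma, Finset.mem_erase]
          exact ⟨erase_mem_cliques hC hw, ⟨huw, hu⟩, hwu⟩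
        rcases hG u w (adj_of_mem_cliques hC hu hw huw) with h | h
        · exact key u hu w hw huw h
        · exact key w hw u hu huw.symm h
    _ ≤ ∑ t ∈ (cliques G i).sigma fun K => K.sigma fun u => N u, g t.1 := by
        refine Finset.sum_le_sum fun t ht => hg _ _ ?_
        simp only [Finset.mem_sigma] at ht
        exact ⟨_, ht.2.1⟩
    _ = ∑ K ∈ cliques G i, (∑ u ∈ K, (N u).card) * g K := by
        rw [Finset.sum_sigma]
        refine Finset.sum_congr rfl fun K _ => ?_
        dsimp only
        rw [Finset.sum_const, smul_eq_mul, Finset.card_sigma]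
    _ ≤ ∑ K ∈ cliques G i, (i * a) * g K := by
        refine Finset.sum_le_sum fun K hK => Nat.mul_le_mul_right _ ?_
        rw [← (mem_cliques.1 hK).card_eq, ← smul_eq_mul, ← Finset.sum_const]
        exact Finset.sum_le_sum fun u _ => hN u
    _ = (i * a) * ∑ K ∈ cliques G i, g K := by rw [Finset.mul_sum]

/-- The sets obtained from `C` by dropping a vertex of `W`. -/
def dropEach (W C : Finset (Fin n)) : Finset (Finset (Fin n)) := W.image fun w => C.erase w

theorem card_dropEach {W C : Finset (Fin n)} (h : W ⊆ C) : (dropEach W C).card = W.card :=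
  Finset.card_image_of_injOn fun _ ha _ hb e => Finset.erase_injOn _ (h ha) (h hb) e

theorem mem_dropEach {W C K : Finset (Fin n)} :
    K ∈ dropEach W C ↔ ∃ w ∈ W, C.erase w = K := Finset.mem_image

theorem dropEach_subset_cliques {i : ℕ} {W C : Finset (Fin n)} (h : W ⊆ C)
    (hC : C ∈ cliques G (i + 1)) : dropEach W C ⊆ cliques G i := by
  intro K hK
  obtain ⟨w, hw, rfl⟩ := mem_dropEach.1 hK
  exact erase_mem_cliques hC (h hw)

/-- Among any family `U` of `i`-cliques there are few incidences with `(i+1)`-cliques that have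
two facets in `U`: such a clique is determined by one of these facets, a vertex of it and an
out-neighbor of that vertex. -/
theorem sum_two_facets_le {a i b : ℕ} {N : Fin n → Finset (Fin n)}
    (hN : ∀ v, (N v).card ≤ a) (hG : ∀ u v, G.Adj u v → v ∈ N u ∨ u ∈ N v)
    (W : Finset (Fin n) → Finset (Fin n)) (hW : ∀ C, W C ⊆ C)
    (hb : ∀ C ∈ cliques G (i + 1), (W C).card = b)
    (U : Finset (Finset (Fin n))) (hU : U ⊆ cliques G i) :
    ∑ K ∈ U, ((cliques G (i + 1)).filter fun C => K ∈ dropEach (W C) C ∧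
        ∃ K' ∈ dropEach (W C) C, K' ≠ K ∧ K' ∈ U).card ≤ (b * (i * a)) * U.card := by
  classical
  set S := (cliques G (i + 1)).filter fun C => ∃ K ∈ U, K ∈ dropEach (W C) C ∧
        ∃ K' ∈ dropEach (W C) C, K' ≠ K ∧ K' ∈ U with hS
  have h1 : S ⊆ U.biUnion fun K => K.biUnion fun u => (N u).image fun w => insert w K := by
    intro C hC
    rw [hS, Finset.mem_filter] at hC
    obtain ⟨hC, K, hK, hKC, K', hKC', hne, hK'⟩ := hC
    obtain ⟨w, hw, rfl⟩ := mem_dropEach.1 hKC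
    obtain ⟨w', hw', rfl⟩ := mem_dropEach.1 hKC'
    have hww : w ≠ w' := fun e => hne (by rw [e])
    have hwC := hW C hw
    have hwC' := hW C hw'
    simp only [Finset.mem_biUnion, Finset.mem_image]
    rcases hG w w' (adj_of_mem_cliques hC hwC hwC' hww) with h | h
    · exact ⟨C.erase w', hK', w, by simp [hww, hwC], w', h, Finset.insert_erase hwC'⟩
    · exact ⟨C.erase w, hK, w', by simp [hww.symm, hwC'], w, h, Finset.insert_erase hwC⟩
  have h2 : S.card ≤ U.card * (i * a) := by
    refine (Finset.card_le_card h1).trans (Finset.card_biUnion_le_card_mul _ _ _ fun K hK => ?_)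
    rw [← (mem_cliques.1 (hU hK)).card_eq]
    exact Finset.card_biUnion_le_card_mul _ _ _ fun u _ => Finset.card_image_le.trans (hN u)
  calc ∑ K ∈ U, ((cliques G (i + 1)).filter fun C => K ∈ dropEach (W C) C ∧
        ∃ K' ∈ dropEach (W C) C, K' ≠ K ∧ K' ∈ U).card
      ≤ ∑ K ∈ U, ∑ C ∈ S, if K ∈ dropEach (W C) C then 1 else 0 := by
        refine Finset.sum_le_sum fun K hK => ?_
        rw [← Finset.sum_filter, ← Finset.card_eq_sum_ones]
        refine Finset.card_le_card fun C hC => ?_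
        rw [Finset.mem_filter] at hC
        rw [Finset.mem_filter, hS, Finset.mem_filter]
        exact ⟨⟨hC.1, K, hK, hC.2⟩, hC.2.1⟩
    _ = ∑ C ∈ S, ∑ K ∈ U, if K ∈ dropEach (W C) C then 1 else 0 := Finset.sum_comm
    _ ≤ ∑ C ∈ S, b := by
        refine Finset.sum_le_sum fun C hC => ?_
        have hC' := (Finset.mem_filter.1 hC).1
        rw [← Finset.sum_filter, ← Finset.card_eq_sum_ones, ← hb C hC', ← card_dropEach (hW C)]
        exact Finset.card_le_card fun K hK => (Finset.mem_filter.1 hK).2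
    _ ≤ (b * (i * a)) * U.card := by
        rw [Finset.sum_const, smul_eq_mul]
        calc S.card * b ≤ (U.card * (i * a)) * b := Nat.mul_le_mul_right _ h2
          _ = _ := by ring

/-! ### The degree order -/

/-- The strict linear order by `d`, with ties broken by the label. -/
def Prec (d : Fin n → ℕ) (v w : Fin n) : Prop := d v < d w ∨ (d v = d w ∧ v < w)

theorem Prec.irrefl (d : Fin n → ℕ) (v : Fin n) : ¬ Prec d v v := by simp [Prec]

theorem Prec.trans {d : Fin n → ℕ} {u v w : Fin n} (h : Prec d u v) (h' : Prec d v w) :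
    Prec d u w := by
  unfold Prec at *
  rcases h with h | h <;> rcases h' with h' | h'
  · left; omega
  · left; omega
  · left; omega
  · right; exact ⟨by omega, h.2.trans h'.2⟩

theorem Prec.total {d : Fin n → ℕ} {v w : Fin n} (h : v ≠ w) : Prec d v w ∨ Prec d w v := by
  unfold Prec
  rcases lt_trichotomy (d v) (d w) with h1 | h1 | h1
  · exact Or.inl (Or.inl h1)
  · rcases lt_or_gt_of_ne h with h2 | h2
    · exact Or.inl (Or.inr ⟨h1, h2⟩)
    · exact Or.inr (Or.inr ⟨h1.symm, h2⟩)
  · exact Or.inr (Or.inl h1)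

theorem exists_root (d : Fin n → ℕ) {K : Finset (Fin n)} (hK : K.Nonempty) :
    ∃ v ∈ K, ∀ w ∈ K, w ≠ v → Prec d v w := by
  induction hK using Finset.Nonempty.cons_induction with
  | singleton a => exact ⟨a, by simp, by simp⟩
  | cons a s ha hs ih =>
    obtain ⟨v, hv, h⟩ := ih
    have hav : a ≠ v := fun e => ha (e ▸ hv)
    rcases Prec.total (d := d) hav with h1 | h1
    · refine ⟨a, by simp, fun w hw hne => ?_⟩
      rcases Finset.mem_cons.1 hw with rfl | hw
      · exact absurd rfl hne
      · by_cases e : w = v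
        · exact e ▸ h1
        · exact h1.trans (h w hw e)
    · refine ⟨v, by simp [hv], fun w hw hne => ?_⟩
      rcases Finset.mem_cons.1 hw with rfl | hw
      · exact h1
      · exact h w hw hne

/-- The first vertex of a nonempty set in the order by `d`. -/
noncomputable def root (d : Fin n → ℕ) (K : Finset (Fin n)) (hK : K.Nonempty) : Fin n :=
  (exists_root d hK).choose

theorem root_mem (d : Fin n → ℕ) {K : Finset (Fin n)} (hK : K.Nonempty) : root d K hK ∈ K :=
  (exists_root d hK).choose_spec.1

theorem root_prec (d : Fin n → ℕ) {K : Finset (Fin n)} (hK : K.Nonempty) {w : Fin n}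
    (hw : w ∈ K) (h : w ≠ root d K hK) : Prec d (root d K hK) w :=
  (exists_root d hK).choose_spec.2 w hw h

theorem root_le (d : Fin n → ℕ) {K : Finset (Fin n)} (hK : K.Nonempty) {w : Fin n}
    (hw : w ∈ K) : d (root d K hK) ≤ d w := by
  by_cases h : w = root d K hK
  · rw [← h]
  · rcases root_prec d hK hw h with h | h <;> omega

theorem root_congr {d d' : Fin n → ℕ} {K : Finset (Fin n)} (hK : K.Nonempty)
    (h : ∀ v ∈ K, d v = d' v) : root d K hK = root d' K hK := by
  by_contra hne
  have h1 := root_prec d hK (root_mem d' hK) (Ne.symm hne)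
  have h2 := root_prec d' hK (root_mem d hK) hne
  unfold Prec at h1 h2
  rw [h _ (root_mem d' hK), h _ (root_mem d hK)] at h1
  rcases h1 with h1 | h1 <;> rcases h2 with h2 | h2
  · omega
  · omega
  · omega
  · exact absurd h1.2 h2.2.asymm

open Classical in
/-- All vertices of a set but the first one in the order by `d`. -/
noncomputable def nonRoot (d : Fin n → ℕ) (C : Finset (Fin n)) : Finset (Fin n) :=
  C.filter fun w => ∃ v ∈ C, Prec d v w

theorem mem_nonRoot {d : Fin n → ℕ} {C : Finset (Fin n)} {w : Fin n} :
    w ∈ nonRoot d C ↔ w ∈ C ∧ ∃ v ∈ C, Prec d v w := by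
  simp [nonRoot]

theorem nonRoot_subset (d : Fin n → ℕ) (C : Finset (Fin n)) : nonRoot d C ⊆ C :=
  fun _ h => (mem_nonRoot.1 h).1

theorem nonRoot_eq (d : Fin n → ℕ) {C : Finset (Fin n)} (hC : C.Nonempty) :
    nonRoot d C = C.erase (root d C hC) := by
  ext w
  rw [mem_nonRoot, Finset.mem_erase]
  constructor
  · rintro ⟨hw, v, hv, hvw⟩
    refine ⟨fun e => ?_, hw⟩
    by_cases hv' : v = root d C hC
    · rw [e, ← hv'] at hvw; exact Prec.irrefl _ _ hvw
    · exact Prec.irrefl _ _ ((e ▸ hvw).trans (root_prec d hC hv hv'))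
  · rintro ⟨h, hw⟩
    exact ⟨hw, root d C hC, root_mem d hC, root_prec d hC hw h⟩

theorem card_nonRoot (d : Fin n → ℕ) {i : ℕ} {C : Finset (Fin n)} (hC : C.card = i + 1) :
    (nonRoot d C).card = i := by
  have h : C.Nonempty := Finset.card_pos.1 (by omega)
  rw [nonRoot_eq d h, Finset.card_erase_of_mem (root_mem d h), hC]; rfl

theorem nonRoot_congr {d d' : Fin n → ℕ} {C : Finset (Fin n)} (h : ∀ v ∈ C, d v = d' v) :
    nonRoot d C = nonRoot d' C := by
  ext w
  simp only [mem_nonRoot, Prec]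
  refine and_congr_right fun hw => exists_congr fun v => and_congr_right fun hv => ?_
  rw [h v hv, h w hw]

theorem mem_nonRoot_insert (d : Fin n → ℕ) {K : Finset (Fin n)} (hK : K.Nonempty)
    {w : Fin n} : w ∈ nonRoot d (insert w K) ↔ Prec d (root d K hK) w := by
  rw [mem_nonRoot]
  constructor
  · rintro ⟨-, v, hv, hvw⟩
    rcases Finset.mem_insert.1 hv with rfl | hv
    · exact absurd hvw (Prec.irrefl _ _)
    · by_cases e : v = root d K hK
      · exact e ▸ hvw
      · exact (root_prec d hK hv e).trans hvw
  · intro h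
    exact ⟨by simp, _, Finset.mem_insert_of_mem (root_mem d hK), h⟩

end Cliques

end CliqueSampling

namespace CliqueSampling

/-! ### Random walks on systems of facets -/

/-- Two families of objects ("faces" and "cells") such that every cell has exactly `b ≥ 2`
facets among the faces. -/
structure FacetSystem (X : Type) [DecidableEq X] where
  faces : Finset X
  cells : Finset X
  facets : X → Finset X
  b : ℕ
  two_le : 2 ≤ b
  facets_subset : ∀ C ∈ cells, facets C ⊆ faces
  card_facets : ∀ C ∈ cells, (facets C).card = b

namespace FacetSystem

variable {X : Type} [DecidableEq X] (S : FacetSystem X)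

/-- `K` is a facet of the cell `C`. -/
def Inc (K C : X) : Prop := C ∈ S.cells ∧ K ∈ S.facets C

/-- The number of cells of which `K` is a facet. -/
def deg (K : X) : ℕ := (S.cells.filter fun C => K ∈ S.facets C).card

/-- The probability to move from the cell `C`, entered through its facet `K`, to the facet `K'`:
another facet is chosen uniformly. -/
noncomputable def switch (K C K' : X) : ℝ :=
  if K' ∈ (S.facets C).erase K then 1 / (((S.facets C).erase K).card : ℝ) else 0

variable {S} in
theorem Inc.mem_faces {K C : X} (h : S.Inc K C) : K ∈ S.faces := S.facets_subset C h.1 h.2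

variable {S} in
theorem switch_nonneg (K C K' : X) : 0 ≤ S.switch K C K' := by
  unfold switch; split_ifs <;> positivity

theorem b_sub_one_pos : (0 : ℝ) < S.b - 1 := by
  have : (2 : ℝ) ≤ S.b := by exact_mod_cast S.two_le
  linarith

variable {S} in
theorem sum_const_facets {c : ℝ} {K C : X} (hKC : S.Inc K C) :
    ∑ _K' ∈ (S.facets C).erase K, c / (S.b - 1) = c := by
  rw [Finset.sum_const, Finset.card_erase_of_mem hKC.2, S.card_facets C hKC.1, nsmul_eq_mul,
    Nat.cast_sub (by have := S.two_le; omega), Nat.cast_one, mul_div_cancel₀]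
  exact S.b_sub_one_pos.ne'

variable (base : X → ℝ) (fr ct : X → X → ℝ)

/-- `mass t K C` is the probability that after `t` moves the walk is at the cell `C`, entered
through the facet `K`. The walk starts at a face drawn according to `base`, enters the first cell
with the kernel `fr`, and all later ones, after a switch of the facet, with the kernel `ct`. -/
noncomputable def mass [Fintype X] : ℕ → X → X → ℝ
  | 0, K, C => base K * fr K C
  | t + 1, K', C' => (∑ p : X × X, mass t p.1 p.2 * S.switch p.1 p.2 K') * ct K' C'

/-- The probability that the `(t+1)`-st move of the walk leads to the face `K'`. -/
noncomputable def inflow [Fintype X] (t : ℕ) (K' : X) : ℝ :=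
  ∑ p : X × X, S.mass base fr ct t p.1 p.2 * S.switch p.1 p.2 K'

/-- The expected number of visits to the pair `(K, C)` within the first `T` moves. -/
noncomputable def visits [Fintype X] (T : ℕ) (K C : X) : ℝ :=
  ∑ t ∈ Finset.range (T + 1), S.mass base fr ct t K C

/-- The conditions on the kernels which make the walk visit all pairs (facet, cell) about equally
often. A face of degree at most `σ` is left mainly through `fr`, with probability about `1 / τ`
to each cell; at a face of larger degree the two kernels share the work, as `ct` enters each cell
with probability about `s / deg`, and `fr` with probability about `(1 - s) / τ`. -/
structure GoodKernels (pl ph τ σ δ u : ℝ) : Prop where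
  pl_nonneg : 0 ≤ pl
  τ_pos : 0 < τ
  δ_pos : 0 < δ
  δ_lt : δ < 1
  one_le_u : 1 ≤ u
  base_zero : ∀ K ∉ S.faces, base K = 0
  base_ge : ∀ K ∈ S.faces, pl ≤ base K
  base_le : ∀ K ∈ S.faces, base K ≤ ph
  fr_nonneg : ∀ K C, 0 ≤ fr K C
  ct_nonneg : ∀ K C, 0 ≤ ct K C
  fr_zero : ∀ K ∈ S.faces, ∀ C, ¬ S.Inc K C → fr K C = 0
  ct_zero : ∀ K ∈ S.faces, ∀ C, ¬ S.Inc K C → ct K C = 0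
  upper : ∀ K, ∃ s : ℝ, 0 ≤ s ∧ s ≤ 1 ∧ ∀ C, S.Inc K C →
    fr K C ≤ (1 - s) / τ ∧ (S.deg K : ℝ) * ct K C ≤ u * s
  lower_of_le : ∀ K C, S.Inc K C → (S.deg K : ℝ) ≤ σ → (1 - δ) ^ 3 / τ ≤ fr K C
  lower_of_gt : ∀ K C, S.Inc K C → σ < S.deg K → ∀ y : ℝ, 0 ≤ y → y ≤ 1 →
    (1 - δ) ^ 2 * y ≤ fr K C * τ + y * (S.deg K * ct K C)

variable {S base fr ct} {pl ph τ σ δ u : ℝ}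

theorem mass_succ [Fintype X] (t : ℕ) (K C : X) :
    S.mass base fr ct (t + 1) K C = S.inflow base fr ct t K * ct K C := rfl

theorem visits_succ [Fintype X] (T : ℕ) (K C : X) :
    S.visits base fr ct (T + 1) K C = base K * fr K C +
      (∑ t ∈ Finset.range (T + 1), S.inflow base fr ct t K) * ct K C := by
  rw [visits, Finset.sum_range_succ', add_comm, Finset.sum_mul]
  rfl

namespace GoodKernels

variable (h : S.GoodKernels base fr ct pl ph τ σ δ u)
include h

theorem base_nonneg (K : X) : 0 ≤ base K := by
  by_cases hK : K ∈ S.faces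
  · exact h.pl_nonneg.trans (h.base_ge K hK)
  · rw [h.base_zero K hK]

theorem ph_nonneg_of_inc {K C : X} (hKC : S.Inc K C) : 0 ≤ ph :=
  h.pl_nonneg.trans ((h.base_ge K hKC.mem_faces).trans (h.base_le K hKC.mem_faces))

variable [Fintype X]

theorem mass_nonneg (t : ℕ) (K C : X) : 0 ≤ S.mass base fr ct t K C := by
  induction t generalizing K C with
  | zero => exact mul_nonneg (h.base_nonneg K) (h.fr_nonneg K C)
  | succ t ih =>
    exact mul_nonneg (Finset.sum_nonneg fun p _ => mul_nonneg (ih _ _) (switch_nonneg _ _ _))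
      (h.ct_nonneg _ _)

theorem visits_nonneg (T : ℕ) (K C : X) : 0 ≤ S.visits base fr ct T K C :=
  Finset.sum_nonneg fun t _ => h.mass_nonneg t K C

theorem mass_eq_zero (t : ℕ) {K C : X} (hKC : ¬ S.Inc K C) :
    S.mass base fr ct t K C = 0 := by
  induction t generalizing K C with
  | zero =>
    by_cases hK : K ∈ S.faces
    · simp [mass, h.fr_zero K hK C hKC]
    · simp [mass, h.base_zero K hK]
  | succ t ih =>
    rw [mass_succ]
    by_cases hK : K ∈ S.faces
    · rw [h.ct_zero K hK C hKC, mul_zero]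
    · rw [inflow, Finset.sum_eq_zero, zero_mul]
      rintro ⟨K', C'⟩ -
      by_cases hi : S.Inc K' C'
      · have : S.switch K' C' K = 0 := by
          rw [switch, if_neg]
          intro hmem
          exact hK (S.facets_subset C' hi.1 (Finset.mem_of_mem_erase hmem))
        dsimp only
        rw [this, mul_zero]
      · dsimp only
        rw [ih hi, zero_mul]

theorem inflow_eq (t : ℕ) (K : X) :
    S.inflow base fr ct t K = ∑ C ∈ S.cells.filter fun C => K ∈ S.facets C,
      ∑ K' ∈ (S.facets C).erase K, S.mass base fr ct t K' C / (S.b - 1) := by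
  rw [inflow, Fintype.sum_prod_type_right, ← Finset.sum_subset (Finset.subset_univ
    (S.cells.filter fun C => K ∈ S.facets C))]
  · refine Finset.sum_congr rfl fun C hC => ?_
    rw [Finset.mem_filter] at hC
    rw [← Finset.sum_subset (Finset.subset_univ ((S.facets C).erase K))]
    · refine Finset.sum_congr rfl fun K' hK' => ?_
      rw [Finset.mem_erase] at hK'
      rw [switch, if_pos (Finset.mem_erase.2 ⟨hK'.1.symm, hC.2⟩),
        Finset.card_erase_of_mem hK'.2, S.card_facets C hC.1,
        Nat.cast_sub (by have := S.two_le; omega)]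
      simp [div_eq_mul_inv]
    · intro K' _ hK'
      rw [Finset.mem_erase, not_and_or, not_not] at hK'
      rcases hK' with rfl | hK'
      · simp [switch]
      · rw [h.mass_eq_zero t (fun hi => hK' hi.2), zero_mul]
  · intro C _ hC
    refine Finset.sum_eq_zero fun K' _ => ?_
    by_cases hi : S.Inc K' C
    · rw [Finset.mem_filter, not_and] at hC
      rw [switch, if_neg fun hmem => hC hi.1 (Finset.mem_of_mem_erase hmem), mul_zero]
    · rw [h.mass_eq_zero t hi, zero_mul]

theorem inflow_nonneg (t : ℕ) (K : X) : 0 ≤ S.inflow base fr ct t K :=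
  Finset.sum_nonneg fun _ _ => mul_nonneg (h.mass_nonneg _ _ _) (switch_nonneg _ _ _)

theorem sum_inflow_eq (T : ℕ) (K : X) :
    ∑ t ∈ Finset.range (T + 1), S.inflow base fr ct t K =
      ∑ C ∈ S.cells.filter fun C => K ∈ S.facets C,
      ∑ K' ∈ (S.facets C).erase K, S.visits base fr ct T K' C / (S.b - 1) := by
  simp_rw [h.inflow_eq]
  rw [Finset.sum_comm]
  refine Finset.sum_congr rfl fun C _ => ?_
  rw [Finset.sum_comm]
  refine Finset.sum_congr rfl fun K' _ => ?_
  rw [visits, Finset.sum_div]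

theorem sum_inflow_le_of {T : ℕ} {M : ℝ}
    (hM : ∀ K C, S.Inc K C → S.visits base fr ct T K C ≤ M) (K : X) :
    ∑ t ∈ Finset.range (T + 1), S.inflow base fr ct t K ≤ S.deg K * M := by
  rw [h.sum_inflow_eq, deg, ← nsmul_eq_mul, ← Finset.sum_const]
  refine Finset.sum_le_sum fun C hC => ?_
  rw [Finset.mem_filter] at hC
  rw [← sum_const_facets (c := M) (show S.Inc K C from hC)]
  refine Finset.sum_le_sum fun K' hK' => ?_
  exact div_le_div_of_nonneg_right (hM _ _ ⟨hC.1, Finset.mem_of_mem_erase hK'⟩)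
    S.b_sub_one_pos.le

/-- A conservation argument: if no pair is visited more than `M` times, then the inflow of a face
`K` is at most `deg K * M`, and `ct` spreads it evenly. -/
theorem visits_le (T : ℕ) {K C : X} (hKC : S.Inc K C) :
    S.visits base fr ct T K C ≤ ph / τ * u ^ T := by
  induction T generalizing K C with
  | zero =>
    obtain ⟨s, hs0, hs1, hs⟩ := h.upper K
    have h1 := (hs C hKC).1
    have h2 : fr K C ≤ 1 / τ := h1.trans (div_le_div_of_nonneg_right (by linarith) h.τ_pos.le)
    simp only [visits, zero_add, Finset.range_one, Finset.sum_singleton, mass, pow_zero, mul_one]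
    calc base K * fr K C ≤ ph * (1 / τ) := mul_le_mul (h.base_le K hKC.mem_faces) h2
          (h.fr_nonneg _ _) (h.ph_nonneg_of_inc hKC)
      _ = ph / τ := by ring
  | succ T ih =>
    obtain ⟨s, hs0, hs1, hs⟩ := h.upper K
    obtain ⟨h1, h2⟩ := hs C hKC
    have hph := h.ph_nonneg_of_inc hKC
    have hq : 0 ≤ ph / τ * u ^ T :=
      mul_nonneg (div_nonneg hph h.τ_pos.le) (pow_nonneg (by linarith [h.one_le_u]) _)
    have h3 := h.sum_inflow_le_of (fun K C hKC => ih hKC) K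
    rw [visits_succ]
    have hu : 1 ≤ u ^ (T + 1) := one_le_pow₀ h.one_le_u
    calc base K * fr K C + (∑ t ∈ Finset.range (T + 1), S.inflow base fr ct t K) * ct K C
        ≤ ph * ((1 - s) / τ) + (S.deg K * (ph / τ * u ^ T)) * ct K C :=
          add_le_add (mul_le_mul (h.base_le K hKC.mem_faces) h1 (h.fr_nonneg _ _) hph)
            (mul_le_mul_of_nonneg_right h3 (h.ct_nonneg _ _))
      _ = ph / τ * (1 - s) + (ph / τ * u ^ T) * (S.deg K * ct K C) := by ring
      _ ≤ ph / τ * (1 - s) + (ph / τ * u ^ T) * (u * s) := by gcongr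
      _ = ph / τ * ((1 - s) * 1 + s * u ^ (T + 1)) := by ring
      _ ≤ ph / τ * ((1 - s) * u ^ (T + 1) + s * u ^ (T + 1)) := by
          have : 0 ≤ ph / τ := div_nonneg hph h.τ_pos.le
          have : 0 ≤ 1 - s := by linarith
          gcongr
      _ = ph / τ * u ^ (T + 1) := by ring

theorem inflow_le {t T : ℕ} (htT : t ≤ T) (K : X) :
    S.inflow base fr ct t K ≤ S.deg K * (ph / τ * u ^ T) :=
  (Finset.single_le_sum (f := fun t => S.inflow base fr ct t K)
    (fun t _ => h.inflow_nonneg t K) (Finset.mem_range.2 (Nat.lt_succ_of_le htT))).trans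
    (h.sum_inflow_le_of (fun _ _ hKC => h.visits_le T hKC) K)

end GoodKernels

variable (S) in
/-- The faces that are not yet reached sufficiently often within `j` moves: a face of degree
more than `σ` stays in this set as long as more than a fraction `δ` of its cells have another
facet in it. -/
noncomputable def unsettled (σ δ : ℝ) : ℕ → Finset X
  | 0 => by classical exact S.faces.filter fun K => σ < S.deg K
  | j + 1 => by classical exact (unsettled σ δ j).filter fun K => δ * S.deg K <
      ((S.cells.filter fun C => K ∈ S.facets C ∧
        ∃ K' ∈ S.facets C, K' ≠ K ∧ K' ∈ unsettled σ δ j).card : ℝ)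

theorem unsettled_succ_subset (j : ℕ) : S.unsettled σ δ (j + 1) ⊆ S.unsettled σ δ j := by
  classical
  intro K hK
  simp only [unsettled, Finset.mem_filter] at hK
  exact hK.1

theorem lt_deg_of_mem_unsettled {j : ℕ} {K : X} (hK : K ∈ S.unsettled σ δ j) :
    K ∈ S.faces ∧ σ < S.deg K := by
  classical
  induction j with
  | zero => simpa [unsettled] using hK
  | succ j ih => exact ih (unsettled_succ_subset j hK)

/-- If every set of faces spans few incidences, the set of unsettled faces halves in each step. -/
theorem card_unsettled {D : ℕ} (hD : 0 < D) (hδ : 0 < δ) (hσ : 2 * D ≤ δ * σ)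
    (hcount : ∀ U ⊆ S.faces, ∑ K ∈ U, (S.cells.filter fun C => K ∈ S.facets C ∧
        ∃ K' ∈ S.facets C, K' ≠ K ∧ K' ∈ U).card ≤ D * U.card) (j : ℕ) :
    2 ^ j * (S.unsettled σ δ j).card ≤ S.faces.card := by
  classical
  induction j with
  | zero => simpa [unsettled] using Finset.card_filter_le _ _
  | succ j ih =>
    set U := S.unsettled σ δ j with hU
    set U' := S.unsettled σ δ (j + 1) with hU'
    have h1 : ∀ K ∈ U', δ * σ ≤ ((S.cells.filter fun C => K ∈ S.facets C ∧
        ∃ K' ∈ S.facets C, K' ≠ K ∧ K' ∈ U).card : ℝ) := by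
      intro K hK
      have h2 := (lt_deg_of_mem_unsettled hK).2
      rw [hU'] at hK
      simp only [unsettled, Finset.mem_filter] at hK
      have h3 := hK.2
      refine le_trans (mul_le_mul_of_nonneg_left h2.le hδ.le) (le_of_lt ?_)
      convert h3
    have h2 : (U'.card : ℝ) * (δ * σ) ≤ D * U.card := by
      calc (U'.card : ℝ) * (δ * σ) = ∑ _K ∈ U', δ * σ := by rw [Finset.sum_const, nsmul_eq_mul]
        _ ≤ ∑ K ∈ U', ((S.cells.filter fun C => K ∈ S.facets C ∧
            ∃ K' ∈ S.facets C, K' ≠ K ∧ K' ∈ U).card : ℝ) := Finset.sum_le_sum h1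
        _ ≤ ∑ K ∈ U, ((S.cells.filter fun C => K ∈ S.facets C ∧
            ∃ K' ∈ S.facets C, K' ≠ K ∧ K' ∈ U).card : ℝ) :=
          Finset.sum_le_sum_of_subset_of_nonneg (unsettled_succ_subset j)
            fun _ _ _ => Nat.cast_nonneg _
        _ ≤ D * U.card := by
          exact_mod_cast hcount U fun K hK => (lt_deg_of_mem_unsettled hK).1
    have h3 : 2 * (U'.card : ℝ) ≤ U.card := by
      have hD' : (0 : ℝ) < D := by exact_mod_cast hD
      have : (U'.card : ℝ) * (2 * D) ≤ D * U.card :=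
        (mul_le_mul_of_nonneg_left hσ (Nat.cast_nonneg _)).trans h2
      nlinarith
    have h4 : 2 * U'.card ≤ U.card := by exact_mod_cast h3
    calc 2 ^ (j + 1) * U'.card = 2 ^ j * (2 * U'.card) := by ring
      _ ≤ 2 ^ j * U.card := Nat.mul_le_mul_left _ h4
      _ ≤ _ := ih

theorem unsettled_eq_empty {D : ℕ} (hD : 0 < D) (hδ : 0 < δ) (hσ : 2 * D ≤ δ * σ)
    (hcount : ∀ U ⊆ S.faces, ∑ K ∈ U, (S.cells.filter fun C => K ∈ S.facets C ∧
        ∃ K' ∈ S.facets C, K' ≠ K ∧ K' ∈ U).card ≤ D * U.card) {j : ℕ}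
    (hj : S.faces.card < 2 ^ j) : S.unsettled σ δ j = ∅ := by
  have h1 := card_unsettled hD hδ hσ hcount j
  rw [← Finset.card_eq_zero]
  by_contra hne
  have : 2 ^ j * 1 ≤ 2 ^ j * (S.unsettled σ δ j).card :=
    Nat.mul_le_mul_left _ (Nat.one_le_iff_ne_zero.2 hne)
  omega

namespace GoodKernels

variable [Fintype X] (h : S.GoodKernels base fr ct pl ph τ σ δ u)
include h

/-- A settled face receives almost its full inflow, as most of its cells have only settled other
facets. -/
theorem le_visits (T : ℕ) {K C : X} (hKC : S.Inc K C) (hK : K ∉ S.unsettled σ δ T) :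
    pl / τ * (1 - δ) ^ (3 * T + 3) ≤ S.visits base fr ct T K C := by
  classical
  have hδ0 : 0 ≤ 1 - δ := by linarith [h.δ_lt]
  have hδ1 : 1 - δ ≤ 1 := by linarith [h.δ_pos]
  have hq : 0 ≤ pl / τ := div_nonneg h.pl_nonneg h.τ_pos.le
  induction T generalizing K C with
  | zero =>
    have hd : (S.deg K : ℝ) ≤ σ := by
      by_contra hcon
      exact hK (by simpa [unsettled] using ⟨hKC.mem_faces, not_le.1 hcon⟩)
    have h1 := h.lower_of_le K C hKC hd
    simp only [visits, zero_add, Finset.range_one, Finset.sum_singleton, mass, mul_zero]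
    calc pl / τ * (1 - δ) ^ 3 = pl * ((1 - δ) ^ 3 / τ) := by ring
      _ ≤ base K * fr K C := mul_le_mul (h.base_ge K hKC.mem_faces) h1
          (div_nonneg (pow_nonneg hδ0 _) h.τ_pos.le) (h.base_nonneg K)
  | succ T ih =>
    by_cases hKT : K ∈ S.unsettled σ δ T
    · have hσ := (lt_deg_of_mem_unsettled hKT).2
      set bad := S.cells.filter fun C => K ∈ S.facets C ∧
        ∃ K' ∈ S.facets C, K' ≠ K ∧ K' ∈ S.unsettled σ δ T with hbad
      have hb : (bad.card : ℝ) ≤ δ * S.deg K := by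
        by_contra hcon
        refine hK ?_
        simp only [unsettled, Finset.mem_filter]
        refine ⟨hKT, ?_⟩
        convert not_le.1 hcon
      set M := pl / τ * (1 - δ) ^ (3 * T + 3) with hM
      have hM0 : 0 ≤ M := mul_nonneg hq (pow_nonneg hδ0 _)
      have hin : (1 - δ) * S.deg K * M ≤
          ∑ t ∈ Finset.range (T + 1), S.inflow base fr ct t K := by
        rw [h.sum_inflow_eq]
        set all := S.cells.filter fun C => K ∈ S.facets C with hall
        have hsub : bad ⊆ all := fun C hC => by
          rw [hbad, Finset.mem_filter] at hC
          rw [hall, Finset.mem_filter]; exact ⟨hC.1, hC.2.1⟩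
        have hcard : ((all \ bad).card : ℝ) = S.deg K - bad.card := by
          rw [Finset.card_sdiff_of_subset hsub, Nat.cast_sub (Finset.card_le_card hsub)]; rfl
        calc (1 - δ) * S.deg K * M ≤ (all \ bad).card * M := by
              rw [hcard]; exact mul_le_mul_of_nonneg_right (by linarith) hM0
          _ = ∑ C ∈ all \ bad, M := by rw [Finset.sum_const, nsmul_eq_mul]
          _ ≤ ∑ C ∈ all \ bad, ∑ K' ∈ (S.facets C).erase K,
                S.visits base fr ct T K' C / (S.b - 1) := by
              refine Finset.sum_le_sum fun C hC => ?_
              rw [Finset.mem_sdiff, hall, Finset.mem_filter, hbad, Finset.mem_filter] at hC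
              obtain ⟨⟨hC1, hC2⟩, hC3⟩ := hC
              rw [← sum_const_facets (c := M) (show S.Inc K C from ⟨hC1, hC2⟩)]
              refine Finset.sum_le_sum fun K' hK' =>
                div_le_div_of_nonneg_right ?_ S.b_sub_one_pos.le
              rw [Finset.mem_erase] at hK'
              exact ih ⟨hC1, hK'.2⟩ fun hu => hC3 ⟨hC1, hC2, K', hK'.2, hK'.1, hu⟩
          _ ≤ _ := Finset.sum_le_sum_of_subset_of_nonneg Finset.sdiff_subset
              fun C _ _ => Finset.sum_nonneg fun K' _ =>
                div_nonneg (h.visits_nonneg _ _ _) S.b_sub_one_pos.le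
      rw [visits_succ]
      have hy := h.lower_of_gt K C hKC hσ ((1 - δ) ^ (3 * T + 4)) (pow_nonneg hδ0 _)
        (pow_le_one₀ hδ0 hδ1)
      calc pl / τ * (1 - δ) ^ (3 * (T + 1) + 3)
          = pl / τ * ((1 - δ) ^ 2 * (1 - δ) ^ (3 * T + 4)) := by ring
        _ ≤ pl / τ * (fr K C * τ + (1 - δ) ^ (3 * T + 4) * (S.deg K * ct K C)) := by gcongr
        _ = pl * fr K C + ((1 - δ) * S.deg K * M) * ct K C := by
            have := h.τ_pos.ne'
            rw [hM, mul_add]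
            congr 1
            · field_simp
            · ring
        _ ≤ _ := add_le_add
            (mul_le_mul_of_nonneg_right (h.base_ge K hKC.mem_faces) (h.fr_nonneg _ _))
            (mul_le_mul_of_nonneg_right hin (h.ct_nonneg _ _))
    · calc pl / τ * (1 - δ) ^ (3 * (T + 1) + 3) ≤ pl / τ * (1 - δ) ^ (3 * T + 3) :=
            mul_le_mul_of_nonneg_left (pow_le_pow_of_le_one hδ0 hδ1 (by omega)) hq
        _ ≤ S.visits base fr ct T K C := ih hKC hKT
        _ ≤ _ := by
            rw [visits, visits, Finset.sum_range_succ _ (T + 1)]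
            linarith [h.mass_nonneg (T + 1) K C]

end GoodKernels

end FacetSystem

end CliqueSampling

namespace CliqueSampling

namespace QueryAlg

variable {n : ℕ} {X Y : Type} [Fintype X] [DecidableEq X] {G : SimpleGraph (Fin n)}

/-- The walk on a system of facets as an algorithm: a face is produced by `A`, the first cell is
entered by `fresh`, and each later one by `cont`, after the algorithm `fac` has determined the
facets of the present cell. The output is the last cell with the facet through which it was
entered. -/
noncomputable def walkSteps (A : QueryAlg n (Option X)) (fresh cont : X → QueryAlg n (Option X))
    (fac : X → QueryAlg n (Finset X)) : ℕ → QueryAlg n (Option (X × X))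
  | 0 => bindO A fun K => bindO (fresh K) fun C => output (some (K, C))
  | t + 1 => bindO (walkSteps A fresh cont fac t) fun p => bind (fac p.2) fun F =>
      bindO (pick (F.erase p.1)) fun K => bindO (cont K) fun C => output (some (K, C))

/-- The cell reached by the walk after a uniformly random number of at most `J` moves. -/
noncomputable def walk (A : QueryAlg n (Option X)) (fresh cont : X → QueryAlg n (Option X))
    (fac : X → QueryAlg n (Finset X)) (J : ℕ) : QueryAlg n (Option X) :=
  bindO (pick (Finset.univ : Finset (Fin (J + 1)))) fun t =>
    bindO (walkSteps A fresh cont fac t) fun p => output (some p.2)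

theorem pr_output_some (L : AdjLists G) [DecidableEq Y] (x y : Y) :
    pr L (output (some x) : QueryAlg n (Option Y)) (some y) = if y = x then 1 else 0 := by
  rw [pr_output]; simp

theorem pr_bindO_pair (L : AdjLists G) (B : QueryAlg n (Option X)) (K K' C : X) :
    pr L (bindO B fun C => output (some (K, C))) (some (K', C)) =
      if K' = K then pr L B (some C) else 0 := by
  rw [pr_bindO]
  simp only [pr_output_some, Prod.mk.injEq]
  by_cases h : K' = K
  · simp [h]
  · simp [h]

variable {L : AdjLists G} {A : QueryAlg n (Option X)} {fresh cont : X → QueryAlg n (Option X)}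
  {fac : X → QueryAlg n (Finset X)} {S : FacetSystem X} {pl ph τ σ δ u : ℝ}

theorem pr_bindO_pick_switch (K C K' C' : X) :
    pr L (bindO (pick ((S.facets C).erase K)) fun K => bindO (cont K) fun C =>
      output (some (K, C))) (some (K', C')) =
      S.switch K C K' * pr L (cont K') (some C') := by
  rw [pr_bindO]
  simp only [pr_bindO_pair, pr_pick]
  rw [Finset.sum_eq_single K']
  · simp [FacetSystem.switch]
  · intro b _ hb; simp [Ne.symm hb]
  · simp

theorem pr_walkSteps {mF : ℕ}
    (h : S.GoodKernels (fun K => pr L A (some K)) (fun K C => pr L (fresh K) (some C))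
      (fun K C => pr L (cont K) (some C)) pl ph τ σ δ u)
    (hfac : ∀ C ∈ S.cells, Det L (fac C) (S.facets C) mF) (t : ℕ) (K C : X) :
    pr L (walkSteps A fresh cont fac t) (some (K, C)) =
      S.mass (fun K => pr L A (some K)) (fun K C => pr L (fresh K) (some C))
      (fun K C => pr L (cont K) (some C)) t K C := by
  induction t generalizing K C with
  | zero =>
    rw [walkSteps, pr_bindO, FacetSystem.mass]
    simp only [pr_bindO_pair]
    simp
  | succ t ih =>
    rw [walkSteps, pr_bindO, FacetSystem.mass_succ, FacetSystem.inflow, Finset.sum_mul]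
    refine Finset.sum_congr rfl fun p _ => ?_
    rw [show p = (p.1, p.2) from rfl, ih]
    by_cases hi : S.Inc p.1 p.2
    · rw [(hfac _ hi.1).pr_bind, pr_bindO_pick_switch, mul_assoc]
    · rw [h.mass_eq_zero t hi]; simp

theorem pr_walk {mF : ℕ}
    (h : S.GoodKernels (fun K => pr L A (some K)) (fun K C => pr L (fresh K) (some C))
      (fun K C => pr L (cont K) (some C)) pl ph τ σ δ u)
    (hfac : ∀ C ∈ S.cells, Det L (fac C) (S.facets C) mF) (J : ℕ) (C : X) :
    pr L (walk A fresh cont fac J) (some C) = 1 / (J + 1) * ∑ K,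
      S.visits (fun K => pr L A (some K)) (fun K C => pr L (fresh K) (some C))
      (fun K C => pr L (cont K) (some C)) J K C := by
  rw [walk, pr_bindO]
  have h1 : ∀ t : ℕ, pr L (bindO (walkSteps A fresh cont fac t) fun p => output (some p.2))
      (some C) = ∑ K, S.mass (fun K => pr L A (some K)) (fun K C => pr L (fresh K) (some C))
      (fun K C => pr L (cont K) (some C)) t K C := by
    intro t
    rw [pr_bindO, Fintype.sum_prod_type]
    refine Finset.sum_congr rfl fun K _ => ?_
    simp only [pr_walkSteps h hfac, pr_output_some]
    simp
  simp only [h1, pr_pick, Finset.mem_univ, if_true, Finset.card_univ, Fintype.card_fin]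
  rw [← Finset.mul_sum, Finset.sum_comm]
  push_cast
  congr 1
  refine Finset.sum_congr rfl fun K _ => ?_
  rw [FacetSystem.visits, ← Fin.sum_univ_eq_sum_range]

theorem pr_walk_eq_zero {mF : ℕ}
    (h : S.GoodKernels (fun K => pr L A (some K)) (fun K C => pr L (fresh K) (some C))
      (fun K C => pr L (cont K) (some C)) pl ph τ σ δ u)
    (hfac : ∀ C ∈ S.cells, Det L (fac C) (S.facets C) mF) (J : ℕ) {C : X} (hC : C ∉ S.cells) :
    pr L (walk A fresh cont fac J) (some C) = 0 := by
  rw [pr_walk h hfac, Finset.sum_eq_zero, mul_zero]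
  intro K _
  exact Finset.sum_eq_zero fun t _ => h.mass_eq_zero t fun hi => hC hi.1

theorem pr_walk_eq_sum_facets {mF : ℕ}
    (h : S.GoodKernels (fun K => pr L A (some K)) (fun K C => pr L (fresh K) (some C))
      (fun K C => pr L (cont K) (some C)) pl ph τ σ δ u)
    (hfac : ∀ C ∈ S.cells, Det L (fac C) (S.facets C) mF) (J : ℕ) (C : X) :
    pr L (walk A fresh cont fac J) (some C) = 1 / (J + 1) * ∑ K ∈ S.facets C,
      S.visits (fun K => pr L A (some K)) (fun K C => pr L (fresh K) (some C))
      (fun K C => pr L (cont K) (some C)) J K C := by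
  rw [pr_walk h hfac]
  congr 1
  symm
  refine Finset.sum_subset (Finset.subset_univ _) fun K _ hK => ?_
  exact Finset.sum_eq_zero fun t _ => h.mass_eq_zero t fun hi => hK hi.2

theorem pr_walk_le {mF : ℕ}
    (h : S.GoodKernels (fun K => pr L A (some K)) (fun K C => pr L (fresh K) (some C))
      (fun K C => pr L (cont K) (some C)) pl ph τ σ δ u)
    (hfac : ∀ C ∈ S.cells, Det L (fac C) (S.facets C) mF) (J : ℕ) {C : X} (hC : C ∈ S.cells) :
    pr L (walk A fresh cont fac J) (some C) ≤ S.b / ((J + 1) * τ) * ph * u ^ J := by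
  rw [pr_walk_eq_sum_facets h hfac]
  calc _ ≤ 1 / ((J : ℝ) + 1) * ∑ K ∈ S.facets C, ph / τ * u ^ J := by
        refine mul_le_mul_of_nonneg_left (Finset.sum_le_sum fun K hK => ?_) (by positivity)
        exact h.visits_le J ⟨hC, hK⟩
    _ = _ := by
        rw [Finset.sum_const, S.card_facets C hC, nsmul_eq_mul]
        have := h.τ_pos.ne'
        field_simp

theorem le_pr_walk {mF : ℕ}
    (h : S.GoodKernels (fun K => pr L A (some K)) (fun K C => pr L (fresh K) (some C))
      (fun K C => pr L (cont K) (some C)) pl ph τ σ δ u)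
    (hfac : ∀ C ∈ S.cells, Det L (fac C) (S.facets C) mF) {J : ℕ}
    (hJ : S.unsettled σ δ J = ∅) {C : X} (hC : C ∈ S.cells) :
    S.b / ((J + 1) * τ) * pl * (1 - δ) ^ (3 * J + 3) ≤
      pr L (walk A fresh cont fac J) (some C) := by
  rw [pr_walk_eq_sum_facets h hfac]
  calc _ = 1 / ((J : ℝ) + 1) * ∑ K ∈ S.facets C, pl / τ * (1 - δ) ^ (3 * J + 3) := by
        rw [Finset.sum_const, S.card_facets C hC, nsmul_eq_mul]
        have := h.τ_pos.ne'
        field_simp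
    _ ≤ _ := by
        refine mul_le_mul_of_nonneg_left (Finset.sum_le_sum fun K hK => ?_) (by positivity)
        exact h.le_visits J ⟨hC, hK⟩ (by simp [hJ])

theorem sum_inflow_le_one {mF : ℕ}
    (h : S.GoodKernels (fun K => pr L A (some K)) (fun K C => pr L (fresh K) (some C))
      (fun K C => pr L (cont K) (some C)) pl ph τ σ δ u)
    (hfac : ∀ C ∈ S.cells, Det L (fac C) (S.facets C) mF) (t : ℕ) :
    ∑ K, S.inflow (fun K => pr L A (some K)) (fun K C => pr L (fresh K) (some C))
      (fun K C => pr L (cont K) (some C)) t K ≤ 1 := by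
  simp_rw [FacetSystem.inflow]
  rw [Finset.sum_comm]
  refine le_trans (Finset.sum_le_sum fun p _ => ?_)
    (sum_pr_some_le_one L (walkSteps A fresh cont fac t))
  rw [← Finset.mul_sum, show p = (p.1, p.2) from rfl, pr_walkSteps h hfac]
  refine mul_le_of_le_one_right (h.mass_nonneg _ _ _) ?_
  simp only [FacetSystem.switch]
  rw [Finset.sum_ite_mem, Finset.univ_inter, Finset.sum_const, nsmul_eq_mul, mul_one_div]
  exact div_self_le_one _

theorem costLe_walkSteps {mF : ℕ} {cA E F : ℝ} {cf cc : X → ℝ}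
    (h : S.GoodKernels (fun K => pr L A (some K)) (fun K C => pr L (fresh K) (some C))
      (fun K C => pr L (cont K) (some C)) pl ph τ σ δ u)
    (hfac : ∀ C ∈ S.cells, Det L (fac C) (S.facets C) mF) {J : ℕ}
    (hcA : 0 ≤ cA) (hA : CostLe L A cA) (hcf : ∀ K, 0 ≤ cf K) (hcc : ∀ K, 0 ≤ cc K)
    (hfresh : ∀ K ∈ S.faces, CostLe L (fresh K) (cf K))
    (hcont : ∀ K ∈ S.faces, CostLe L (cont K) (cc K))
    (hE : ∑ K, pr L A (some K) * cf K ≤ E) (hF0 : 0 ≤ F)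
    (hF : ∀ t < J, ∑ K, S.inflow (fun K => pr L A (some K)) (fun K C => pr L (fresh K) (some C))
      (fun K C => pr L (cont K) (some C)) t K * cc K ≤ F) (t : ℕ) (ht : t ≤ J) :
    CostLe L (walkSteps A fresh cont fac t) (cA + E + t * (mF + F)) := by
  have hE0 : 0 ≤ E := (Finset.sum_nonneg fun K _ => mul_nonneg (pr_nonneg _ _ _) (hcf K)).trans hE
  induction t with
  | zero =>
    have h1 : CostLe L (walkSteps A fresh cont fac 0) (cA + ∑ K, pr L A (some K) * cf K) := by
      refine CostLe.bindO hcA hcf hA fun K hK => ?_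
      have hK' : K ∈ S.faces := by by_contra hcon; exact hK (h.base_zero K hcon)
      refine (CostLe.bindO (h := fun _ => 0) (hcf K) (fun _ => le_rfl) (hfresh K hK')
        fun C _ => CostLe.output L _ _).mono ?_
      simp
    refine h1.mono ?_
    push_cast
    linarith
  | succ t ih =>
    have h1 := ih (by omega)
    have hc0 : 0 ≤ cA + E + t * (mF + F) := by positivity
    have h2 := CostLe.bindO (g := fun p : X × X => bind (fac p.2) fun F =>
      bindO (pick (F.erase p.1)) fun K => bindO (cont K) fun C => output (some (K, C)))
      (h := fun p : X × X => mF + ∑ K, S.switch p.1 p.2 K * cc K) hc0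
      (fun p => by
        refine add_nonneg (Nat.cast_nonneg _) (Finset.sum_nonneg fun K _ => mul_nonneg ?_ (hcc K))
        exact FacetSystem.switch_nonneg _ _ _) h1
      (fun p hp => by
        rw [show p = (p.1, p.2) from rfl, pr_walkSteps h hfac] at hp
        have hi : S.Inc p.1 p.2 := by
          by_contra hi; exact hp (h.mass_eq_zero t hi)
        refine (hfac _ hi.1).costLe_bind (Finset.sum_nonneg fun K _ =>
          mul_nonneg (FacetSystem.switch_nonneg _ _ _) (hcc K)) ?_
        have h3 := CostLe.bindO (L := L) (A := pick ((S.facets p.2).erase p.1))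
          (g := fun K => bindO (cont K) fun C => output (some (K, C))) (h := cc) le_rfl hcc
          (by simpa using (MaxLe.pick L ((S.facets p.2).erase p.1) 0).costLe) (fun K hK => by
            have hK' : K ∈ S.faces := by
              rw [pr_pick] at hK
              refine S.facets_subset _ hi.1 (Finset.mem_of_mem_erase (a := p.1) ?_)
              by_contra hcon; exact hK (if_neg hcon)
            refine (CostLe.bindO (h := fun _ => 0) (hcc K) (fun _ => le_rfl) (hcont K hK')
              fun C _ => CostLe.output L _ _).mono ?_
            simp)
        refine h3.mono ?_
        rw [zero_add]
        refine le_of_eq (Finset.sum_congr rfl fun K _ => ?_)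
        rw [pr_pick]; rfl)
    refine CostLe.mono (a := _) h2 ?_
    have h4 : ∑ p, pr L (walkSteps A fresh cont fac t) (some p) *
        (mF + ∑ K, S.switch p.1 p.2 K * cc K) ≤ mF + F := by
      simp_rw [mul_add, Finset.sum_add_distrib, ← Finset.sum_mul]
      refine add_le_add ?_ ?_
      · exact mul_le_of_le_one_left (Nat.cast_nonneg _) (sum_pr_some_le_one L _)
      · refine le_trans (le_of_eq ?_) (hF t (by omega))
        simp_rw [FacetSystem.inflow, Finset.mul_sum, Finset.sum_mul]
        rw [Finset.sum_comm]
        refine Finset.sum_congr rfl fun K _ => Finset.sum_congr rfl fun p _ => ?_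
        rw [show p = (p.1, p.2) from rfl, pr_walkSteps h hfac, mul_assoc]
    push_cast
    linarith

/-- The expected number of queries of the walk, in terms of those of its steps. -/
theorem costLe_walk {mF : ℕ} {cA E F : ℝ} {cf cc : X → ℝ}
    (h : S.GoodKernels (fun K => pr L A (some K)) (fun K C => pr L (fresh K) (some C))
      (fun K C => pr L (cont K) (some C)) pl ph τ σ δ u)
    (hfac : ∀ C ∈ S.cells, Det L (fac C) (S.facets C) mF) {J : ℕ}
    (hcA : 0 ≤ cA) (hA : CostLe L A cA) (hcf : ∀ K, 0 ≤ cf K) (hcc : ∀ K, 0 ≤ cc K)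
    (hfresh : ∀ K ∈ S.faces, CostLe L (fresh K) (cf K))
    (hcont : ∀ K ∈ S.faces, CostLe L (cont K) (cc K))
    (hE : ∑ K, pr L A (some K) * cf K ≤ E) (hF0 : 0 ≤ F)
    (hF : ∀ t < J, ∑ K, S.inflow (fun K => pr L A (some K)) (fun K C => pr L (fresh K) (some C))
      (fun K C => pr L (cont K) (some C)) t K * cc K ≤ F) :
    CostLe L (walk A fresh cont fac J) (cA + E + J * (mF + F)) := by
  have hE0 : 0 ≤ E := (Finset.sum_nonneg fun K _ => mul_nonneg (pr_nonneg _ _ _) (hcf K)).trans hE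
  have h0 : 0 ≤ cA + E + J * (mF + F) := by positivity
  have h1 := CostLe.bindO (L := L) (A := pick (Finset.univ : Finset (Fin (J + 1))))
    (g := fun t => bindO (walkSteps A fresh cont fac t) fun p => output (some p.2))
    (h := fun _ => cA + E + J * (mF + F)) le_rfl (fun _ => h0)
    (by simpa using (MaxLe.pick L (Finset.univ : Finset (Fin (J + 1))) 0).costLe)
    (fun t _ => by
      have ht : (t : ℕ) ≤ J := Nat.lt_succ_iff.1 t.2
      have h2 : cA + E + (t : ℕ) * (mF + F) ≤ cA + E + J * (mF + F) := by
        have : ((t : ℕ) : ℝ) ≤ J := by exact_mod_cast ht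
        gcongr
      refine (CostLe.bindO (h := fun _ => 0) h0 (fun _ => le_rfl)
        ((costLe_walkSteps h hfac hcA hA hcf hcc hfresh hcont hE hF0 hF t ht).mono h2)
        fun C _ => CostLe.output L _ _).mono ?_
      simp)
  refine h1.mono ?_
  rw [zero_add, ← Finset.sum_mul]
  exact mul_le_of_le_one_left h0 (sum_pr_some_le_one L _)

theorem maxLe_walk {mF mA m : ℕ}
    (h : S.GoodKernels (fun K => pr L A (some K)) (fun K C => pr L (fresh K) (some C))
      (fun K C => pr L (cont K) (some C)) pl ph τ σ δ u)
    (hfac : ∀ C ∈ S.cells, Det L (fac C) (S.facets C) mF) (J : ℕ)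
    (hA : MaxLe L A mA) (hfresh : ∀ K ∈ S.faces, MaxLe L (fresh K) m)
    (hcont : ∀ K ∈ S.faces, MaxLe L (cont K) m) :
    MaxLe L (walk A fresh cont fac J) (mA + m + J * (mF + m)) := by
  have key : ∀ t : ℕ, MaxLe L (walkSteps A fresh cont fac t) (mA + m + t * (mF + m)) := by
    intro t
    induction t with
    | zero =>
      refine MaxLe.mono (a := mA + (m + 0)) (hA.bindO fun K hK => ?_) (by omega)
      have hK' : K ∈ S.faces := by by_contra hcon; exact hK (h.base_zero K hcon)
      exact (hfresh K hK').bindO fun C _ => MaxLe.output L _ _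
    | succ t ih =>
      refine MaxLe.mono (a := (mA + m + t * (mF + m)) + (mF + (0 + (m + 0))))
        (ih.bindO fun p hp => ?_) (by rw [add_mul]; omega)
      rw [show p = (p.1, p.2) from rfl, pr_walkSteps h hfac] at hp
      have hi : S.Inc p.1 p.2 := by
        by_contra hi; exact hp (h.mass_eq_zero t hi)
      refine (hfac _ hi.1).maxLe_bind ((MaxLe.pick L _ 0).bindO fun K hK => ?_)
      have hK' : K ∈ S.faces := by
        rw [pr_pick] at hK
        refine S.facets_subset _ hi.1 (Finset.mem_of_mem_erase (a := p.1) ?_)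
        by_contra hcon; exact hK (if_neg hcon)
      exact (hcont K hK').bindO fun C _ => MaxLe.output L _ _
  refine MaxLe.mono (a := 0 + (mA + m + J * (mF + m) + 0))
    ((MaxLe.pick L _ 0).bindO fun t _ => ?_) (by omega)
  refine MaxLe.bindO ((key t).mono ?_) fun p _ => MaxLe.output L _ _
  exact Nat.add_le_add_left (Nat.mul_le_mul_right _ (Nat.lt_succ_iff.1 t.2)) _

end QueryAlg

end CliqueSampling

namespace CliqueSampling

variable {n : ℕ} {G : SimpleGraph (Fin n)}

/-! ### Systems of cliques -/

/-- The `i`-cliques as faces and the `(i+1)`-cliques as cells, where a facet of `C` arises by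
dropping one of the vertices in `W C`. -/
noncomputable def cliqueSystem (G : SimpleGraph (Fin n)) (i b : ℕ)
    (W : Finset (Fin n) → Finset (Fin n)) (h2 : 2 ≤ b) (hW : ∀ C, W C ⊆ C)
    (hb : ∀ C ∈ cliques G (i + 1), (W C).card = b) : FacetSystem (Finset (Fin n)) where
  faces := cliques G i
  cells := cliques G (i + 1)
  facets C := dropEach (W C) C
  b := b
  two_le := h2
  facets_subset C hC := dropEach_subset_cliques (hW C) hC
  card_facets C hC := (card_dropEach (hW C)).trans (hb C hC)

section System

variable {i b : ℕ} {W : Finset (Fin n) → Finset (Fin n)} {h2 : 2 ≤ b} {hW : ∀ C, W C ⊆ C}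
  {hb : ∀ C ∈ cliques G (i + 1), (W C).card = b}

theorem cliqueSystem_inc_insert {K : Finset (Fin n)} {w : Fin n} (hw : w ∉ K) :
    (cliqueSystem G i b W h2 hW hb).Inc K (insert w K) ↔
      insert w K ∈ cliques G (i + 1) ∧ w ∈ W (insert w K) := by
  refine and_congr_right fun _ => ?_
  change K ∈ dropEach _ _ ↔ _
  rw [mem_dropEach]
  constructor
  · rintro ⟨v, hv, e⟩
    have : v ∉ K := fun h => by rw [← e] at h; simp at h
    have hv' := Finset.mem_insert.1 (hW _ hv)
    rcases hv' with rfl | h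
    · exact hv
    · exact absurd h this
  · intro h
    exact ⟨w, h, Finset.erase_insert hw⟩

theorem exists_insert_of_cliqueSystem_inc {K C : Finset (Fin n)}
    (h : (cliqueSystem G i b W h2 hW hb).Inc K C) : ∃ w ∉ K, insert w K = C := by
  obtain ⟨w, hw, rfl⟩ := mem_dropEach.1 h.2
  exact ⟨w, Finset.notMem_erase w C, Finset.insert_erase (hW C hw)⟩

theorem cliqueSystem_unsettled_eq_empty {a J : ℕ} {σ δ : ℝ} {N : Fin n → Finset (Fin n)}
    (hN : ∀ v, (N v).card ≤ a) (hG : ∀ u v, G.Adj u v → v ∈ N u ∨ u ∈ N v)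
    (ha : 0 < a) (hi : 0 < i) (hδ : 0 < δ) (hσ : 2 * ((b * (i * a) : ℕ) : ℝ) ≤ δ * σ)
    (hJ : (cliques G i).card < 2 ^ J) :
    (cliqueSystem G i b W h2 hW hb).unsettled σ δ J = ∅ := by
  refine FacetSystem.unsettled_eq_empty (D := b * (i * a)) (by positivity) hδ hσ
    (fun U hU => ?_) hJ
  exact sum_two_facets_le hN hG W hW hb U hU

end System

theorem mem_cliques_one {K : Finset (Fin n)} : K ∈ cliques G 1 ↔ ∃ v, K = {v} := by
  rw [mem_cliques, SimpleGraph.isNClique_iff, Finset.card_eq_one]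
  constructor
  · exact fun h => h.2
  · rintro ⟨v, rfl⟩
    exact ⟨by simp, v, rfl⟩

theorem pair_mem_cliques_two {v w : Fin n} : {v, w} ∈ cliques G 2 ↔ G.Adj v w := by
  rw [mem_cliques, SimpleGraph.isNClique_iff]
  constructor
  · rintro ⟨h, hc⟩
    have hne : v ≠ w := by rintro rfl; simp at hc
    exact h (by simp) (by simp) hne
  · intro h
    refine ⟨?_, Finset.card_pair h.ne⟩
    simp [SimpleGraph.isClique_insert, h]

namespace AdjLists

variable (L : AdjLists G)

/-- The degree of a vertex. -/
def dg (v : Fin n) : ℕ := (L.list v).length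

open Classical in
theorem dg_eq (v : Fin n) : L.dg v = (Finset.univ.filter fun w => G.Adj v w).card := by
  rw [dg, ← List.toFinset_card_of_nodup (L.nodup v)]
  congr 1; ext w; simp [L.mem_iff]

theorem dg_pos {v w : Fin n} (h : G.Adj v w) : 0 < L.dg v :=
  List.length_pos_of_mem ((L.mem_iff v w).2 h)

theorem sum_dg_le {a : ℕ} {N : Fin n → Finset (Fin n)}
    (hN : ∀ v, (N v).card ≤ a) (hG : ∀ u v, G.Adj u v → v ∈ N u ∨ u ∈ N v) :
    ∑ v, L.dg v ≤ 2 * (n * a) := by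
  classical
  have h1 : ∀ v, L.dg v ≤ (N v).card + ∑ w, if v ∈ N w then 1 else 0 := by
    intro v
    rw [dg_eq, ← Finset.sum_filter, ← Finset.card_eq_sum_ones]
    refine le_trans (Finset.card_le_card fun w hw => ?_) (Finset.card_union_le _ _)
    simp only [Finset.mem_filter, Finset.mem_univ, true_and, Finset.mem_union] at hw ⊢
    exact hG v w hw
  calc ∑ v, L.dg v ≤ ∑ v, ((N v).card + ∑ w, if v ∈ N w then 1 else 0) :=
        Finset.sum_le_sum fun v _ => h1 v
    _ = ∑ v, (N v).card + ∑ w, ∑ v, (if v ∈ N w then 1 else 0) := by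
        rw [Finset.sum_add_distrib, Finset.sum_comm]
    _ = ∑ v, (N v).card + ∑ w, (N w).card := by simp
    _ ≤ ∑ _v : Fin n, a + ∑ _w : Fin n, a :=
        add_le_add (Finset.sum_le_sum fun v _ => hN v) (Finset.sum_le_sum fun v _ => hN v)
    _ = 2 * (n * a) := by simp; ring

end AdjLists

namespace QueryAlg

variable {L : AdjLists G}

/-! ### Elementary queries -/

/-- Ask for the degree of a vertex. -/
def askDeg (v : Fin n) : QueryAlg n ℕ := ask (.deg v) fun a => output a

/-- Ask for a neighbor of a vertex. -/
def askNbr (v : Fin n) (i : ℕ) : QueryAlg n (Option (Fin n)) := ask (.nbr v i) fun a => output a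

/-- Ask whether two vertices are adjacent. -/
def askPair (u v : Fin n) : QueryAlg n Bool := ask (.pair u v) fun a => output a

theorem det_askDeg (L : AdjLists G) (v : Fin n) : Det L (askDeg v) (L.dg v) 1 :=
  Det.ask (Det.output L _ 0)

theorem det_askNbr (L : AdjLists G) (v : Fin n) (i : ℕ) :
    Det L (askNbr v i) ((L.list v)[i]?) 1 := Det.ask (Det.output L _ 0)

theorem det_askPair (L : AdjLists G) (u v : Fin n) :
    Det L (askPair u v) (decide (v ∈ L.list u)) 1 := Det.ask (Det.output L _ 0)

theorem Det.pr_eq {Ω : Type} [DecidableEq Ω] {A : QueryAlg n Ω} {x : Ω} {m : ℕ} (h : Det L A x m)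
    (y : Ω) : pr L A y = if y = x then 1 else 0 := by
  rw [pr, h.outputDist, PMF.pure_apply]; split_ifs <;> simp

/-- A uniformly random neighbor of the vertex `v` of degree `d`. -/
noncomputable def randNbr (v : Fin n) (d : ℕ) : QueryAlg n (Option (Fin n)) :=
  bindO (pick (Finset.univ : Finset (Fin d))) fun j => askNbr v j

open Classical in
theorem pr_randNbr (L : AdjLists G) (v w : Fin n) :
    pr L (randNbr v (L.dg v)) (some w) = if G.Adj v w then 1 / (L.dg v : ℝ) else 0 := by
  rw [randNbr, pr_bindO]
  simp only [pr_pick, Finset.mem_univ, if_true, Finset.card_univ, Fintype.card_fin,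
    (det_askNbr L v _).pr_eq]
  split_ifs with h
  · obtain ⟨j, hj, e⟩ := List.mem_iff_getElem.1 ((L.mem_iff v w).2 h)
    have hj' : j < L.dg v := hj
    rw [Finset.sum_eq_single (⟨j, hj'⟩ : Fin (L.dg v))]
    · rw [if_pos, mul_one]
      exact (List.getElem?_eq_some_iff.2 ⟨hj, e⟩).symm
    · intro b _ hb
      rw [if_neg, mul_zero]
      intro e'
      obtain ⟨hb', e'⟩ := List.getElem?_eq_some_iff.1 e'.symm
      exact hb (Fin.ext ((L.nodup v).getElem_inj_iff.1 (e'.trans e.symm)))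
    · simp
  · refine Finset.sum_eq_zero fun j _ => ?_
    rw [if_neg, mul_zero]
    intro e
    exact h ((L.mem_iff v w).1 (List.mem_of_getElem? e.symm))

theorem maxLe_randNbr (L : AdjLists G) (v : Fin n) (d : ℕ) : MaxLe L (randNbr v d) 1 := by
  refine MaxLe.mono (a := 0 + 1) ((MaxLe.pick L _ 0).bindO fun j _ => (det_askNbr L v _).maxLe) ?_
  omega

/-! ### Almost uniform edges -/

/-- A uniformly random vertex. -/
noncomputable def vertexAlg (n : ℕ) : QueryAlg n (Option (Finset (Fin n))) :=
  bindO (pick Finset.univ) fun v => output (some {v})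

theorem pr_vertexAlg (L : AdjLists G) (v : Fin n) :
    pr L (vertexAlg n) (some {v}) = 1 / (n : ℝ) := by
  rw [vertexAlg, pr_bindO, Finset.sum_eq_single v]
  · simp [pr_pick, pr_output_some]
  · intro b _ hb
    simp [pr_output_some, Finset.singleton_inj, Ne.symm hb]
  · simp

theorem pr_vertexAlg_of_notMem (L : AdjLists G) {K : Finset (Fin n)} (hK : K ∉ cliques G 1) :
    pr L (vertexAlg n) (some K) = 0 := by
  rw [vertexAlg, pr_bindO]
  refine Finset.sum_eq_zero fun v _ => ?_
  rw [pr_output_some, if_neg, mul_zero]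
  exact fun h => hK (mem_cliques_one.2 ⟨v, h⟩)

/-- From a vertex of degree at most `θ`, move to each neighbor with probability `1 / θ`. -/
noncomputable def edgeFresh (θ : ℝ) (K : Finset (Fin n)) :
    QueryAlg n (Option (Finset (Fin n))) :=
  if h : K.Nonempty then bind (askDeg h.choose) fun d =>
    if (d : ℝ) ≤ θ then bindO (coin (d / θ)) fun _ => bindO (randNbr h.choose d) fun w =>
      output (some {h.choose, w})
    else output none
  else output none

/-- From a vertex of degree more than `θ`, move to a uniformly random neighbor. -/
noncomputable def edgeCont (θ : ℝ) (K : Finset (Fin n)) :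
    QueryAlg n (Option (Finset (Fin n))) :=
  if h : K.Nonempty then bind (askDeg h.choose) fun d =>
    if (d : ℝ) ≤ θ then output none
    else bindO (randNbr h.choose d) fun w => output (some {h.choose, w})
  else output none

theorem choose_singleton (v : Fin n) (h : ({v} : Finset (Fin n)).Nonempty) : h.choose = v :=
  Finset.mem_singleton.1 h.choose_spec

theorem pr_randNbr_pair (L : AdjLists G) {v w : Fin n} (hvw : w ≠ v) :
    pr L (bindO (randNbr v (L.dg v)) fun w => output (some {v, w})) (some ({v, w} : Finset (Fin n))) =
      pr L (randNbr v (L.dg v)) (some w) := by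
  rw [pr_bindO, Finset.sum_eq_single w]
  · simp [pr_output_some]
  · intro b _ hb
    rw [pr_output_some, if_neg, mul_zero]
    intro e
    have : w ∈ ({v, b} : Finset (Fin n)) := e ▸ by simp
    simp only [Finset.mem_insert, Finset.mem_singleton] at this
    rcases this with h | h
    · exact hvw h
    · exact hb h.symm
  · simp

theorem pr_randNbr_pair_eq_zero (L : AdjLists G) {v : Fin n} {C : Finset (Fin n)}
    (hC : ∀ w, G.Adj v w → C ≠ {v, w}) :
    pr L (bindO (randNbr v (L.dg v)) fun w => output (some {v, w})) (some C) = 0 := by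
  classical
  rw [pr_bindO]
  refine Finset.sum_eq_zero fun w _ => ?_
  rw [pr_randNbr, pr_output_some]
  by_cases h : G.Adj v w
  · simp [hC w h]
  · simp [h]

theorem pr_edgeFresh {θ : ℝ} (hθ : 0 < θ) (v : Fin n) (C : Finset (Fin n)) :
    pr L (edgeFresh θ {v}) (some C) = if (L.dg v : ℝ) ≤ θ then (L.dg v : ℝ) / θ *
      pr L (bindO (randNbr v (L.dg v)) fun w => output (some {v, w})) (some C) else 0 := by
  rw [edgeFresh, dif_pos (Finset.singleton_nonempty v), choose_singleton,
    (det_askDeg L v).pr_bind]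
  split_ifs with h
  · rw [pr_bindO]
    simp [pr_coin L (div_nonneg (Nat.cast_nonneg _) hθ.le) ((div_le_one hθ).2 h)]
  · simp

theorem pr_edgeCont {θ : ℝ} (v : Fin n) (C : Finset (Fin n)) :
    pr L (edgeCont θ {v}) (some C) = if (L.dg v : ℝ) ≤ θ then 0 else
      pr L (bindO (randNbr v (L.dg v)) fun w => output (some {v, w})) (some C) := by
  rw [edgeCont, dif_pos (Finset.singleton_nonempty v), choose_singleton,
    (det_askDeg L v).pr_bind]
  split_ifs with h
  · simp
  · rfl

theorem MaxLe.bind_askDeg {Ω : Type} (v : Fin n) {m : ℕ} {g : ℕ → QueryAlg n Ω}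
    (h : MaxLe L (g (L.dg v)) m) : MaxLe L (QueryAlg.bind (askDeg v) g) (1 + m) :=
  (det_askDeg L v).maxLe_bind h

theorem maxLe_edgeFresh (θ : ℝ) (K : Finset (Fin n)) : MaxLe L (edgeFresh θ K) 2 := by
  rw [edgeFresh]
  split_ifs
  · refine MaxLe.bind_askDeg (m := 1) _ ?_
    split_ifs
    · refine MaxLe.mono (a := 0 + (1 + 0)) ((MaxLe.coin L _ 0).bindO fun _ _ => ?_) (by omega)
      exact (maxLe_randNbr L _ _).bindO fun _ _ => MaxLe.output L _ _
    · exact MaxLe.output L _ _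
  · exact MaxLe.output L _ _

theorem maxLe_edgeCont (θ : ℝ) (K : Finset (Fin n)) : MaxLe L (edgeCont θ K) 2 := by
  rw [edgeCont]
  split_ifs
  · refine MaxLe.bind_askDeg (m := 1) _ ?_
    split_ifs
    · exact MaxLe.output L _ _
    · exact MaxLe.mono (a := 1 + 0)
        ((maxLe_randNbr L _ _).bindO fun _ _ => MaxLe.output L _ _) (by omega)
  · exact MaxLe.output L _ _

/-- Edges as cells and vertices as faces. -/
noncomputable def edgeSystem (G : SimpleGraph (Fin n)) : FacetSystem (Finset (Fin n)) :=
  cliqueSystem G 1 2 id le_rfl (fun _ => subset_rfl) fun _ hC => (mem_cliques.1 hC).card_eq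

theorem edgeSystem_inc {v : Fin n} {C : Finset (Fin n)} :
    (edgeSystem G).Inc {v} C ↔ ∃ w, G.Adj v w ∧ C = {v, w} := by
  constructor
  · intro h
    obtain ⟨w, hw, rfl⟩ := exists_insert_of_cliqueSystem_inc h
    refine ⟨w, ?_, Finset.pair_comm _ _⟩
    have := ((cliqueSystem_inc_insert hw).1 h).1
    exact (pair_mem_cliques_two.1 this).symm
  · rintro ⟨w, h, rfl⟩
    rw [Finset.pair_comm]
    refine (cliqueSystem_inc_insert (by simpa using h.ne')).2 ⟨?_, by simp⟩
    exact pair_mem_cliques_two.2 h.symm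

theorem edgeSystem_deg (L : AdjLists G) (v : Fin n) : (edgeSystem G).deg {v} = L.dg v := by
  classical
  rw [L.dg_eq, FacetSystem.deg]
  symm
  refine Finset.card_bij (fun w _ => {v, w}) ?_ ?_ ?_
  · intro w hw
    have := edgeSystem_inc.2 ⟨w, (Finset.mem_filter.1 hw).2, rfl⟩
    exact Finset.mem_filter.2 ⟨this.1, this.2⟩
  · intro w hw w' hw' e
    have h1 := (Finset.mem_filter.1 hw).2.ne'
    have : w ∈ ({v, w'} : Finset (Fin n)) := e ▸ by simp
    simp only [Finset.mem_insert, Finset.mem_singleton] at this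
    exact this.resolve_left h1
  · intro C hC
    have hC' := Finset.mem_filter.1 hC
    obtain ⟨w, hw, e⟩ := edgeSystem_inc.1 (show (edgeSystem G).Inc {v} C from ⟨hC'.1, hC'.2⟩)
    exact ⟨w, by simpa using hw, e.symm⟩

theorem goodKernels_edge (L : AdjLists G) {θ δ : ℝ} (hθ : 0 < θ) (hδ : 0 < δ) (hδ1 : δ < 1) :
    (edgeSystem G).GoodKernels (fun K => pr L (vertexAlg n) (some K))
      (fun K C => pr L (edgeFresh θ K) (some C)) (fun K C => pr L (edgeCont θ K) (some C))
      (1 / n) (1 / n) θ θ δ 1 := by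
  have hz : ∀ v C, ¬ (edgeSystem G).Inc {v} C →
      pr L (bindO (randNbr v (L.dg v)) fun w => output (some {v, w})) (some C) = 0 := by
    intro v C h
    refine pr_randNbr_pair_eq_zero L fun w hw e => h (edgeSystem_inc.2 ⟨w, hw, e⟩)
  have hp : ∀ v C, (edgeSystem G).Inc {v} C → 0 < (L.dg v : ℝ) ∧
      pr L (bindO (randNbr v (L.dg v)) fun w => output (some {v, w})) (some C) =
        1 / (L.dg v : ℝ) := by
    intro v C h
    obtain ⟨w, hw, rfl⟩ := edgeSystem_inc.1 h
    rw [pr_randNbr_pair L hw.ne', pr_randNbr, if_pos hw]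
    exact ⟨by exact_mod_cast L.dg_pos hw, rfl⟩
  have hface : ∀ K ∈ (edgeSystem G).faces, ∃ v, K = {v} := fun K hK => mem_cliques_one.1 hK
  refine ⟨by positivity, hθ, hδ, hδ1, le_rfl, ?_, ?_, ?_, fun _ _ => pr_nonneg _ _ _,
    fun _ _ => pr_nonneg _ _ _, ?_, ?_, ?_, ?_, ?_⟩
  · exact fun K hK => pr_vertexAlg_of_notMem L hK
  · intro K hK
    obtain ⟨v, rfl⟩ := hface K hK
    exact (pr_vertexAlg L v).ge
  · intro K hK
    obtain ⟨v, rfl⟩ := hface K hK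
    exact (pr_vertexAlg L v).le
  · intro K hK C hC
    obtain ⟨v, rfl⟩ := hface K hK
    rw [pr_edgeFresh hθ, hz v C hC, mul_zero, ite_self]
  · intro K hK C hC
    obtain ⟨v, rfl⟩ := hface K hK
    rw [pr_edgeCont, hz v C hC, ite_self]
  · intro K
    by_cases hK : K ∈ (edgeSystem G).faces
    · obtain ⟨v, rfl⟩ := hface K hK
      refine ⟨if (L.dg v : ℝ) ≤ θ then 0 else 1, ?_, ?_, fun C hC => ?_⟩
      · split_ifs <;> norm_num
      · split_ifs <;> norm_num
      · obtain ⟨hpos, hval⟩ := hp v C hC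
        rw [pr_edgeFresh hθ, pr_edgeCont, hval, edgeSystem_deg L v]
        split_ifs with h
        · refine ⟨le_of_eq ?_, by simp⟩
          field_simp; ring
        · refine ⟨by simp, le_of_eq ?_⟩
          field_simp
    · exact ⟨0, le_rfl, zero_le_one, fun C hC => absurd hC.mem_faces hK⟩
  · intro K C hC hd
    obtain ⟨v, rfl⟩ := hface K hC.mem_faces
    obtain ⟨hpos, hval⟩ := hp v C hC
    rw [edgeSystem_deg L v] at hd
    rw [pr_edgeFresh hθ, hval, if_pos hd]
    have : (1 - δ) ^ 3 ≤ 1 := pow_le_one₀ (by linarith) (by linarith)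
    calc (1 - δ) ^ 3 / θ ≤ 1 / θ := by gcongr
      _ = _ := by field_simp
  · intro K C hC hd y hy hy1
    obtain ⟨v, rfl⟩ := hface K hC.mem_faces
    obtain ⟨hpos, hval⟩ := hp v C hC
    rw [edgeSystem_deg L v] at hd ⊢
    rw [pr_edgeFresh hθ, pr_edgeCont, hval, if_neg (not_le.2 hd), if_neg (not_le.2 hd), zero_mul,
      zero_add, mul_one_div_cancel hpos.ne', mul_one]
    have : (1 - δ) ^ 2 ≤ 1 := pow_le_one₀ (by linarith) (by linarith)
    nlinarith

/-- Almost uniform edges, by the walk on vertices and edges. -/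
noncomputable def edgeAlg (n : ℕ) (θ : ℝ) (J : ℕ) : QueryAlg n (Option (Finset (Fin n))) :=
  walk (vertexAlg n) (edgeFresh θ) (edgeCont θ) (fun C => output (dropEach C C)) J

theorem maxLe_edgeAlg (L : AdjLists G) {θ : ℝ} (hθ : 0 < θ) (J : ℕ) :
    MaxLe L (edgeAlg n θ J) (2 * (J + 1)) := by
  refine MaxLe.mono (maxLe_walk (mF := 0) (mA := 0) (m := 2)
    (goodKernels_edge L hθ (δ := 1 / 2) (by norm_num) (by norm_num))
    (fun C _ => Det.output L _ 0) J ?_ (fun K _ => maxLe_edgeFresh θ K)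
    fun K _ => maxLe_edgeCont θ K) (by ring_nf; omega)
  exact MaxLe.mono (a := 0 + 0) ((MaxLe.pick L _ 0).bindO fun _ _ => MaxLe.output L _ _) le_rfl

theorem pr_edgeAlg_eq_zero (L : AdjLists G) {θ : ℝ} (hθ : 0 < θ) (J : ℕ) {C : Finset (Fin n)}
    (hC : C ∉ cliques G 2) : pr L (edgeAlg n θ J) (some C) = 0 :=
  pr_walk_eq_zero (goodKernels_edge L hθ (δ := 1 / 2) (by norm_num) (by norm_num))
    (fun C _ => Det.output L _ 0) J hC

theorem pr_edgeAlg_le (L : AdjLists G) {θ : ℝ} (hθ : 0 < θ) (J : ℕ) {C : Finset (Fin n)}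
    (hC : C ∈ cliques G 2) : pr L (edgeAlg n θ J) (some C) ≤ 2 / ((J + 1) * θ) * (1 / n) := by
  have := pr_walk_le (goodKernels_edge L hθ (δ := 1 / 2) (by norm_num) (by norm_num))
    (fun C _ => Det.output L _ 0) J hC
  rw [one_pow, mul_one] at this
  exact this

theorem le_pr_edgeAlg (L : AdjLists G) {a J : ℕ} {θ δ : ℝ} {N : Fin n → Finset (Fin n)}
    (hN : ∀ v, (N v).card ≤ a) (hG : ∀ u v, G.Adj u v → v ∈ N u ∨ u ∈ N v)
    (ha : 0 < a) (hδ : 0 < δ) (hδ1 : δ < 1) (hσ : 4 * (a : ℝ) ≤ δ * θ)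
    (hJ : (cliques G 1).card < 2 ^ J) {C : Finset (Fin n)} (hC : C ∈ cliques G 2) :
    2 / ((J + 1) * θ) * (1 / n) * (1 - δ) ^ (3 * J + 3) ≤ pr L (edgeAlg n θ J) (some C) := by
  have hθ : 0 < θ := by
    have : (0 : ℝ) < a := by exact_mod_cast ha
    by_contra hcon
    nlinarith [not_lt.1 hcon]
  refine le_pr_walk (S := edgeSystem G) (goodKernels_edge L hθ hδ hδ1)
    (fun C _ => Det.output L _ 0) ?_ hC
  refine cliqueSystem_unsettled_eq_empty hN hG ha one_pos hδ (le_trans (le_of_eq ?_) hσ) hJ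
  push_cast; ring

end QueryAlg

end CliqueSampling

namespace CliqueSampling

/-! ### Repeated trials -/

section Geometric

variable {Q : ℝ}

theorem geom_sum_le (h0 : 0 ≤ Q) (h1 : Q ≤ 1) (m : ℕ) :
    ∑ j ∈ Finset.range m, (1 - Q) ^ j ≤ m := by
  calc ∑ j ∈ Finset.range m, (1 - Q) ^ j ≤ ∑ _j ∈ Finset.range m, (1 : ℝ) :=
        Finset.sum_le_sum fun j _ => pow_le_one₀ (by linarith) (by linarith)
    _ = m := by simp

theorem mul_geom_sum_eq (m : ℕ) : Q * ∑ j ∈ Finset.range m, (1 - Q) ^ j = 1 - (1 - Q) ^ m := by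
  have := mul_neg_geom_sum (1 - Q) m
  rwa [sub_sub_cancel] at this

theorem one_sub_mul_le_pow (h1 : Q ≤ 1) (m : ℕ) : 1 - m * Q ≤ (1 - Q) ^ m := by
  have := one_add_mul_le_pow (a := -Q) (by linarith) m
  linarith [this, show (1 + -Q) ^ m = (1 - Q) ^ m by ring]

theorem le_geom_sum (h0 : 0 ≤ Q) (h1 : Q ≤ 1) (m : ℕ) :
    ((m + 1 : ℕ) : ℝ) * (1 - m * Q) ≤ ∑ j ∈ Finset.range (m + 1), (1 - Q) ^ j := by
  calc ((m + 1 : ℕ) : ℝ) * (1 - m * Q) = ∑ _j ∈ Finset.range (m + 1), (1 - m * Q) := by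
        rw [Finset.sum_const, Finset.card_range, nsmul_eq_mul]
    _ ≤ _ := by
      refine Finset.sum_le_sum fun j hj => le_trans ?_ (one_sub_mul_le_pow h1 j)
      have : (j : ℝ) ≤ m := by exact_mod_cast Nat.lt_succ_iff.1 (Finset.mem_range.1 hj)
      nlinarith

theorem pow_mul_le_one (h0 : 0 ≤ Q) (h1 : Q ≤ 1) (m : ℕ) : (1 - Q) ^ m * (1 + m * Q) ≤ 1 := by
  calc (1 - Q) ^ m * (1 + m * Q) ≤ (1 - Q) ^ m * (1 + Q) ^ m := by
        refine mul_le_mul_of_nonneg_left ?_ (pow_nonneg (by linarith) _)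
        exact one_add_mul_le_pow (by linarith) m
    _ = (1 - Q ^ 2) ^ m := by rw [← mul_pow]; ring
    _ ≤ 1 := pow_le_one₀ (by nlinarith) (by nlinarith)

end Geometric

/-- The numerical facts about repeated trials at a face of degree `e`, when a trial finds each
cell with a probability `q ≈ l` and succeeds with probability `Q ≈ e * l`. -/
structure TrialData (δ θ l e q Q : ℝ) : Prop where
  δ_pos : 0 < δ
  δ_le : δ ≤ 1 / 2
  θ_pos : 0 < θ
  l_pos : 0 < l
  e_nonneg : 0 ≤ e
  Q_nonneg : 0 ≤ Q
  Q_le_one : Q ≤ 1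
  le_q : (1 - δ) * l ≤ q
  q_le : q ≤ l
  le_Q : (1 - δ) * (e * l) ≤ Q
  Q_le : Q ≤ e * l

namespace TrialData

variable {δ θ l e q Q : ℝ} (h : TrialData δ θ l e q Q)
include h

theorem q_nonneg : 0 ≤ q := (mul_nonneg (by linarith [h.δ_le]) h.l_pos.le).trans h.le_q

theorem fresh_le {τ : ℝ} (hτ : 0 < τ) (m : ℕ) :
    1 / l / (τ * (m + 1 : ℕ)) * ((∑ j ∈ Finset.range (m + 1), (1 - Q) ^ j) * q) ≤ 1 / τ := by
  have hl := h.l_pos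
  have h1 := geom_sum_le h.Q_nonneg h.Q_le_one (m + 1)
  have h2 : (0 : ℝ) < (m + 1 : ℕ) := by positivity
  calc _ ≤ 1 / l / (τ * (m + 1 : ℕ)) * ((m + 1 : ℕ) * l) := by
        refine mul_le_mul_of_nonneg_left ?_ (by positivity)
        exact mul_le_mul h1 h.q_le h.q_nonneg h2.le
    _ = 1 / τ := by field_simp

theorem cont_le (m : ℕ) : e * ((∑ j ∈ Finset.range m, (1 - Q) ^ j) * q) ≤
    1 / (1 - δ) * (1 - (1 - Q) ^ m) := by
  have hδ : 0 < 1 - δ := by linarith [h.δ_le]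
  have hG : 0 ≤ ∑ j ∈ Finset.range m, (1 - Q) ^ j :=
    Finset.sum_nonneg fun j _ => pow_nonneg (by linarith [h.Q_le_one]) _
  rw [← mul_geom_sum_eq]
  have h1 : e * q ≤ 1 / (1 - δ) * Q := by
    rw [one_div, ← div_eq_inv_mul, le_div_iff₀ hδ]
    have := mul_le_mul_of_nonneg_left h.q_le h.e_nonneg
    nlinarith [h.le_Q]
  nlinarith [mul_le_mul_of_nonneg_right h1 hG]

theorem le_cont (m : ℕ) : (1 - δ) * (1 - (1 - Q) ^ m) ≤
    e * ((∑ j ∈ Finset.range m, (1 - Q) ^ j) * q) := by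
  have hδ : 0 < 1 - δ := by linarith [h.δ_le]
  have hG : 0 ≤ ∑ j ∈ Finset.range m, (1 - Q) ^ j :=
    Finset.sum_nonneg fun j _ => pow_nonneg (by linarith [h.Q_le_one]) _
  rw [← mul_geom_sum_eq]
  have h1 : (1 - δ) * Q ≤ e * q := by
    have := mul_le_mul_of_nonneg_left h.le_q h.e_nonneg
    have := mul_le_mul_of_nonneg_left h.Q_le hδ.le
    nlinarith
  nlinarith [mul_le_mul_of_nonneg_right h1 hG]

theorem le_fresh {τ : ℝ} (hτ : τ = 4 * θ / δ ^ 2) (he : e ≤ 4 * θ / δ) :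
    (1 - δ) ^ 2 / τ ≤ 1 / l / (τ * (⌊1 / l / τ⌋₊ + 1 : ℕ)) *
      ((∑ j ∈ Finset.range (⌊1 / l / τ⌋₊ + 1), (1 - Q) ^ j) * q) := by
  have hl := h.l_pos
  have hδ := h.δ_pos
  have hθ := h.θ_pos
  have hδ' : 0 ≤ 1 - δ := by linarith [h.δ_le]
  have hτ0 : 0 < τ := by rw [hτ]; positivity
  set m := ⌊1 / l / τ⌋₊ with hm
  have hm1 : (m : ℝ) ≤ 1 / l / τ := Nat.floor_le (by positivity)
  have hmQ : m * Q ≤ δ := by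
    calc m * Q ≤ 1 / l / τ * (e * l) :=
          mul_le_mul hm1 h.Q_le h.Q_nonneg (by positivity)
      _ = e / τ := by field_simp
      _ ≤ 4 * θ / δ / τ := by gcongr
      _ = δ := by rw [hτ]; field_simp
  have h2 : (0 : ℝ) < (m + 1 : ℕ) := by positivity
  calc (1 - δ) ^ 2 / τ = 1 / l / (τ * (m + 1 : ℕ)) * (((m + 1 : ℕ) * (1 - δ)) * ((1 - δ) * l)) := by
        field_simp
    _ ≤ _ := by
        refine mul_le_mul_of_nonneg_left ?_ (by positivity)
        refine mul_le_mul ?_ h.le_q (by positivity)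
          (Finset.sum_nonneg fun j _ => pow_nonneg (by linarith [h.Q_le_one]) _)
        refine le_trans ?_ (le_geom_sum h.Q_nonneg h.Q_le_one m)
        gcongr

theorem le_pow (he : e ≤ δ * θ) : 1 - δ ≤ (1 - Q) ^ ⌊1 / l / θ⌋₊ := by
  have hl := h.l_pos
  have hθ := h.θ_pos
  refine le_trans ?_ (one_sub_mul_le_pow h.Q_le_one _)
  have hm1 : ((⌊1 / l / θ⌋₊ : ℕ) : ℝ) ≤ 1 / l / θ := Nat.floor_le (by positivity)
  have : ((⌊1 / l / θ⌋₊ : ℕ) : ℝ) * Q ≤ δ := by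
    calc _ ≤ 1 / l / θ * (e * l) := mul_le_mul hm1 h.Q_le h.Q_nonneg (by positivity)
      _ = e / θ := by field_simp
      _ ≤ δ := by rw [div_le_iff₀ hθ]; exact he
  linarith

theorem pow_le (he : 4 * θ / δ ≤ e) : (1 - Q) ^ ⌊1 / l / θ⌋₊ ≤ δ := by
  have hl := h.l_pos
  have hθ := h.θ_pos
  have hδ := h.δ_pos
  have hδ2 := h.δ_le
  set m := ⌊1 / l / θ⌋₊ with hm
  have hm1 : 1 / l / θ < m + 1 := Nat.lt_floor_add_one _
  have he8 : 8 * θ ≤ e := by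
    refine le_trans ?_ he
    rw [le_div_iff₀ hδ]; nlinarith
  have hQ1 : 1 / 2 * (e * l) ≤ Q := by
    refine le_trans ?_ h.le_Q
    have : 0 ≤ e * l := mul_nonneg h.e_nonneg hl.le
    nlinarith
  -- a trial succeeds with probability at most one, so `1 / l` is at least about `e`
  have hD : e / 2 ≤ 1 / l := by
    rw [le_div_iff₀ hl]; nlinarith [h.Q_le_one]
  have hD2 : 2 ≤ 1 / l / θ := by
    rw [le_div_iff₀ hθ]; linarith
  have hm2 : 1 / l / θ / 2 ≤ m := by linarith
  have hmQ : 1 / δ ≤ m * Q := by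
    calc 1 / δ = 4 * θ / δ / (4 * θ) := by field_simp
      _ ≤ e / (4 * θ) := by gcongr
      _ = 1 / l / θ / 2 * (1 / 2 * (e * l)) := by field_simp; ring
      _ ≤ m * Q := mul_le_mul hm2 hQ1 (mul_nonneg (by norm_num)
          (mul_nonneg h.e_nonneg hl.le)) (Nat.cast_nonneg _)
  have h3 := pow_mul_le_one h.Q_nonneg h.Q_le_one m
  have h4 : 0 ≤ (1 - Q) ^ m := pow_nonneg (by linarith [h.Q_le_one]) _
  have h5 : (1 - Q) ^ m * (1 / δ) ≤ 1 := by nlinarith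
  rw [mul_one_div, div_le_one hδ] at h5
  exact h5

theorem le_fresh_add_cont {τ y F : ℝ} (hτ : τ = 4 * θ / δ ^ 2) (hy : 0 ≤ y) (hy1 : y ≤ 1)
    (hF : F = 1 / l / (τ * (⌊1 / l / τ⌋₊ + 1 : ℕ)) *
      ((∑ j ∈ Finset.range (⌊1 / l / τ⌋₊ + 1), (1 - Q) ^ j) * q)) :
    (1 - δ) ^ 2 * y ≤ (1 - Q) ^ ⌊1 / l / θ⌋₊ * F * τ +
      y * (e * ((∑ j ∈ Finset.range ⌊1 / l / θ⌋₊, (1 - Q) ^ j) * q)) := by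
  have hδ := h.δ_pos
  have hθ := h.θ_pos
  have hδ' : 0 ≤ 1 - δ := by linarith [h.δ_le]
  have hτ0 : 0 < τ := by rw [hτ]; positivity
  have h1 := h.le_cont ⌊1 / l / θ⌋₊
  set f := (1 - Q) ^ ⌊1 / l / θ⌋₊ with hf
  have hf0 : 0 ≤ f := pow_nonneg (by linarith [h.Q_le_one]) _
  rcases le_total e (4 * θ / δ) with he | he
  · have h2 := h.le_fresh hτ he
    rw [← hF, div_le_iff₀ hτ0] at h2
    have h3 : f * (1 - δ) ^ 2 * y ≤ f * F * τ := by
      calc f * (1 - δ) ^ 2 * y ≤ f * (1 - δ) ^ 2 * 1 := by gcongr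
        _ ≤ f * F * τ := by rw [mul_one, mul_assoc]; gcongr
    have hf1 : f ≤ 1 := pow_le_one₀ (by linarith [h.Q_le_one]) (by linarith [h.Q_nonneg])
    have h4 : y * ((1 - δ) ^ 2 * (1 - f)) ≤ y * (e * ((∑ j ∈ Finset.range ⌊1 / l / θ⌋₊,
        (1 - Q) ^ j) * q)) := by
      refine mul_le_mul_of_nonneg_left (le_trans ?_ h1) hy
      refine mul_le_mul_of_nonneg_right ?_ (by linarith)
      nlinarith
    nlinarith
  · have h2 := h.pow_le he
    rw [← hf] at h2
    have hF0 : 0 ≤ f * F * τ := by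
      have hl := h.l_pos
      have : 0 ≤ F := by
        rw [hF]
        refine mul_nonneg (by positivity) (mul_nonneg (Finset.sum_nonneg fun j _ =>
          pow_nonneg (by linarith [h.Q_le_one]) _) h.q_nonneg)
      positivity
    have h4 : y * ((1 - δ) * (1 - δ)) ≤ y * (e * ((∑ j ∈ Finset.range ⌊1 / l / θ⌋₊,
        (1 - Q) ^ j) * q)) := by
      refine mul_le_mul_of_nonneg_left (le_trans ?_ h1) hy
      exact mul_le_mul_of_nonneg_left (by linarith) hδ'
    nlinarith

end TrialData

namespace QueryAlg

variable {n : ℕ} {X : Type} {G : SimpleGraph (Fin n)} {L : AdjLists G}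

/-- Repeat a trial up to `m` times, until it succeeds. -/
noncomputable def retry (t : QueryAlg n (Option X)) : ℕ → QueryAlg n (Option X)
  | 0 => output none
  | m + 1 => bind t fun o => o.elim (retry t m) fun x => output (some x)

theorem pr_none_eq [Fintype X] (L : AdjLists G) (t : QueryAlg n (Option X)) :
    pr L t none = 1 - ∑ x, pr L t (some x) := by
  rw [sum_pr_some]; ring

theorem pr_retry_some [Fintype X] (L : AdjLists G) (t : QueryAlg n (Option X)) (m : ℕ) (x : X) :
    pr L (retry t m) (some x) = (∑ j ∈ Finset.range m, pr L t none ^ j) * pr L t (some x) := by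
  classical
  induction m with
  | zero => simp [retry]
  | succ m ih =>
    rw [retry, pr_bind, Fintype.sum_option]
    simp only [Option.elim_none, Option.elim_some, pr_output_some, ih]
    rw [Finset.sum_range_succ' (fun j => pr L t none ^ j)]
    simp only [mul_ite, mul_one, mul_zero, Finset.sum_ite_eq, Finset.mem_univ, if_true, pow_zero,
      pow_succ, ← Finset.sum_mul]
    ring

theorem pr_retry_none [Fintype X] (L : AdjLists G) (t : QueryAlg n (Option X)) (m : ℕ) :
    pr L (retry t m) none = pr L t none ^ m := by
  classical
  induction m with
  | zero => simp [retry, pr_output]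
  | succ m ih =>
    rw [retry, pr_bind, Fintype.sum_option]
    simp only [Option.elim_none, Option.elim_some, pr_output, ih]
    simp [pow_succ, mul_comm]

theorem costLe_retry [Fintype X] {t : QueryAlg n (Option X)} {c : ℝ} (hc : 0 ≤ c) (h : CostLe L t c) (m : ℕ) :
    CostLe L (retry t m) (c * ∑ j ∈ Finset.range m, pr L t none ^ j) := by
  induction m with
  | zero => exact CostLe.output L _ _
  | succ m ih =>
    have h0 : 0 ≤ c * ∑ j ∈ Finset.range m, pr L t none ^ j :=
      mul_nonneg hc (Finset.sum_nonneg fun j _ => pow_nonneg (pr_nonneg _ _ _) _)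
    have := CostLe.bind (L := L) (A := t)
      (g := fun o : Option X => o.elim (retry t m) fun x => output (some x))
      (h := fun o => o.elim (c * ∑ j ∈ Finset.range m, pr L t none ^ j) fun _ => 0) hc
      (by rintro (_ | x) <;> simp [h0]) h
      (by rintro (_ | x) _
          · exact ih
          · exact CostLe.output L _ _)
    rw [Fintype.sum_option] at this
    refine this.mono (le_of_eq ?_)
    rw [Finset.sum_range_succ' (fun j => pr L t none ^ j)]
    simp only [Option.elim_none, Option.elim_some, mul_zero, Finset.sum_const_zero, pow_zero,
      pow_succ, ← Finset.sum_mul]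
    ring

theorem maxLe_retry {t : QueryAlg n (Option X)} {m : ℕ} (h : MaxLe L t m) (r : ℕ) :
    MaxLe L (retry t r) (r * m) := by
  induction r with
  | zero => exact MaxLe.output L _ _
  | succ r ih =>
    refine MaxLe.mono (a := m + r * m) (h.bind fun o _ => ?_) (by rw [add_mul]; omega)
    cases o with
    | none => exact ih
    | some x => exact MaxLe.output L _ _

/-- The steps of the walk at a face where each of its cells is found by a trial `t` with
probability about `1 / D`. A first round of about `D / θ` trials decides whether the face counts
as one of large degree: from such a face the walk continues with the cell found. -/
noncomputable def contTrials (t : QueryAlg n (Option X)) (D θ : ℝ) : QueryAlg n (Option X) :=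
  retry t ⌊D / θ⌋₊

/-- A face that is visited first enters a cell only if the first round of trials fails. A second
round, scaled down by a coin, then finds each cell with probability about `1 / τ`. -/
noncomputable def freshTrials (t : QueryAlg n (Option X)) (D θ τ : ℝ) : QueryAlg n (Option X) :=
  bind (retry t ⌊D / θ⌋₊) fun o => o.elim
    (bindO (coin (D / (τ * (⌊D / τ⌋₊ + 1 : ℕ)))) fun _ => retry t (⌊D / τ⌋₊ + 1))
    fun _ => output none

theorem pr_contTrials [Fintype X] (t : QueryAlg n (Option X)) (D θ : ℝ) (x : X) :
    pr L (contTrials t D θ) (some x) =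
      (∑ j ∈ Finset.range ⌊D / θ⌋₊, pr L t none ^ j) * pr L t (some x) := pr_retry_some _ _ _ _

theorem pr_freshTrials [Fintype X] (t : QueryAlg n (Option X)) {D τ : ℝ} (θ : ℝ) (hD : 0 ≤ D) (hτ : 0 < τ)
    (x : X) : pr L (freshTrials t D θ τ) (some x) = pr L t none ^ ⌊D / θ⌋₊ *
      (D / (τ * (⌊D / τ⌋₊ + 1 : ℕ)) *
        ((∑ j ∈ Finset.range (⌊D / τ⌋₊ + 1), pr L t none ^ j) * pr L t (some x))) := by
  have hm : (0 : ℝ) < (⌊D / τ⌋₊ + 1 : ℕ) := by positivity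
  have ha : D / (τ * (⌊D / τ⌋₊ + 1 : ℕ)) ≤ 1 := by
    rw [div_le_one (by positivity), mul_comm, ← div_le_iff₀ hτ]
    push_cast
    exact (Nat.lt_floor_add_one _).le
  rw [freshTrials, pr_bind, Fintype.sum_option]
  simp only [Option.elim_none, Option.elim_some, pr_output_none_some, mul_zero,
    Finset.sum_const_zero, add_zero, pr_retry_none]
  rw [pr_bindO]
  simp only [Finset.univ_unique, PUnit.default_eq_unit, Finset.sum_singleton]
  rw [pr_coin L (by positivity) ha, pr_retry_some]

theorem costLe_freshTrials [Fintype X] {t : QueryAlg n (Option X)} {c D θ τ : ℝ} (hc : 0 ≤ c)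
    (h : CostLe L t c) (hD : 0 ≤ D) (hθ : 0 < θ) (hτ : θ ≤ τ) :
    CostLe L (freshTrials t D θ τ) (c * (2 * (D / θ) + 1)) := by
  have hτ0 : 0 < τ := hθ.trans_le hτ
  have h1 : ∀ m : ℕ, ∑ j ∈ Finset.range m, pr L t none ^ j ≤ m := by
    intro m
    have hle : pr L t none ≤ 1 := by
      have := sum_pr L t
      rw [Fintype.sum_option] at this
      have : 0 ≤ ∑ x, pr L t (some x) := Finset.sum_nonneg fun x _ => pr_nonneg _ _ _
      linarith
    calc ∑ j ∈ Finset.range m, pr L t none ^ j ≤ ∑ _j ∈ Finset.range m, (1 : ℝ) :=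
          Finset.sum_le_sum fun j _ => pow_le_one₀ (pr_nonneg _ _ _) hle
      _ = m := by simp
  have hr : ∀ m : ℕ, CostLe L (retry t m) (c * m) := fun m =>
    (costLe_retry hc h m).mono (mul_le_mul_of_nonneg_left (h1 m) hc)
  have hB : CostLe L (bindO (coin (D / (τ * (⌊D / τ⌋₊ + 1 : ℕ)))) fun _ =>
      retry t (⌊D / τ⌋₊ + 1)) (c * (⌊D / τ⌋₊ + 1 : ℕ)) := by
    have h2 := CostLe.bindO (L := L) (A := coin (D / (τ * (⌊D / τ⌋₊ + 1 : ℕ))))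
      (g := fun _ => retry t (⌊D / τ⌋₊ + 1)) (h := fun _ => c * (⌊D / τ⌋₊ + 1 : ℕ)) le_rfl
      (fun _ => by positivity)
      (by simpa using (MaxLe.coin L (D / (τ * (⌊D / τ⌋₊ + 1 : ℕ))) 0).costLe) (fun _ _ => hr _)
    refine h2.mono ?_
    rw [zero_add, ← Finset.sum_mul]
    exact mul_le_of_le_one_left (by positivity) (sum_pr_some_le_one L _)
  have h3 := CostLe.bind (L := L) (A := retry t ⌊D / θ⌋₊)
    (g := fun o : Option X => o.elim
      (bindO (coin (D / (τ * (⌊D / τ⌋₊ + 1 : ℕ)))) fun _ => retry t (⌊D / τ⌋₊ + 1))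
      fun _ => output none) (h := fun _ => c * (⌊D / τ⌋₊ + 1 : ℕ)) (by positivity)
    (fun _ => by positivity) (hr ⌊D / θ⌋₊)
    (by rintro (_ | x) _
        · exact hB
        · exact CostLe.output L _ _)
  refine h3.mono ?_
  rw [← Finset.sum_mul, sum_pr, one_mul, ← mul_add]
  refine mul_le_mul_of_nonneg_left ?_ hc
  have h4 : ((⌊D / θ⌋₊ : ℕ) : ℝ) ≤ D / θ := Nat.floor_le (by positivity)
  have h5 : ((⌊D / τ⌋₊ : ℕ) : ℝ) ≤ D / θ := (Nat.floor_le (by positivity)).trans (by gcongr)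
  push_cast
  linarith

theorem maxLe_freshTrials {t : QueryAlg n (Option X)} {m : ℕ} {D θ τ : ℝ} (h : MaxLe L t m)
    (hD : 0 ≤ D) (hθ : 0 < θ) (hτ : θ ≤ τ) :
    MaxLe L (freshTrials t D θ τ) ((2 * ⌊D / θ⌋₊ + 1) * m) := by
  refine MaxLe.mono (a := ⌊D / θ⌋₊ * m + (⌊D / τ⌋₊ + 1) * m)
    ((maxLe_retry h _).bind fun o _ => ?_) ?_
  · cases o with
    | none =>
      refine MaxLe.mono (a := 0 + (⌊D / τ⌋₊ + 1) * m)
        ((MaxLe.coin L _ 0).bindO fun _ _ => maxLe_retry h _) (by omega)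
    | some x => exact MaxLe.output L _ _
  · have : ⌊D / τ⌋₊ ≤ ⌊D / θ⌋₊ := Nat.floor_le_floor (by gcongr)
    rw [← add_mul]
    exact Nat.mul_le_mul_right _ (by omega)

theorem maxLe_contTrials {t : QueryAlg n (Option X)} {m : ℕ} {D θ : ℝ} (h : MaxLe L t m) :
    MaxLe L (contTrials t D θ) ((2 * ⌊D / θ⌋₊ + 1) * m) :=
  (maxLe_retry h _).mono (Nat.mul_le_mul_right _ (by omega))

end QueryAlg

end CliqueSampling

namespace CliqueSampling

namespace QueryAlg

variable {n : ℕ} {G : SimpleGraph (Fin n)} {L : AdjLists G}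

/-! ### Extending cliques -/

/-- The degrees of the vertices in a list; other vertices get the value `0`. -/
noncomputable def askDegs : List (Fin n) → QueryAlg n (Fin n → ℕ)
  | [] => output fun _ => 0
  | v :: l => bind (askDeg v) fun d => bind (askDegs l) fun f => output (Function.update f v d)

theorem det_askDegs (L : AdjLists G) (l : List (Fin n)) :
    Det L (askDegs l) (fun v => if v ∈ l then L.dg v else 0) l.length := by
  induction l with
  | nil => exact Det.output L _ _
  | cons v l ih =>
    refine Det.mono (a := 1 + (l.length + 0)) ((det_askDeg L v).bind (ih.bind ?_))
      (by simp; omega)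
    convert Det.output L _ 0 using 1
    ext w
    by_cases h : w = v
    · subst h; simp
    · simp [h]

/-- The degrees of the vertices in a set. -/
noncomputable def degsOf (K : Finset (Fin n)) : QueryAlg n (Fin n → ℕ) := askDegs K.toList

/-- The degree function restricted to a set. -/
def degOn (L : AdjLists G) (K : Finset (Fin n)) (v : Fin n) : ℕ := if v ∈ K then L.dg v else 0

theorem degOn_of_mem {K : Finset (Fin n)} {v : Fin n} (h : v ∈ K) : degOn L K v = L.dg v :=
  if_pos h

theorem det_degsOf (L : AdjLists G) (K : Finset (Fin n)) :
    Det L (degsOf K) (degOn L K) K.card := by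
  have := det_askDegs L K.toList
  simp only [Finset.mem_toList, Finset.length_toList] at this
  exact this

/-- Is the vertex `w` adjacent to all vertices in a list? -/
noncomputable def allAdj (w : Fin n) : List (Fin n) → QueryAlg n Bool
  | [] => output true
  | u :: l => bind (askPair u w) fun b => bind (allAdj w l) fun c => output (b && c)

theorem det_allAdj (L : AdjLists G) (w : Fin n) (l : List (Fin n)) :
    Det L (allAdj w l) (l.all fun u => decide (w ∈ L.list u)) l.length := by
  induction l with
  | nil => exact Det.output L _ _
  | cons u l ih =>
    refine Det.mono (a := 1 + (l.length + 0)) ((det_askPair L u w).bind (ih.bind ?_))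
      (by simp; omega)
    rw [List.all_cons]
    exact Det.output L _ 0

/-- Add the vertex `w` to the clique `K` if the result is a clique in which `w` is not the first
vertex in the degree order. -/
noncomputable def addVertex (K : Finset (Fin n)) (w : Fin n) :
    QueryAlg n (Option (Finset (Fin n))) :=
  bind (degsOf (insert w K)) fun f => bind (allAdj w K.toList) fun b =>
    output (if w ∉ K ∧ b = true ∧ w ∈ nonRoot f (insert w K) then some (insert w K) else none)

/-- Cliques of size `i ≥ 2` as faces, where the facets of a clique arise by dropping a vertex other
than the first one in the degree order. -/
noncomputable def rootedSystem (L : AdjLists G) (i : ℕ) (hi : 2 ≤ i) :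
    FacetSystem (Finset (Fin n)) :=
  cliqueSystem G i i (nonRoot L.dg) hi (nonRoot_subset L.dg)
    fun _ hC => card_nonRoot L.dg (mem_cliques.1 hC).card_eq

variable {i : ℕ} {hi : 2 ≤ i}

open Classical in
theorem det_addVertex (L : AdjLists G) (hi : 2 ≤ i) {K : Finset (Fin n)} (hK : K ∈ cliques G i)
    (w : Fin n) : Det L (addVertex K w)
      (if w ∉ K ∧ (rootedSystem L i hi).Inc K (insert w K) then some (insert w K) else none)
      (2 * i + 1) := by
  have hc := (mem_cliques.1 hK).card_eq
  have h1 : (insert w K).card + (K.toList.length + 0) ≤ 2 * i + 1 := by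
    have := Finset.card_insert_le w K
    rw [Finset.length_toList]; omega
  refine Det.mono (((det_degsOf L _).bind ((det_allAdj L w _).bind ?_))) h1
  rw [nonRoot_congr (fun v hv => degOn_of_mem hv)]
  convert Det.output L _ 0 using 2
  refine and_congr_right fun hw => ?_
  rw [rootedSystem, cliqueSystem_inc_insert hw]
  refine and_congr_left fun _ => ?_
  simp only [List.all_eq_true, Finset.mem_toList, decide_eq_true_eq, L.mem_iff]
  constructor
  · intro h u hu
    exact adj_of_mem_cliques h (Finset.mem_insert_of_mem hu) (Finset.mem_insert_self _ _)
      (fun e => hw (e ▸ hu))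
  · intro h
    rw [mem_cliques] at hK ⊢
    exact hK.insert fun u hu => (h u hu).symm

/-- One trial to extend the clique `K` by a vertex drawn from `src`. -/
noncomputable def extend (K : Finset (Fin n)) (src : QueryAlg n (Option (Fin n))) :
    QueryAlg n (Option (Finset (Fin n))) :=
  bindO src (addVertex K)

theorem pr_extend_insert {K : Finset (Fin n)} (hK : K ∈ cliques G i) {w : Fin n} (hw : w ∉ K)
    (h : (rootedSystem L i hi).Inc K (insert w K)) (src : QueryAlg n (Option (Fin n))) :
    pr L (extend K src) (some (insert w K)) = pr L src (some w) := by
  rw [extend, pr_bindO, Finset.sum_eq_single w]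
  · rw [(det_addVertex L hi hK w).pr_eq, if_pos, mul_one]
    rw [if_pos ⟨hw, h⟩]
  · intro w' _ hw'
    rw [(det_addVertex L hi hK w').pr_eq, if_neg, mul_zero]
    split_ifs with h'
    · intro e
      rw [Option.some.injEq] at e
      have : w' ∈ insert w K := e ▸ Finset.mem_insert_self _ _
      rcases Finset.mem_insert.1 this with h1 | h1
      · exact hw' h1
      · exact h'.1 h1
    · simp
  · simp

theorem pr_extend_eq_zero {K C : Finset (Fin n)} (hK : K ∈ cliques G i)
    (h : ¬ (rootedSystem L i hi).Inc K C) (src : QueryAlg n (Option (Fin n))) :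
    pr L (extend K src) (some C) = 0 := by
  rw [extend, pr_bindO]
  refine Finset.sum_eq_zero fun w _ => ?_
  rw [(det_addVertex L hi hK w).pr_eq, if_neg, mul_zero]
  split_ifs with h'
  · intro e
    rw [Option.some.injEq] at e
    exact h (e ▸ h'.2)
  · simp

/-- From a random edge obtain a random vertex, such that all vertices of degree at least `M` are
about equally likely. -/
noncomputable def highVertex (M : ℝ) (E : QueryAlg n (Option (Finset (Fin n)))) :
    QueryAlg n (Option (Fin n)) :=
  bindO E fun e => bindO (pick e) fun w => bind (askDeg w) fun d =>
    if M ≤ d then bindO (coin (M / d)) fun _ => output (some w) else output none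

theorem pr_highVertex {M : ℝ} (hM : 0 < M) (E : QueryAlg n (Option (Finset (Fin n))))
    {w : Fin n} (hw : M ≤ L.dg w) :
    pr L (highVertex M E) (some w) =
      ∑ e, if w ∈ e then pr L E (some e) * (1 / e.card * (M / L.dg w)) else 0 := by
  rw [highVertex, pr_bindO]
  refine Finset.sum_congr rfl fun e _ => ?_
  have hd : 0 < (L.dg w : ℝ) := hM.trans_le hw
  have h1 : ∀ x, pr L (bind (askDeg x) fun d => if M ≤ d then
      bindO (coin (M / d)) fun _ => output (some x) else output none) (some w) =
      if w = x then M / L.dg w else 0 := by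
    intro x
    rw [(det_askDeg L x).pr_bind]
    by_cases hx : w = x
    · subst hx
      rw [if_pos hw, pr_bindO, if_pos rfl]
      simp [pr_coin L (div_nonneg hM.le hd.le) ((div_le_one hd).2 hw), pr_output_some]
    · split_ifs with h
      · rw [pr_bindO]
        simp [pr_output_some, hx]
      · simp
  rw [pr_bindO]
  simp only [h1, pr_pick]
  simp [mul_ite]

theorem card_edges_at (L : AdjLists G) (w : Fin n) :
    ((cliques G 2).filter fun e => w ∈ e).card = L.dg w := by
  rw [← edgeSystem_deg L w, FacetSystem.deg]
  congr 1
  refine Finset.filter_congr fun e he => ?_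
  constructor
  · intro hw
    have h1 : (e.erase w).card = 1 := by
      rw [Finset.card_erase_of_mem hw, (mem_cliques.1 he).card_eq]
    obtain ⟨x, hx⟩ := Finset.card_eq_one.1 h1
    have h2 : e = {w, x} := by rw [← hx, Finset.insert_erase hw]
    have h3 : G.Adj w x := pair_mem_cliques_two.1 (h2 ▸ he)
    exact (edgeSystem_inc.2 ⟨x, h3, h2⟩).2
  · intro hw
    obtain ⟨x, -, rfl⟩ := edgeSystem_inc.1 (show (edgeSystem G).Inc {w} e from ⟨he, hw⟩)
    simp

theorem pr_highVertex_bounds {M pl ph : ℝ} (hM : 0 < M)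
    {E : QueryAlg n (Option (Finset (Fin n)))}
    (h0 : ∀ e ∉ cliques G 2, pr L E (some e) = 0)
    (h1 : ∀ e ∈ cliques G 2, pl ≤ pr L E (some e))
    (h2 : ∀ e ∈ cliques G 2, pr L E (some e) ≤ ph) {w : Fin n} (hw : M ≤ L.dg w) :
    pl * M / 2 ≤ pr L (highVertex M E) (some w) ∧
      pr L (highVertex M E) (some w) ≤ ph * M / 2 := by
  have hd : 0 < (L.dg w : ℝ) := hM.trans_le hw
  have h3 : pr L (highVertex M E) (some w) =
      ∑ e ∈ (cliques G 2).filter fun e => w ∈ e, pr L E (some e) * (1 / 2 * (M / L.dg w)) := by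
    rw [pr_highVertex hM E hw]
    symm
    rw [Finset.sum_filter]
    refine (Finset.sum_subset (Finset.subset_univ (cliques G 2)) fun e _ he => ?_).symm.trans ?_
      |>.symm
    · rw [h0 e he]; simp
    · refine Finset.sum_congr rfl fun e he => ?_
      rw [(mem_cliques.1 he).card_eq]
      push_cast
      rfl
  have hc : ∀ p : ℝ, ∑ _e ∈ (cliques G 2).filter fun e => w ∈ e, p * (1 / 2 * (M / L.dg w)) =
      p * M / 2 := by
    intro p
    rw [Finset.sum_const, card_edges_at L w, nsmul_eq_mul]
    field_simp
  rw [h3, ← hc pl, ← hc ph]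
  constructor <;> refine Finset.sum_le_sum fun e he => mul_le_mul_of_nonneg_right ?_ (by positivity)
  · exact h1 e (Finset.mem_filter.1 he).1
  · exact h2 e (Finset.mem_filter.1 he).1

theorem maxLe_highVertex {M : ℝ} {E : QueryAlg n (Option (Finset (Fin n)))} {m : ℕ}
    (h : MaxLe L E m) : MaxLe L (highVertex M E) (m + 1) := by
  refine h.bindO fun e _ => ?_
  refine MaxLe.mono (a := 0 + (1 + 0)) ((MaxLe.pick L _ 0).bindO fun w _ =>
    MaxLe.bind_askDeg w ?_) (by omega)
  split_ifs
  · exact MaxLe.mono (a := 0 + 0) ((MaxLe.coin L _ 0).bindO fun _ _ => MaxLe.output L _ _) le_rfl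
  · exact MaxLe.output L _ _

/-- One trial to extend a clique `K` with first vertex `v` of degree `d`. A neighbor of `v` is
drawn; but if `d` is larger than `M`, so is the degree of the vertex to be added, and it is
drawn by `highVertex`. -/
noncomputable def trial (M : ℝ) (E : QueryAlg n (Option (Finset (Fin n)))) (K : Finset (Fin n))
    (v : Fin n) (d : ℕ) : QueryAlg n (Option (Finset (Fin n))) :=
  extend K (if (d : ℝ) ≤ M then randNbr v d else highVertex M E)

/-- The inverse of the probability with which a trial finds a given extension. -/
noncomputable def trialRate (M ph : ℝ) (d : ℕ) : ℝ := if (d : ℝ) ≤ M then d else 2 / (ph * M)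

theorem root_adj {K : Finset (Fin n)} (hK : K ∈ cliques G i) (hi : 2 ≤ i) (hne : K.Nonempty) :
    0 < L.dg (root L.dg K hne) := by
  have hc : 1 < K.card := by rw [(mem_cliques.1 hK).card_eq]; omega
  obtain ⟨w, hw, hwr⟩ := Finset.exists_mem_ne hc (root L.dg K hne)
  exact L.dg_pos (adj_of_mem_cliques hK (root_mem _ hne) hw hwr.symm)

theorem pr_trial_bounds {M pl ph δ : ℝ} (hM : 0 < M) (hδ : 0 < δ)
    {E : QueryAlg n (Option (Finset (Fin n)))}
    (h0 : ∀ e ∉ cliques G 2, pr L E (some e) = 0)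
    (h1 : ∀ e ∈ cliques G 2, pl ≤ pr L E (some e))
    (h2 : ∀ e ∈ cliques G 2, pr L E (some e) ≤ ph) (hpl : (1 - δ) * ph ≤ pl)
    {K C : Finset (Fin n)} (hne : K.Nonempty)
    (hC : (rootedSystem L i hi).Inc K C) :
    (1 - δ) * (1 / trialRate M ph (L.dg (root L.dg K hne))) ≤
      pr L (trial M E K (root L.dg K hne) (L.dg (root L.dg K hne))) (some C) ∧
    pr L (trial M E K (root L.dg K hne) (L.dg (root L.dg K hne))) (some C) ≤
      1 / trialRate M ph (L.dg (root L.dg K hne)) := by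
  have hK : K ∈ cliques G i := hC.mem_faces
  obtain ⟨w, hw, rfl⟩ := exists_insert_of_cliqueSystem_inc hC
  have hpos := root_adj (L := L) hK hi hne
  have hpos' : (0 : ℝ) < L.dg (root L.dg K hne) := by exact_mod_cast hpos
  rw [trial, pr_extend_insert hK hw hC, trialRate]
  obtain ⟨hcl, hnr⟩ := (cliqueSystem_inc_insert hw).1 hC
  have hprec := (mem_nonRoot_insert L.dg hne).1 hnr
  split_ifs with hd
  · have hadj : G.Adj (root L.dg K hne) w := by
      refine adj_of_mem_cliques hcl (Finset.mem_insert_of_mem (root_mem _ hne))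
        (Finset.mem_insert_self _ _) fun e => hw ?_
      rw [← e]; exact root_mem _ hne
    rw [pr_randNbr, if_pos hadj]
    refine ⟨?_, le_rfl⟩
    have : 0 ≤ 1 / (L.dg (root L.dg K hne) : ℝ) := by positivity
    nlinarith
  · have hwM : M ≤ L.dg w := by
      have : L.dg (root L.dg K hne) ≤ L.dg w := by
        rcases hprec with h | h <;> omega
      have : (L.dg (root L.dg K hne) : ℝ) ≤ L.dg w := by exact_mod_cast this
      linarith [not_le.1 hd]
    obtain ⟨h3, h4⟩ := pr_highVertex_bounds hM h0 h1 h2 hwM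
    rw [one_div_div]
    refine ⟨le_trans ?_ h3, h4⟩
    have := mul_le_mul_of_nonneg_right hpl (by positivity : 0 ≤ M / 2)
    linarith

theorem trialRate_pos {M ph : ℝ} (hM : 0 < M) (hph : 0 < ph) {d : ℕ} (hd : 0 < d) :
    0 < trialRate M ph d := by
  have : (0 : ℝ) < d := by exact_mod_cast hd
  rw [trialRate]; split_ifs <;> positivity

theorem trialData {M pl ph δ θ : ℝ} (hM : 0 < M) (hph : 0 < ph) (hδ : 0 < δ) (hδ2 : δ ≤ 1 / 2)
    (hθ : 0 < θ) {E : QueryAlg n (Option (Finset (Fin n)))}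
    (h0 : ∀ e ∉ cliques G 2, pr L E (some e) = 0)
    (h1 : ∀ e ∈ cliques G 2, pl ≤ pr L E (some e))
    (h2 : ∀ e ∈ cliques G 2, pr L E (some e) ≤ ph) (hpl : (1 - δ) * ph ≤ pl)
    {K : Finset (Fin n)} (hne : K.Nonempty) (hK : K ∈ cliques G i) {q : ℝ}
    (hq : (1 - δ) * (1 / trialRate M ph (L.dg (root L.dg K hne))) ≤ q)
    (hq' : q ≤ 1 / trialRate M ph (L.dg (root L.dg K hne))) :
    TrialData δ θ (1 / trialRate M ph (L.dg (root L.dg K hne)))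
      ((rootedSystem L i hi).deg K) q
      (∑ C, pr L (trial M E K (root L.dg K hne) (L.dg (root L.dg K hne))) (some C)) := by
  have hpos := root_adj (L := L) hK hi hne
  have hQ : ∑ C, pr L (trial M E K (root L.dg K hne) (L.dg (root L.dg K hne))) (some C) =
      ∑ C ∈ (rootedSystem L i hi).cells.filter fun C => K ∈ (rootedSystem L i hi).facets C,
        pr L (trial M E K (root L.dg K hne) (L.dg (root L.dg K hne))) (some C) := by
    symm
    refine Finset.sum_subset (Finset.subset_univ _) fun C _ hC => ?_
    exact pr_extend_eq_zero (hi := hi) hK (fun h => hC (Finset.mem_filter.2 h)) _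
  have hb : ∀ C ∈ (rootedSystem L i hi).cells.filter fun C =>
      K ∈ (rootedSystem L i hi).facets C, _ := fun C hC =>
    pr_trial_bounds hM hδ h0 h1 h2 hpl hne
      (show (rootedSystem L i hi).Inc K C from Finset.mem_filter.1 hC)
  refine ⟨hδ, hδ2, hθ, one_div_pos.2 (trialRate_pos hM hph hpos), Nat.cast_nonneg _,
    Finset.sum_nonneg fun _ _ => pr_nonneg _ _ _, sum_pr_some_le_one _ _, hq, hq', ?_, ?_⟩
  · rw [hQ, mul_left_comm, FacetSystem.deg, ← nsmul_eq_mul, ← Finset.sum_const]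
    exact Finset.sum_le_sum fun C hC => (hb C hC).1
  · rw [hQ, FacetSystem.deg, ← nsmul_eq_mul, ← Finset.sum_const]
    exact Finset.sum_le_sum fun C hC => (hb C hC).2

/-- The step of the walk at a clique that is visited first. -/
noncomputable def cliqueFresh (M ph θ τ : ℝ) (E : QueryAlg n (Option (Finset (Fin n))))
    (K : Finset (Fin n)) : QueryAlg n (Option (Finset (Fin n))) :=
  if h : K.Nonempty then bind (degsOf K) fun f =>
    freshTrials (trial M E K (root f K h) (f (root f K h))) (trialRate M ph (f (root f K h))) θ τ
  else output none

/-- The step of the walk at a clique that is reached from a larger one. -/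
noncomputable def cliqueCont (M ph θ : ℝ) (E : QueryAlg n (Option (Finset (Fin n))))
    (K : Finset (Fin n)) : QueryAlg n (Option (Finset (Fin n))) :=
  if h : K.Nonempty then bind (degsOf K) fun f =>
    contTrials (trial M E K (root f K h) (f (root f K h))) (trialRate M ph (f (root f K h))) θ
  else output none

/-- The facets of a clique in the rooted system. -/
noncomputable def cliqueFacets (C : Finset (Fin n)) : QueryAlg n (Finset (Finset (Fin n))) :=
  bind (degsOf C) fun f => output (dropEach (nonRoot f C) C)

theorem det_cliqueFacets (L : AdjLists G) (hi : 2 ≤ i) {C : Finset (Fin n)}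
    (hC : C ∈ (rootedSystem L i hi).cells) :
    Det L (cliqueFacets C) ((rootedSystem L i hi).facets C) (i + 1) := by
  have hc : C.card = i + 1 := (mem_cliques.1 hC).card_eq
  refine Det.mono (a := C.card + 0) ((det_degsOf L C).bind ?_) (by omega)
  rw [nonRoot_congr (d' := L.dg) fun v hv => degOn_of_mem hv]
  exact Det.output L _ 0

theorem root_degOn {K : Finset (Fin n)} (h : K.Nonempty) :
    root (degOn L K) K h = root L.dg K h := root_congr h fun _ hv => degOn_of_mem hv

theorem degOn_root {K : Finset (Fin n)} (h : K.Nonempty) :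
    degOn L K (root L.dg K h) = L.dg (root L.dg K h) := degOn_of_mem (root_mem _ h)

section Steps

variable {M ph θ τ : ℝ} {E : QueryAlg n (Option (Finset (Fin n)))}

theorem pr_cliqueFresh {K : Finset (Fin n)} (h : K.Nonempty) (C : Finset (Fin n)) :
    pr L (cliqueFresh M ph θ τ E K) (some C) =
      pr L (freshTrials (trial M E K (root L.dg K h) (L.dg (root L.dg K h)))
        (trialRate M ph (L.dg (root L.dg K h))) θ τ) (some C) := by
  rw [cliqueFresh, dif_pos h, (det_degsOf L K).pr_bind, root_degOn, degOn_root]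

theorem pr_cliqueCont {K : Finset (Fin n)} (h : K.Nonempty) (C : Finset (Fin n)) :
    pr L (cliqueCont M ph θ E K) (some C) =
      pr L (contTrials (trial M E K (root L.dg K h) (L.dg (root L.dg K h)))
        (trialRate M ph (L.dg (root L.dg K h))) θ) (some C) := by
  rw [cliqueCont, dif_pos h, (det_degsOf L K).pr_bind, root_degOn, degOn_root]

end Steps

theorem nonempty_of_mem_cliques {K : Finset (Fin n)} (hi : 2 ≤ i) (hK : K ∈ cliques G i) :
    K.Nonempty := Finset.card_pos.1 (by rw [(mem_cliques.1 hK).card_eq]; omega)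

/-- The trials at the cliques of size `i` satisfy the conditions under which the walk visits all
pairs about equally often. -/
theorem goodKernels_clique {M pl2 ph2 pl ph δ θ τ : ℝ} (hM : 0 < M) (hph2 : 0 < ph2) (hδ : 0 < δ)
    (hδ2 : δ ≤ 1 / 2) (hθ : 0 < θ) (hτ : τ = 4 * θ / δ ^ 2)
    {A E : QueryAlg n (Option (Finset (Fin n)))}
    (h0 : ∀ e ∉ cliques G 2, pr L E (some e) = 0)
    (h1 : ∀ e ∈ cliques G 2, pl2 ≤ pr L E (some e))
    (h2 : ∀ e ∈ cliques G 2, pr L E (some e) ≤ ph2) (hpl2 : (1 - δ) * ph2 ≤ pl2)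
    (hpl : 0 ≤ pl) (hA0 : ∀ K ∉ cliques G i, pr L A (some K) = 0)
    (hA1 : ∀ K ∈ cliques G i, pl ≤ pr L A (some K))
    (hA2 : ∀ K ∈ cliques G i, pr L A (some K) ≤ ph) :
    (rootedSystem L i hi).GoodKernels (fun K => pr L A (some K))
      (fun K C => pr L (cliqueFresh M ph2 θ τ E K) (some C))
      (fun K C => pr L (cliqueCont M ph2 θ E K) (some C))
      pl ph τ (δ * θ) δ (1 / (1 - δ)) := by
  have hτ0 : 0 < τ := by rw [hτ]; positivity
  have hδ1 : 0 < 1 - δ := by linarith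
  have hfr : ∀ (K : Finset (Fin n)) (hne : K.Nonempty) (C : Finset (Fin n)), K ∈ cliques G i →
      pr L (cliqueFresh M ph2 θ τ E K) (some C) = _ := fun K hne C hK =>
    (pr_cliqueFresh hne C).trans (pr_freshTrials _ _
      (trialRate_pos hM hph2 (root_adj hK hi hne)).le hτ0 C)
  have hct : ∀ (K : Finset (Fin n)) (hne : K.Nonempty) (C : Finset (Fin n)),
      pr L (cliqueCont M ph2 θ E K) (some C) = _ := fun K hne C =>
    (pr_cliqueCont hne C).trans (pr_contTrials _ _ _ C)
  have hdata : ∀ K C (hC : (rootedSystem L i hi).Inc K C) (hne : K.Nonempty), TrialData δ θ _ _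
      (pr L (trial M E K (root L.dg K hne) (L.dg (root L.dg K hne))) (some C)) _ :=
    fun K C hC hne => trialData (hi := hi) hM hph2 hδ hδ2 hθ h0 h1 h2 hpl2 hne hC.mem_faces
      (pr_trial_bounds hM hδ h0 h1 h2 hpl2 hne hC).1
      (pr_trial_bounds hM hδ h0 h1 h2 hpl2 hne hC).2
  refine ⟨hpl, hτ0, hδ, by linarith, ?_, hA0, hA1, hA2, fun _ _ => pr_nonneg _ _ _,
    fun _ _ => pr_nonneg _ _ _, ?_, ?_, ?_, ?_, ?_⟩
  · rw [le_div_iff₀ hδ1]; linarith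
  · intro K hK C hC
    have hne := nonempty_of_mem_cliques hi hK
    rw [hfr K hne C hK, trial, pr_extend_eq_zero (hi := hi) hK hC]
    ring
  · intro K hK C hC
    have hne := nonempty_of_mem_cliques hi hK
    rw [hct K hne C, trial, pr_extend_eq_zero (hi := hi) hK hC, mul_zero]
  · intro K
    by_cases hK : K ∈ cliques G i
    · have hne := nonempty_of_mem_cliques hi hK
      set t := trial M E K (root L.dg K hne) (L.dg (root L.dg K hne)) with ht
      set D := trialRate M ph2 (L.dg (root L.dg K hne)) with hD
      have hle : pr L t none ≤ 1 := by
        rw [pr_none_eq]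
        linarith [Finset.sum_nonneg fun C (_ : C ∈ Finset.univ) => pr_nonneg L t (some C)]
      refine ⟨1 - pr L t none ^ ⌊D / θ⌋₊, ?_, ?_, fun C hC => ?_⟩
      · linarith [pow_le_one₀ (n := ⌊D / θ⌋₊) (pr_nonneg L t none) hle]
      · linarith [pow_nonneg (pr_nonneg L t none) ⌊D / θ⌋₊]
      · have hd := hdata K C hC hne
        rw [hfr K hne C hK, hct K hne C]
        simp only [← ht, ← hD, pr_none_eq L t] at hd ⊢
        have h3 := hd.fresh_le hτ0 ⌊D / τ⌋₊
        have h4 := hd.cont_le ⌊D / θ⌋₊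
        rw [one_div_one_div] at h3
        refine ⟨?_, h4⟩
        rw [sub_sub_cancel, div_eq_mul_one_div (_ ^ _)]
        refine mul_le_mul_of_nonneg_left h3 (pow_nonneg ?_ _)
        linarith [hd.Q_le_one]
    · exact ⟨0, le_rfl, zero_le_one, fun C hC => absurd hC.mem_faces hK⟩
  · intro K C hC he
    have hK : K ∈ cliques G i := hC.mem_faces
    have hne := nonempty_of_mem_cliques hi hK
    have hd := hdata K C hC hne
    rw [hfr K hne C hK]
    rw [pr_none_eq]
    have h3 := hd.le_pow he
    have h4 := hd.le_fresh hτ (he.trans (by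
      rw [le_div_iff₀ hδ]; nlinarith [mul_pos hδ hθ]))
    rw [one_div_one_div] at h3 h4
    calc (1 - δ) ^ 3 / τ = (1 - δ) * ((1 - δ) ^ 2 / τ) := by ring
      _ ≤ _ := mul_le_mul h3 h4 (by positivity) (pow_nonneg (by linarith [hd.Q_le_one]) _)
  · intro K C hC he y hy hy1
    have hK : K ∈ cliques G i := hC.mem_faces
    have hne := nonempty_of_mem_cliques hi hK
    have hd := hdata K C hC hne
    rw [hfr K hne C hK, hct K hne C, pr_none_eq]
    have h3 := hd.le_fresh_add_cont hτ hy hy1 rfl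
    rw [one_div_one_div] at h3
    exact h3

end QueryAlg

end CliqueSampling

namespace CliqueSampling

namespace QueryAlg

variable {n : ℕ} {G : SimpleGraph (Fin n)} {L : AdjLists G}

/-! ### Almost uniform cliques of all sizes -/

/-- `A` outputs only `i`-cliques, each with probability between `pl` and `ph`; its expected and
maximum numbers of queries are at most `c` and `m`. -/
structure Sampler (L : AdjLists G) (A : QueryAlg n (Option (Finset (Fin n)))) (i : ℕ)
    (pl ph c : ℝ) (m : ℕ) : Prop where
  pr_zero : ∀ K ∉ cliques G i, pr L A (some K) = 0
  le_pr : ∀ K ∈ cliques G i, pl ≤ pr L A (some K)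
  pr_le : ∀ K ∈ cliques G i, pr L A (some K) ≤ ph
  cost_nonneg : 0 ≤ c
  costLe : CostLe L A c
  maxLe : MaxLe L A m

/-- The degree of the first vertex of a clique in the degree order, hence its minimum degree. -/
noncomputable def rootDeg (L : AdjLists G) (K : Finset (Fin n)) : ℕ :=
  if h : K.Nonempty then L.dg (root L.dg K h) else 0

theorem rootDeg_of_nonempty {K : Finset (Fin n)} (h : K.Nonempty) :
    rootDeg L K = L.dg (root L.dg K h) := dif_pos h

theorem rootDeg_insert_le (w : Fin n) {K : Finset (Fin n)} (h : K.Nonempty) :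
    rootDeg L (insert w K) ≤ rootDeg L K := by
  rw [rootDeg_of_nonempty h, rootDeg_of_nonempty (Finset.insert_nonempty w K)]
  exact root_le L.dg _ (Finset.mem_insert_of_mem (root_mem L.dg h))

theorem sum_rootDeg_one (L : AdjLists G) : ∑ K ∈ cliques G 1, rootDeg L K = ∑ v, L.dg v := by
  have h1 : cliques G 1 = Finset.univ.image fun v : Fin n => ({v} : Finset (Fin n)) := by
    ext K; rw [mem_cliques_one]; simp [eq_comm]
  rw [h1, Finset.sum_image fun v _ w _ h => Finset.singleton_injective h]
  refine Finset.sum_congr rfl fun v _ => ?_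
  rw [rootDeg_of_nonempty (Finset.singleton_nonempty v)]
  rw [Finset.mem_singleton.1 (root_mem L.dg (Finset.singleton_nonempty v))]

/-- One more vertex: the walk from cliques of size `i` to cliques of size `i + 1`. -/
noncomputable def cliqueStep (M ph θ τ : ℝ) (E : QueryAlg n (Option (Finset (Fin n)))) (J : ℕ)
    (A : QueryAlg n (Option (Finset (Fin n)))) : QueryAlg n (Option (Finset (Fin n))) :=
  walk A (cliqueFresh M ph θ τ E) (cliqueCont M ph θ E) cliqueFacets J

theorem maxLe_trial {M : ℝ} {E : QueryAlg n (Option (Finset (Fin n)))} {mE i : ℕ}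
    (hE : MaxLe L E mE) (hi : 2 ≤ i) {K : Finset (Fin n)} (hK : K ∈ cliques G i) (v : Fin n)
    (d : ℕ) : MaxLe L (trial M E K v d) (mE + 2 * i + 2) := by
  refine MaxLe.mono (a := (mE + 1) + (2 * i + 1)) (MaxLe.bindO ?_ fun w _ =>
    (det_addVertex L hi hK w).maxLe) (by omega)
  split_ifs
  · exact (maxLe_randNbr L v d).mono (by omega)
  · exact maxLe_highVertex hE

section Costs

variable {M ph θ τ : ℝ} {E : QueryAlg n (Option (Finset (Fin n)))} {mE i : ℕ}
  {K : Finset (Fin n)}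

theorem maxLe_cliqueFresh (hE : MaxLe L E mE) (hi : 2 ≤ i) (hM : 0 < M) (hph : 0 < ph)
    (hθ : 0 < θ) (hτ : θ ≤ τ) {D : ℝ} (hD : ∀ d, trialRate M ph d ≤ D) (hK : K ∈ cliques G i) :
    MaxLe L (cliqueFresh M ph θ τ E K) (i + (2 * ⌊D / θ⌋₊ + 1) * (mE + 2 * i + 2)) := by
  have h := nonempty_of_mem_cliques hi hK
  rw [cliqueFresh, dif_pos h]
  have hc := (mem_cliques.1 hK).card_eq
  rw [← hc]
  refine (det_degsOf L K).maxLe_bind ?_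
  rw [root_degOn, degOn_root, hc]
  refine (maxLe_freshTrials (maxLe_trial hE hi hK _ _)
    (trialRate_pos hM hph (root_adj hK hi h)).le hθ hτ).mono ?_
  have : ⌊trialRate M ph (L.dg (root L.dg K h)) / θ⌋₊ ≤ ⌊D / θ⌋₊ :=
    Nat.floor_le_floor (div_le_div_of_nonneg_right (hD _) hθ.le)
  gcongr

theorem maxLe_cliqueCont (hE : MaxLe L E mE) (hi : 2 ≤ i)
    (hθ : 0 < θ) {D : ℝ} (hD : ∀ d, trialRate M ph d ≤ D) (hK : K ∈ cliques G i) :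
    MaxLe L (cliqueCont M ph θ E K) (i + (2 * ⌊D / θ⌋₊ + 1) * (mE + 2 * i + 2)) := by
  have h := nonempty_of_mem_cliques hi hK
  rw [cliqueCont, dif_pos h]
  have hc := (mem_cliques.1 hK).card_eq
  rw [← hc]
  refine (det_degsOf L K).maxLe_bind ?_
  rw [root_degOn, degOn_root, hc]
  refine (maxLe_contTrials (maxLe_trial hE hi hK _ _)).mono ?_
  have : ⌊trialRate M ph (L.dg (root L.dg K h)) / θ⌋₊ ≤ ⌊D / θ⌋₊ :=
    Nat.floor_le_floor (div_le_div_of_nonneg_right (hD _) hθ.le)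
  gcongr

theorem costLe_cliqueFresh (hE : MaxLe L E mE) (hi : 2 ≤ i) (hM : 0 < M) (hph : 0 < ph)
    (hθ : 0 < θ) (hτ : θ ≤ τ) (hK : K ∈ cliques G i) :
    CostLe L (cliqueFresh M ph θ τ E K)
      (i + (mE + 2 * i + 2) * (2 * (trialRate M ph (rootDeg L K) / θ) + 1)) := by
  have h := nonempty_of_mem_cliques hi hK
  rw [cliqueFresh, dif_pos h, rootDeg_of_nonempty h]
  have hc := (mem_cliques.1 hK).card_eq
  have hr := trialRate_pos hM hph (root_adj (L := L) hK hi h)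
  have h1 := (det_degsOf L K).costLe_bind (g := fun f =>
    freshTrials (trial M E K (root f K h) (f (root f K h))) (trialRate M ph (f (root f K h))) θ τ)
    (c := (mE + 2 * i + 2 : ℕ) * (2 * (trialRate M ph (L.dg (root L.dg K h)) / θ) + 1))
    (by positivity) (by
      rw [root_degOn, degOn_root]
      exact costLe_freshTrials (Nat.cast_nonneg _) (maxLe_trial hE hi hK _ _).costLe hr.le hθ hτ)
  rw [hc] at h1
  push_cast at h1
  exact h1

theorem costLe_cliqueCont (hE : MaxLe L E mE) (hi : 2 ≤ i) (hK : K ∈ cliques G i)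
    (h : K.Nonempty) :
    CostLe L (cliqueCont M ph θ E K) (i + (mE + 2 * i + 2) *
      ∑ j ∈ Finset.range ⌊trialRate M ph (rootDeg L K) / θ⌋₊,
        pr L (trial M E K (root L.dg K h) (L.dg (root L.dg K h))) none ^ j) := by
  rw [cliqueCont, dif_pos h, rootDeg_of_nonempty h]
  have hc := (mem_cliques.1 hK).card_eq
  have h1 := (det_degsOf L K).costLe_bind (g := fun f =>
    contTrials (trial M E K (root f K h) (f (root f K h))) (trialRate M ph (f (root f K h))) θ)
    (c := (mE + 2 * i + 2 : ℕ) *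
      ∑ j ∈ Finset.range ⌊trialRate M ph (L.dg (root L.dg K h)) / θ⌋₊,
        pr L (trial M E K (root L.dg K h) (L.dg (root L.dg K h))) none ^ j)
    (mul_nonneg (Nat.cast_nonneg _) (Finset.sum_nonneg fun j _ => pow_nonneg (pr_nonneg _ _ _) _))
    (by
      rw [root_degOn, degOn_root]
      exact costLe_retry (Nat.cast_nonneg _) (maxLe_trial hE hi hK _ _).costLe _)
  rw [hc] at h1
  push_cast at h1
  exact h1

end Costs

/-- The expected number of trials until a first success, at a face entered with probability
proportional to its degree, is bounded independently of this degree. -/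
theorem deg_mul_geom_sum_le {δ θ l e q Q : ℝ} (h : TrialData δ θ l e q Q) (r : ℕ) :
    e * ∑ j ∈ Finset.range r, (1 - Q) ^ j ≤ 1 / (1 - δ) * (1 / l) := by
  have hδ : 0 < 1 - δ := by linarith [h.δ_le]
  have hl := h.l_pos
  have hG : 0 ≤ ∑ j ∈ Finset.range r, (1 - Q) ^ j :=
    Finset.sum_nonneg fun j _ => pow_nonneg (by linarith [h.Q_le_one]) _
  have h1 : Q * ∑ j ∈ Finset.range r, (1 - Q) ^ j ≤ 1 := by
    rw [mul_geom_sum_eq]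
    linarith [pow_nonneg (by linarith [h.Q_le_one] : 0 ≤ 1 - Q) r]
  have h2 := mul_le_mul_of_nonneg_right h.le_Q hG
  rw [one_div_mul_one_div, le_div_iff₀ (by positivity)]
  linarith

theorem Sampler.step {M δ θ τ pl2 ph2 cE pl ph cA H Z D : ℝ} {mE mA i k a J : ℕ}
    {N : Fin n → Finset (Fin n)} {E A : QueryAlg n (Option (Finset (Fin n)))}
    (hE : Sampler L E 2 pl2 ph2 cE mE) (hA : Sampler L A i pl ph cA mA)
    (hN : ∀ v, (N v).card ≤ a) (hG : ∀ u v, G.Adj u v → v ∈ N u ∨ u ∈ N v) (ha : 0 < a)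
    (hi : 2 ≤ i) (hik : i ≤ k) (hM : 0 < M) (hph2 : 0 < ph2) (hpl2 : (1 - δ) * ph2 ≤ pl2)
    (hδ : 0 < δ) (hδ2 : δ ≤ 1 / 2) (hθ : 0 < θ) (hτ : τ = 4 * θ / δ ^ 2) (hpl : 0 ≤ pl)
    (hph : 0 ≤ ph)
    (hσ : 2 * ((i * (i * a) : ℕ) : ℝ) ≤ δ * (δ * θ)) (hJ : (cliques G i).card < 2 ^ J)
    (hu : (1 / (1 - δ)) ^ (J + 1) ≤ 2) (hH : ∀ d : ℕ, trialRate M ph2 d ≤ H * d)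
    (hD : ∀ d : ℕ, trialRate M ph2 d ≤ D) (hZ0 : 0 ≤ Z)
    (hZ : ph * (H * ((∑ K ∈ cliques G i, rootDeg L K : ℕ) : ℝ)) ≤ Z * θ) :
    Sampler L (cliqueStep M ph2 θ τ E J A) (i + 1)
      (i / ((J + 1) * τ) * pl * (1 - δ) ^ (3 * J + 3))
      (i / ((J + 1) * τ) * ph * (1 / (1 - δ)) ^ J)
      (cA + (J + 1) * (2 * k + 1 + (mE + 2 * k + 2) * (1 + 2 * Z)))
      (mA + (J + 1) * (2 * k + 1 + (2 * ⌊D / θ⌋₊ + 1) * (mE + 2 * k + 2))) := by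
  have hg := goodKernels_clique (hi := hi) hM hph2 hδ hδ2 hθ hτ hE.pr_zero hE.le_pr hE.pr_le hpl2
    hpl hA.pr_zero hA.le_pr hA.pr_le
  have hfac := fun C (hC : C ∈ (rootedSystem L i hi).cells) => det_cliqueFacets L hi hC
  have hτ0 : 0 < τ := by rw [hτ]; positivity
  have hθτ : θ ≤ τ := by
    have h1 : δ ^ 2 ≤ 1 := pow_le_one₀ hδ.le (by linarith)
    rw [hτ, le_div_iff₀ (by positivity)]
    nlinarith
  have hik' : (i : ℝ) ≤ k := by exact_mod_cast hik
  have hempty : (rootedSystem L i hi).unsettled (δ * θ) δ J = ∅ :=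
    cliqueSystem_unsettled_eq_empty hN hG ha (by omega) hδ hσ hJ
  have hδ1 : 0 < 1 - δ := by linarith
  have hu1 : 1 ≤ 1 / (1 - δ) := by rw [le_div_iff₀ hδ1]; linarith
  have hrate0 : ∀ d : ℕ, 0 ≤ trialRate M ph2 d := fun d => by
    rw [trialRate]; split_ifs <;> positivity
  -- the expected number of trials at first visits
  have hsum : ph * ∑ K ∈ cliques G i, trialRate M ph2 (rootDeg L K) ≤ Z * θ := by
    refine le_trans (mul_le_mul_of_nonneg_left ?_ hph) hZ
    rw [Nat.cast_sum, Finset.mul_sum]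
    exact Finset.sum_le_sum fun K _ => hH _
  refine ⟨fun K hK => pr_walk_eq_zero hg hfac J hK, fun K hK => le_pr_walk hg hfac hempty hK,
    fun K hK => pr_walk_le hg hfac J hK, ?_, ?_, ?_⟩
  · have := hA.cost_nonneg
    positivity
  · set κ : ℝ := mE + 2 * i + 2 with hκ
    have hκ0 : 0 ≤ κ := by positivity
    set cf : Finset (Fin n) → ℝ := fun K =>
      i + κ * (2 * (trialRate M ph2 (rootDeg L K) / θ) + 1) with hcf
    set Gs : Finset (Fin n) → ℝ := fun K => if h : K.Nonempty then
      ∑ j ∈ Finset.range ⌊trialRate M ph2 (rootDeg L K) / θ⌋₊,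
        pr L (trial M E K (root L.dg K h) (L.dg (root L.dg K h))) none ^ j else 0 with hGs
    have hGs0 : ∀ K, 0 ≤ Gs K := fun K => by
      simp only [hGs]
      split_ifs
      · exact Finset.sum_nonneg fun j _ => pow_nonneg (pr_nonneg _ _ _) _
      · exact le_rfl
    have hcf0 : ∀ K, 0 ≤ cf K := fun K => by
      have := hrate0 (rootDeg L K)
      simp only [hcf]; positivity
    have h1 : ∑ K, pr L A (some K) * cf K ≤ i + κ * (1 + 2 * Z) := by
      have e1 : ∀ K, pr L A (some K) * cf K = pr L A (some K) * (i + κ) +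
          κ * 2 / θ * (pr L A (some K) * trialRate M ph2 (rootDeg L K)) := fun K => by
        simp only [hcf]; ring
      simp_rw [e1, Finset.sum_add_distrib, ← Finset.sum_mul, ← Finset.mul_sum]
      have e2 : ∑ K, pr L A (some K) * trialRate M ph2 (rootDeg L K) ≤ Z * θ := by
        refine le_trans ?_ hsum
        rw [Finset.mul_sum, ← Finset.sum_subset (Finset.subset_univ (cliques G i))]
        · exact Finset.sum_le_sum fun K hK =>
            mul_le_mul_of_nonneg_right (hA.pr_le K hK) (hrate0 _)
        · intro K _ hK
          rw [hA.pr_zero K hK, zero_mul]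
      calc _ ≤ 1 * (i + κ) + κ * 2 / θ * (Z * θ) :=
            add_le_add (mul_le_mul_of_nonneg_right (sum_pr_some_le_one L A) (by positivity))
              (mul_le_mul_of_nonneg_left e2 (by positivity))
        _ = i + κ * (1 + 2 * Z) := by field_simp; ring
    have h2 : ∀ t < J, ∑ K, (rootedSystem L i hi).inflow (fun K => pr L A (some K))
        (fun K C => pr L (cliqueFresh M ph2 θ τ E K) (some C))
        (fun K C => pr L (cliqueCont M ph2 θ E K) (some C)) t K * (i + κ * Gs K) ≤
        i + κ * (1 + 2 * Z) := by
      intro t ht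
      set inf := (rootedSystem L i hi).inflow (fun K => pr L A (some K))
        (fun K C => pr L (cliqueFresh M ph2 θ τ E K) (some C))
        (fun K C => pr L (cliqueCont M ph2 θ E K) (some C)) t with hinf
      have e1 : ∀ K, inf K * (i + κ * Gs K) = inf K * i + κ * (inf K * Gs K) := fun K => by ring
      simp_rw [e1, Finset.sum_add_distrib, ← Finset.sum_mul, ← Finset.mul_sum]
      have e2 : ∀ K, inf K * Gs K ≤ if K ∈ cliques G i then
          2 / τ * (ph * trialRate M ph2 (rootDeg L K)) else 0 := by
        intro K
        have hle := hg.inflow_le ht.le K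
        rw [← hinf] at hle
        have hGsK := hGs0 K
        have hinfK : 0 ≤ inf K := hg.inflow_nonneg t K
        rcases ((rootedSystem L i hi).deg K).eq_zero_or_pos with hd | hd
        · rw [hd, Nat.cast_zero, zero_mul] at hle
          have : inf K = 0 := le_antisymm hle hinfK
          rw [this, zero_mul]
          split_ifs
          · have := hrate0 (rootDeg L K)
            positivity
          · exact le_rfl
        · obtain ⟨C, hC⟩ := Finset.card_pos.1 hd
          have hC' : (rootedSystem L i hi).Inc K C := Finset.mem_filter.1 hC
          have hK : K ∈ cliques G i := hC'.mem_faces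
          have hne := nonempty_of_mem_cliques hi hK
          rw [if_pos hK]
          have hb := pr_trial_bounds hM hδ hE.pr_zero hE.le_pr hE.pr_le hpl2 hne hC'
          have hd := trialData (hi := hi) hM hph2 hδ hδ2 hθ hE.pr_zero hE.le_pr hE.pr_le hpl2 hne
            hK hb.1 hb.2
          have e3 := deg_mul_geom_sum_le hd ⌊trialRate M ph2 (rootDeg L K) / θ⌋₊
          rw [one_div_one_div, ← pr_none_eq] at e3
          have e4 : (rootedSystem L i hi).deg K * Gs K ≤
              1 / (1 - δ) * trialRate M ph2 (rootDeg L K) := by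
            simp only [hGs]
            rw [dif_pos hne]
            refine e3.trans (le_of_eq ?_)
            rw [rootDeg_of_nonempty hne]
          have hq : 0 ≤ ph / τ * (1 / (1 - δ)) ^ J := by positivity
          calc inf K * Gs K ≤ ((rootedSystem L i hi).deg K * (ph / τ * (1 / (1 - δ)) ^ J)) * Gs K :=
                mul_le_mul_of_nonneg_right hle hGsK
            _ = ph / τ * (1 / (1 - δ)) ^ J * ((rootedSystem L i hi).deg K * Gs K) := by ring
            _ ≤ ph / τ * (1 / (1 - δ)) ^ J * (1 / (1 - δ) * trialRate M ph2 (rootDeg L K)) :=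
                mul_le_mul_of_nonneg_left e4 hq
            _ = (1 / (1 - δ)) ^ (J + 1) * (1 / τ * (ph * trialRate M ph2 (rootDeg L K))) := by
                rw [pow_succ]; ring
            _ ≤ 2 * (1 / τ * (ph * trialRate M ph2 (rootDeg L K))) := by
                have := hrate0 (rootDeg L K)
                exact mul_le_mul_of_nonneg_right hu (by positivity)
            _ = _ := by ring
      have e5 : ∑ K, inf K * Gs K ≤ 2 * Z := by
        refine (Finset.sum_le_sum fun K _ => e2 K).trans ?_
        rw [Finset.sum_ite_mem, Finset.univ_inter, ← Finset.mul_sum, ← Finset.mul_sum]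
        calc 2 / τ * (ph * ∑ K ∈ cliques G i, trialRate M ph2 (rootDeg L K)) ≤ 2 / τ * (Z * τ) := by
              refine mul_le_mul_of_nonneg_left (hsum.trans ?_) (by positivity)
              gcongr
          _ = 2 * Z := by field_simp
      have e6 : ∑ K, inf K ≤ 1 := sum_inflow_le_one hg hfac t
      nlinarith [mul_le_mul_of_nonneg_right e6 (Nat.cast_nonneg (α := ℝ) i),
        mul_le_mul_of_nonneg_left e5 hκ0]
    have hF0 : 0 ≤ i + κ * (1 + 2 * Z) := by positivity
    refine (costLe_walk (cc := fun K => i + κ * Gs K) hg hfac hA.cost_nonneg hA.costLe hcf0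
      (fun K => by have := hGs0 K; positivity)
      (fun K hK => ?_) (fun K hK => ?_) h1 hF0 h2).mono ?_
    · exact costLe_cliqueFresh hE.maxLe hi hM hph2 hθ hθτ hK
    · have hne := nonempty_of_mem_cliques hi hK
      have := costLe_cliqueCont (M := M) (ph := ph2) (θ := θ) hE.maxLe hi hK hne
      simp only [hGs]
      rw [dif_pos hne]
      exact this
    · have hκk : κ ≤ mE + 2 * k + 2 := by rw [hκ]; linarith
      have e7 : κ * (1 + 2 * Z) ≤ (mE + 2 * k + 2) * (1 + 2 * Z) := by gcongr
      have hJ0 : (0 : ℝ) ≤ J := Nat.cast_nonneg _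
      push_cast
      nlinarith
  · refine (maxLe_walk hg hfac J hA.maxLe
      (fun K hK => maxLe_cliqueFresh hE.maxLe hi hM hph2 hθ hθτ hD hK)
      fun K hK => maxLe_cliqueCont hE.maxLe hi hθ hD hK).mono ?_
    have e1 : (2 * ⌊D / θ⌋₊ + 1) * (mE + 2 * i + 2) ≤
        (2 * ⌊D / θ⌋₊ + 1) * (mE + 2 * k + 2) := by gcongr
    revert e1
    generalize (2 * ⌊D / θ⌋₊ + 1) * (mE + 2 * i + 2) = x
    generalize (2 * ⌊D / θ⌋₊ + 1) * (mE + 2 * k + 2) = y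
    intro e1
    have e2 := Nat.mul_le_mul_left J (by omega : i + 1 + (i + x) ≤ 2 * k + 1 + y)
    rw [Nat.add_mul J 1, one_mul]
    omega

end QueryAlg

end CliqueSampling

namespace CliqueSampling

namespace QueryAlg

variable {n : ℕ} {G : SimpleGraph (Fin n)} {L : AdjLists G}

/-- From an algorithm `E` for edges to an algorithm for cliques of size `j + 2`, one vertex at a
time. -/
noncomputable def cliqueAlg (M ph θ τ : ℝ) (J : ℕ) (E : QueryAlg n (Option (Finset (Fin n)))) :
    ℕ → QueryAlg n (Option (Finset (Fin n)))
  | 0 => E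
  | j + 1 => cliqueStep M ph θ τ E J (cliqueAlg M ph θ τ J E j)

/-- The probability of a clique of size `j + 2`, for edges of probability `b`, up to a factor `q`
for each vertex added. -/
noncomputable def cliqueRate (τ : ℝ) (J : ℕ) (b q : ℝ) : ℕ → ℝ
  | 0 => b
  | j + 1 => ((j + 2 : ℕ) : ℝ) / ((J + 1) * τ) * cliqueRate τ J b q j * q

theorem cliqueRate_eq (τ : ℝ) (J : ℕ) (b q : ℝ) (j : ℕ) :
    cliqueRate τ J b q j = b * q ^ j * cliqueRate τ J 1 1 j := by
  induction j with
  | zero => simp [cliqueRate]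
  | succ j ih => simp only [cliqueRate]; rw [ih]; ring

theorem inv_pow_le_cliqueRate {τ : ℝ} (hτ : 0 < τ) (J j : ℕ) :
    1 / ((J + 1) * τ) ^ j ≤ cliqueRate τ J 1 1 j := by
  induction j with
  | zero => simp [cliqueRate]
  | succ j ih =>
    have h0 : 0 < (J + 1) * τ := by positivity
    rw [cliqueRate, mul_one]
    have h1 : 1 / ((J + 1) * τ) ≤ ((j + 2 : ℕ) : ℝ) / ((J + 1) * τ) := by
      gcongr; push_cast; linarith [Nat.cast_nonneg (α := ℝ) j]
    calc 1 / ((J + 1) * τ) ^ (j + 1) = 1 / ((J + 1) * τ) * (1 / ((J + 1) * τ) ^ j) := by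
          rw [pow_succ]; field_simp
      _ ≤ _ := mul_le_mul h1 ih (by positivity) (by positivity)

theorem cliqueRate_nonneg {τ b q : ℝ} (hτ : 0 < τ) (J : ℕ) (hb : 0 ≤ b) (hq : 0 ≤ q) (j : ℕ) :
    0 ≤ cliqueRate τ J b q j := by
  induction j with
  | zero => exact hb
  | succ j ih => rw [cliqueRate]; positivity

theorem sampler_cliqueAlg {M δ θ τ pl2 ph2 cE H Z D : ℝ} {mE k a J : ℕ}
    {N : Fin n → Finset (Fin n)} {E : QueryAlg n (Option (Finset (Fin n)))}
    (hE : Sampler L E 2 pl2 ph2 cE mE)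
    (hN : ∀ v, (N v).card ≤ a) (hG : ∀ u v, G.Adj u v → v ∈ N u ∨ u ∈ N v) (ha : 0 < a)
    (hM : 0 < M) (hph2 : 0 < ph2) (hpl2 : (1 - δ) * ph2 ≤ pl2)
    (hδ : 0 < δ) (hδ2 : δ ≤ 1 / 2) (hθ : 0 < θ) (hτ : τ = 4 * θ / δ ^ 2)
    (hσ : 2 * ((k : ℝ) ^ 2 * a) ≤ δ * (δ * θ)) (hJ : ∀ i ≤ k, (cliques G i).card < 2 ^ J)
    (hu : (1 / (1 - δ)) ^ (J + 1) ≤ 2) (hH : ∀ d : ℕ, trialRate M ph2 d ≤ H * d)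
    (hH0 : 0 ≤ H) (hD : ∀ d : ℕ, trialRate M ph2 d ≤ D) (hZ0 : 0 ≤ Z)
    (hbase : ph2 * (2 * (n * (a : ℝ) ^ 2)) ≤ a) (hinv : 2 * ((k : ℝ) ^ 2 * a) ≤ (J + 1) * τ)
    (hZ : H * a ≤ Z * θ) {j : ℕ} (hj : j + 2 ≤ k) :
    Sampler L (cliqueAlg M ph2 θ τ J E j) (j + 2)
        (cliqueRate τ J pl2 ((1 - δ) ^ (3 * J + 3)) j)
        (cliqueRate τ J ph2 ((1 / (1 - δ)) ^ J) j)
        (cE + j * ((J + 1) * (2 * k + 1 + (mE + 2 * k + 2) * (1 + 2 * Z))))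
        (mE + j * ((J + 1) * (2 * k + 1 + (2 * ⌊D / θ⌋₊ + 1) * (mE + 2 * k + 2)))) ∧
      cliqueRate τ J ph2 ((1 / (1 - δ)) ^ J) j *
        ((∑ K ∈ cliques G (j + 2), rootDeg L K : ℕ) : ℝ) ≤ a := by
  have hδ1 : 0 < 1 - δ := by linarith
  have hτ0 : 0 < τ := by rw [hτ]; positivity
  have hsum := fun i (hi : 1 ≤ i) => sum_cliques_succ_le hi hN hG (rootDeg L)
    fun w K hK => rootDeg_insert_le w hK
  have huJ : (1 / (1 - δ)) ^ J ≤ 2 := by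
    refine le_trans (pow_le_pow_right₀ ?_ (Nat.le_succ J)) hu
    rw [le_div_iff₀ hδ1]; linarith
  induction j with
  | zero =>
    refine ⟨by simpa [cliqueAlg, cliqueRate] using hE, ?_⟩
    rw [cliqueRate]
    refine le_trans (mul_le_mul_of_nonneg_left ?_ hph2.le) hbase
    have h1 := (hsum 1 le_rfl).trans (Nat.mul_le_mul_left _
      ((sum_rootDeg_one L).le.trans (L.sum_dg_le hN hG)))
    have h2 : ((∑ K ∈ cliques G (0 + 2), rootDeg L K : ℕ) : ℝ) ≤
        ((1 * a * (2 * (n * a)) : ℕ) : ℝ) := by exact_mod_cast h1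
    refine h2.trans (le_of_eq ?_)
    push_cast; ring
  | succ j ih =>
    obtain ⟨h1, h2⟩ := ih (by omega)
    have hjk : ((j + 2 : ℕ) : ℝ) ≤ k := by exact_mod_cast (by omega : j + 2 ≤ k)
    have hjk2 : ((j + 2 : ℕ) : ℝ) ^ 2 * a ≤ (k : ℝ) ^ 2 * a := by gcongr
    have hq : 0 ≤ (1 / (1 - δ)) ^ J := by positivity
    have hr := cliqueRate_nonneg hτ0 J hph2.le hq j
    have hrl := cliqueRate_nonneg hτ0 J
      (le_trans (by positivity) hpl2) (by positivity : 0 ≤ (1 - δ) ^ (3 * J + 3)) j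
    constructor
    · have h3 := hE.step h1 (a := a) (k := k) (δ := δ) (τ := τ) (H := H) (Z := Z) (D := D)
        (J := J) hN hG ha (by omega) (by omega) hM hph2 hpl2 hδ hδ2 hθ hτ hrl hr
        (by push_cast at hjk2 ⊢; linarith) (hJ _ (by omega)) hu hH hD hZ0
        (le_trans (by rw [mul_left_comm]; exact mul_le_mul_of_nonneg_left h2 hH0) hZ)
      rw [Nat.cast_succ, add_one_mul, add_one_mul j, ← add_assoc, ← add_assoc]
      exact h3
    · rw [cliqueRate]
      have h3 : ((∑ K ∈ cliques G (j + 1 + 2), rootDeg L K : ℕ) : ℝ) ≤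
          (((j + 2) * a * ∑ K ∈ cliques G (j + 2), rootDeg L K : ℕ) : ℝ) := by
        exact_mod_cast hsum (j + 2) (by omega)
      rw [Nat.cast_mul, Nat.cast_mul] at h3
      set Y := ((∑ K ∈ cliques G (j + 2), rootDeg L K : ℕ) : ℝ)
      set r := cliqueRate τ J ph2 ((1 / (1 - δ)) ^ J) j
      set q := (1 / (1 - δ)) ^ J
      have ha0 : (0 : ℝ) ≤ a := Nat.cast_nonneg a
      calc ((j + 2 : ℕ) : ℝ) / ((J + 1) * τ) * r * q * _
          ≤ ((j + 2 : ℕ) : ℝ) / ((J + 1) * τ) * r * q * (((j + 2 : ℕ) : ℝ) * a * Y) :=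
            mul_le_mul_of_nonneg_left h3 (by positivity)
        _ = (r * Y) * (q * (((j + 2 : ℕ) : ℝ) ^ 2 * a) / ((J + 1) * τ)) := by ring
        _ ≤ a * 1 := by
            refine mul_le_mul h2 ?_ (by positivity) ha0
            rw [div_le_one (by positivity)]
            exact (mul_le_mul huJ hjk2 (by positivity) (by norm_num)).trans hinv
        _ = a := mul_one _

end QueryAlg

end CliqueSampling

namespace CliqueSampling

namespace QueryAlg

variable {n : ℕ} {G : SimpleGraph (Fin n)} {L : AdjLists G} {Ω X : Type}

/-! ### Reading the whole graph -/

/-- The first `i` neighbors of a vertex. -/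
noncomputable def readNbrs (v : Fin n) : ℕ → QueryAlg n (Finset (Fin n))
  | 0 => output ∅
  | i + 1 => bind (askNbr v i) fun o => bind (readNbrs v i) fun s => output (s ∪ o.toFinset)

/-- The neighborhoods of the vertices in a list. -/
noncomputable def readList : List (Fin n) → QueryAlg n (Fin n → Finset (Fin n))
  | [] => output fun _ => ∅
  | v :: l => bind (bind (askDeg v) (readNbrs v)) fun s => bind (readList l) fun f =>
      output (Function.update f v s)

/-- The whole graph. -/
noncomputable def readGraph (n : ℕ) : QueryAlg n (SimpleGraph (Fin n)) :=
  bind (readList (List.finRange n)) fun f => output (SimpleGraph.fromRel fun u v => v ∈ f u)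

theorem det_readNbrs (L : AdjLists G) (v : Fin n) (i : ℕ) :
    Det L (readNbrs v i) ((L.list v).take i).toFinset i := by
  induction i with
  | zero => exact Det.output L _ _
  | succ i ih =>
    refine Det.mono (a := 1 + (i + 0)) ((det_askNbr L v i).bind (ih.bind ?_)) (by omega)
    convert Det.output L _ 0 using 1
    ext w
    rw [List.take_add_one]
    simp

theorem det_readList (L : AdjLists G) (l : List (Fin n)) :
    Det L (readList l) (fun v => if v ∈ l then (L.list v).toFinset else ∅)
      (l.map fun v => 1 + L.dg v).sum := by
  induction l with
  | nil => exact Det.output L _ _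
  | cons v l ih =>
    have h1 := (det_askDeg L v).bind (det_readNbrs L v (L.dg v))
    refine Det.mono (a := 1 + L.dg v + ((l.map fun v => 1 + L.dg v).sum + 0))
      (h1.bind (ih.bind ?_)) (by simp)
    convert Det.output L _ 0 using 1
    ext w x
    by_cases h : w = v
    · subst h; simp [AdjLists.dg]
    · simp [h]

theorem det_readGraph (L : AdjLists G) : Det L (readGraph n) G (n + ∑ v, L.dg v) := by
  have h1 : ((List.finRange n).map fun v => 1 + L.dg v).sum = n + ∑ v, L.dg v := by
    rw [← List.ofFn_eq_map, List.sum_ofFn, Finset.sum_add_distrib]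
    simp
  rw [← h1]
  refine (det_readList L (List.finRange n)).bind (b := 0) ?_
  convert Det.output L _ 0 using 1
  ext u v
  simp only [SimpleGraph.fromRel_adj, List.mem_finRange, if_true, List.mem_toFinset, L.mem_iff]
  exact ⟨fun h => ⟨h.ne, Or.inl h⟩, fun h => h.2.elim id fun h => h.symm⟩

/-- Read the whole graph and choose a clique of size `k` uniformly. -/
noncomputable def exhaustive (n k : ℕ) : QueryAlg n (Option (Finset (Fin n))) :=
  bind (readGraph n) fun H => pick (cliques H k)

theorem pr_exhaustive (L : AdjLists G) (k : ℕ) (C : Finset (Fin n)) :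
    pr L (exhaustive n k) (some C) =
      if C ∈ cliques G k then 1 / ((cliques G k).card : ℝ) else 0 := by
  rw [exhaustive, (det_readGraph L).pr_bind, pr_pick]

theorem maxLe_exhaustive (L : AdjLists G) (k : ℕ) :
    MaxLe L (exhaustive n k) (n + ∑ v, L.dg v) :=
  (det_readGraph L).maxLe_bind (b := 0) (MaxLe.pick L _ 0)

/-! ### Repetition with a budget -/

/-- Run `A` up to `T` times, until it succeeds; give up as soon as more than `B` queries have been
made by failed runs, where `u` is the number of queries made before. -/
noncomputable def loop (A : QueryAlg n (Option X)) (B : ℕ) : ℕ → ℕ → QueryAlg n (Option X)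
  | 0, _ => output none
  | T + 1, u => bindC A fun o q => o.elim
      (if B < u + q then output none else loop A B T (u + q)) fun x => output (some x)

theorem outputDist_apply (A : QueryAlg n Ω) (L : AdjLists G) (x : Ω) :
    A.outputDist L x = ∑' q, A.run L (x, q) := by
  classical
  rw [outputDist, PMF.map_apply, ENNReal.tsum_prod', tsum_eq_single x]
  · simp
  · intro y hy; simp [hy.symm]

theorem outputDist_loop_succ [Fintype X] (A : QueryAlg n (Option X)) (B T u : ℕ) (L : AdjLists G)
    (y : Option X) :
    (loop A B (T + 1) u).outputDist L y = (∑' q, A.run L (none, q) *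
      (if B < u + q then output none else loop A B T (u + q)).outputDist L y) +
      ∑ x, A.outputDist L (some x) * (output (some x) : QueryAlg n (Option X)).outputDist L y := by
  rw [loop, outputDist_bindC, PMF.bind_apply, ENNReal.tsum_prod', tsum_fintype,
    Fintype.sum_option]
  simp_rw [outputDist_apply A, ← ENNReal.tsum_mul_right]
  rfl

/-- Repetition multiplies the probabilities of all outputs by the same factor. -/
theorem exists_loop_factor [Fintype X] (A : QueryAlg n (Option X)) (B : ℕ) (L : AdjLists G)
    (T u : ℕ) : ∃ S : ℝ≥0∞, ∀ x, (loop A B T u).outputDist L (some x) =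
      A.outputDist L (some x) * S := by
  classical
  induction T generalizing u with
  | zero => exact ⟨0, fun x => by simp [loop]⟩
  | succ T ih =>
    choose S hS using ih
    refine ⟨(∑' q, A.run L (none, q) * if B < u + q then 0 else S (u + q)) + 1, fun x => ?_⟩
    rw [outputDist_loop_succ, mul_add, mul_one, ← ENNReal.tsum_mul_left]
    congr 1
    · refine tsum_congr fun q => ?_
      split_ifs
      · simp
      · rw [hS]; ring
    · simp

theorem outputDist_loop_none_le [Fintype X] {A : QueryAlg n (Option X)} {B : ℕ} (hB : 0 < B)
    {L : AdjLists G} {c : ℝ≥0∞} (hc : A.expectedQueries L ≤ c) (T u : ℕ) :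
    (loop A B T u).outputDist L none ≤
      A.outputDist L none ^ T + (u + T * c) / B := by
  classical
  have hB0 : (B : ℝ≥0∞) ≠ 0 := by exact_mod_cast hB.ne'
  have hBt : (B : ℝ≥0∞) ≠ ⊤ := ENNReal.natCast_ne_top B
  induction T generalizing u with
  | zero => simp [loop]
  | succ T ih =>
    rw [outputDist_loop_succ]
    set φ := A.outputDist L none with hφ
    have hφ1 : φ ≤ 1 := PMF.coe_le_one _ _
    have h1 : ∀ q, (if B < u + q then output none else loop A B T (u + q)).outputDist L none ≤
        (φ ^ T + (u + T * c) / B) + q / B := by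
      intro q
      have e : ((u + q : ℕ) + T * c) / (B : ℝ≥0∞) = (u + T * c) / B + q / B := by
        rw [← ENNReal.add_div]; push_cast; congr 1; ring
      split_ifs with h
      · refine (PMF.coe_le_one _ _).trans ?_
        rw [add_assoc, ← e]
        refine le_trans ?_ le_add_self
        rw [ENNReal.le_div_iff_mul_le (Or.inl hB0) (Or.inl hBt), one_mul]
        exact le_trans (by exact_mod_cast h.le) le_self_add
      · refine (ih _).trans ?_
        rw [e, add_assoc]
    have h2 : ∑' q : ℕ, A.run L (none, q) * (q : ℝ≥0∞) ≤ c := by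
      refine le_trans ?_ hc
      rw [expectedQueries, ENNReal.tsum_prod']
      exact ENNReal.le_tsum (f := fun o : Option X => ∑' q : ℕ, A.run L (o, q) * (q : ℝ≥0∞)) none
    have h3 : ∑ x, A.outputDist L (some x) *
        (output (some x) : QueryAlg n (Option X)).outputDist L none = 0 := by
      simp
    rw [h3, add_zero]
    calc _ ≤ ∑' q : ℕ, (A.run L (none, q) * (φ ^ T + (u + T * c) / B) +
          (A.run L (none, q) * q) / B) := by
          refine ENNReal.tsum_le_tsum fun q => ?_
          rw [mul_div_assoc, ← mul_add]
          exact mul_le_mul_right (h1 q) _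
      _ = φ * (φ ^ T + (u + T * c) / B) + (∑' q : ℕ, A.run L (none, q) * q) / B := by
          rw [ENNReal.tsum_add, ENNReal.tsum_mul_right, ← outputDist_apply]
          simp_rw [div_eq_mul_inv]
          rw [ENNReal.tsum_mul_right]
      _ ≤ φ ^ (T + 1) + (u + T * c) / B + c / B := by
          rw [mul_add, pow_succ']
          refine add_le_add (add_le_add le_rfl ?_) (ENNReal.div_le_div_right h2 _)
          exact mul_le_of_le_one_left' hφ1
      _ = φ ^ (T + 1) + (u + (T + 1 : ℕ) * c) / B := by
          rw [add_assoc, ← ENNReal.add_div]; push_cast; congr 2; ring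

theorem expectedQueries_loop_le {A : QueryAlg n (Option X)} {L : AdjLists G} {c : ℝ≥0∞}
    (hc : A.expectedQueries L ≤ c) (B T u : ℕ) : (loop A B T u).expectedQueries L ≤ T * c := by
  induction T generalizing u with
  | zero => simp [loop, expectedQueries_output]
  | succ T ih =>
    rw [loop, expectedQueries_bindC]
    calc _ ≤ c + ∑' p, A.run L p * (T * c) := by
          refine add_le_add hc (ENNReal.tsum_le_tsum fun p => mul_le_mul_right ?_ _)
          rcases p with ⟨_ | x, q⟩
          · simp only [Option.elim_none]
            split_ifs
            · simp [expectedQueries_output]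
            · exact ih _
          · simp [expectedQueries_output]
      _ = (T + 1 : ℕ) * c := by
          rw [ENNReal.tsum_mul_right, PMF.tsum_coe]; push_cast; ring

theorem maxLe_loop {A : QueryAlg n (Option X)} {L : AdjLists G} {m : ℕ} (hm : MaxLe L A m)
    (B T : ℕ) {u : ℕ} (hu : u ≤ B) : MaxLe L (loop A B T u) (B - u + m) := by
  induction T generalizing u with
  | zero => exact MaxLe.output L _ _
  | succ T ih =>
    refine MaxLe.bindC fun p hp => ?_
    have h1 := hm p hp
    rcases p with ⟨_ | x, q⟩
    · simp only [Option.elim_none]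
      split_ifs with h
      · exact ⟨0, by simp at h1 ⊢; omega, MaxLe.output L _ _⟩
      · exact ⟨B - (u + q) + m, by simp at h1 ⊢; omega, ih (by omega)⟩
    · exact ⟨0, by simp at h1 ⊢; omega, MaxLe.output L _ _⟩

end QueryAlg

end CliqueSampling

namespace CliqueSampling

namespace QueryAlg

variable {n : ℕ} {G : SimpleGraph (Fin n)} {L : AdjLists G}

/-- When an almost uniform sampler is repeated, the probability of failure drops below `ε / 2`, while
the distribution conditioned on success stays as uniform as that of the sampler. -/
theorem exists_failure_bound {A : QueryAlg n (Option (Finset (Fin n)))} {k m T B : ℕ}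
    {p q c ε : ℝ} (h : Sampler L A k p q c m) (hp : 0 < p) (hε : 0 < ε) (hε1 : ε < 1)
    (hpq : (1 - ε / 16) * q ≤ p) (hT : 8 / ε ≤ T * (((cliques G k).card : ℝ) * p))
    (hB0 : 0 < B) (hB : 4 * (T * c) / ε ≤ B) :
    (∀ C ∉ cliques G k, pr L (loop A B T 0) (some C) = 0) ∧
    pr L (loop A B T 0) none ≤ ε / 2 ∧
    ∀ C ∈ cliques G k,
      (1 - ε / 16) * (1 - pr L (loop A B T 0) none) ≤
        (cliques G k).card * pr L (loop A B T 0) (some C) ∧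
      (1 - ε / 16) * ((cliques G k).card * pr L (loop A B T 0) (some C)) ≤
        1 - pr L (loop A B T 0) none := by
  classical
  obtain ⟨S, hS⟩ := exists_loop_factor A B L T 0
  set R := loop A B T 0 with hR
  set F := pr L R none with hF
  set Nk : ℝ := ((cliques G k).card : ℝ) with hNk
  have hNk0 : 0 ≤ Nk := Nat.cast_nonneg _
  set s := S.toReal with hs
  have hs0 : 0 ≤ s := ENNReal.toReal_nonneg
  have hpr : ∀ C, pr L R (some C) = pr L A (some C) * s := fun C => by
    rw [pr, hS, ENNReal.toReal_mul]; rfl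
  have hsumeq : ∀ Q : QueryAlg n (Option (Finset (Fin n))),
      (∀ C ∉ cliques G k, pr L Q (some C) = 0) →
      ∑ C ∈ cliques G k, pr L Q (some C) = 1 - pr L Q none := fun Q hQ => by
    rw [← sum_pr_some, Finset.sum_subset (Finset.subset_univ _)]
    exact fun C _ hC => hQ C hC
  have hR0 : ∀ C ∉ cliques G k, pr L R (some C) = 0 := fun C hC => by
    rw [hpr, h.pr_zero C hC, zero_mul]
  have hRsum := hsumeq R hR0
  have hlow : Nk * (p * s) ≤ 1 - F := by
    rw [← hRsum, hNk, ← nsmul_eq_mul]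
    refine Finset.card_nsmul_le_sum _ _ _ fun C hC => ?_
    rw [hpr]
    exact mul_le_mul_of_nonneg_right (h.le_pr C hC) hs0
  have hupp : 1 - F ≤ Nk * (q * s) := by
    rw [← hRsum, hNk, ← nsmul_eq_mul]
    refine Finset.sum_le_card_nsmul _ _ _ fun C hC => ?_
    rw [hpr]
    exact mul_le_mul_of_nonneg_right (h.pr_le C hC) hs0
  have hη : 0 ≤ 1 - ε / 16 := by linarith
  refine ⟨hR0, ?_, fun C hC => ⟨?_, ?_⟩⟩
  · -- failure of all attempts, or an exhausted budget
    set φ := pr L A none with hφ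
    have hφ0 : 0 ≤ φ := pr_nonneg _ _ _
    have hφ1 : φ ≤ 1 - Nk * p := by
      have h1 := hsumeq A h.pr_zero
      have h2 : Nk * p ≤ ∑ C ∈ cliques G k, pr L A (some C) := by
        rw [hNk, ← nsmul_eq_mul]
        exact Finset.card_nsmul_le_sum _ _ _ h.le_pr
      linarith
    have hx0 : 0 ≤ Nk * p := by positivity
    have hpow : φ ^ T ≤ ε / 8 := by
      have h1 : φ ^ T * (1 + T * (Nk * p)) ≤ 1 := by
        calc φ ^ T * (1 + T * (Nk * p)) ≤ φ ^ T * (1 + Nk * p) ^ T := by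
              refine mul_le_mul_of_nonneg_left ?_ (pow_nonneg hφ0 _)
              exact one_add_mul_le_pow (by linarith) T
          _ = (φ * (1 + Nk * p)) ^ T := (mul_pow _ _ _).symm
          _ ≤ 1 := pow_le_one₀ (by positivity) (by nlinarith)
      have h2 : φ ^ T * (8 / ε) ≤ 1 :=
        le_trans (mul_le_mul_of_nonneg_left (by linarith) (pow_nonneg hφ0 _)) h1
      rw [mul_div_assoc', div_le_one hε] at h2
      linarith
    have h1 : R.outputDist L none ≤ A.outputDist L none ^ T + (0 + T * ENNReal.ofReal c) / B := by
      have := outputDist_loop_none_le hB0 h.costLe T 0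
      rwa [Nat.cast_zero] at this
    have hBr : (0 : ℝ) < B := by exact_mod_cast hB0
    have hc := h.cost_nonneg
    have h2 : (0 + T * ENNReal.ofReal c) / (B : ℝ≥0∞) = ENNReal.ofReal (T * c / B) := by
      rw [zero_add, ENNReal.ofReal_div_of_pos hBr, ENNReal.ofReal_mul (Nat.cast_nonneg _),
        ENNReal.ofReal_natCast, ENNReal.ofReal_natCast]
    rw [h2, ← ofReal_pr, ← ofReal_pr, ← ENNReal.ofReal_pow (pr_nonneg _ _ _),
      ← ENNReal.ofReal_add (pow_nonneg (pr_nonneg _ _ _) _) (by positivity),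
      ENNReal.ofReal_le_ofReal_iff (by have := pr_nonneg L A none; positivity)] at h1
    have h3 : T * c / B ≤ ε / 4 := by
      rw [div_le_iff₀ hε] at hB
      rw [div_le_iff₀ hBr]
      linarith
    rw [← hF, ← hφ] at h1
    linarith
  · rw [hpr]
    calc (1 - ε / 16) * (1 - F) ≤ (1 - ε / 16) * (Nk * (q * s)) :=
          mul_le_mul_of_nonneg_left hupp hη
      _ = Nk * s * ((1 - ε / 16) * q) := by ring
      _ ≤ Nk * s * pr L A (some C) :=
          mul_le_mul_of_nonneg_left (hpq.trans (h.le_pr C hC)) (by positivity)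
      _ = _ := by ring
  · rw [hpr]
    calc (1 - ε / 16) * (Nk * (pr L A (some C) * s)) =
          Nk * s * ((1 - ε / 16) * pr L A (some C)) := by ring
      _ ≤ Nk * s * p := by
          refine mul_le_mul_of_nonneg_left (le_trans ?_ hpq) (by positivity)
          exact mul_le_mul_of_nonneg_left (h.pr_le C hC) hη
      _ = Nk * (p * s) := by ring
      _ ≤ 1 - F := hlow

/-! ### Choice of the parameters -/

/-- The upper bound for the probability of each edge, as returned by `edgeAlg` with degree
threshold `12 * a * (J + 1) / δ`. -/
noncomputable def edgeProb (n a J : ℕ) (δ : ℝ) : ℝ := δ / (6 * (J + 1) ^ 2 * a * n)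

/-- A single attempt to find a clique of size `k`, by walks of length at most `J` and with relative
error `δ` in each of their steps. The threshold `θ = 2 * k ^ 2 * τ / δ ^ 2` makes `δ * (δ * θ)` at
least `2 * k ^ 2 * a` for `a ≤ τ`, which lets the sets of unsettled cliques halve. -/
noncomputable def attempt (n a k J : ℕ) (δ τ : ℝ) : QueryAlg n (Option (Finset (Fin n))) :=
  cliqueAlg (Real.sqrt (n * a)) (edgeProb n a J δ) (2 * k ^ 2 * τ / δ ^ 2)
    (8 * k ^ 2 * τ / δ ^ 4) J (edgeAlg n (12 * a * (J + 1) / δ) J) (k - 2)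

/-- A lower bound for the probability of each clique in an attempt. -/
noncomputable def attemptProb (n a k J : ℕ) (δ τ : ℝ) : ℝ :=
  edgeProb n a J δ / 2 * (1 / ((J + 1) * (8 * k ^ 2 * τ / δ ^ 4)) ^ (k - 2))

/-- A bound for the expected number of queries of an attempt. -/
noncomputable def attemptCost (k J : ℕ) (δ : ℝ) : ℝ :=
  2 * (J + 1) + k * ((J + 1) * (2 * k + 1 + (2 * (J + 1) + 2 * k + 2) *
    (1 + 2 * (12 * (J + 1) ^ 2 / δ))))

/-- A bound for the maximum number of queries of an attempt. -/
noncomputable def attemptMax (n a k J : ℕ) (δ τ : ℝ) : ℕ :=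
  2 * (J + 1) + k * ((J + 1) * (2 * k + 1 + (2 * ⌊12 * (J + 1) ^ 2 / δ * Real.sqrt (n * a) /
    (2 * k ^ 2 * τ / δ ^ 2)⌋₊ + 1) * (2 * (J + 1) + 2 * k + 2)))

theorem sampler_edgeAlg {a J : ℕ} {δ : ℝ} {N : Fin n → Finset (Fin n)}
    (hN : ∀ v, (N v).card ≤ a) (hG : ∀ u v, G.Adj u v → v ∈ N u ∨ u ∈ N v) (ha : 0 < a)
    (hδ : 0 < δ) (hδ1 : δ ≤ 1) (hJ : (cliques G 1).card < 2 ^ J) :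
    Sampler L (edgeAlg n (12 * a * (J + 1) / δ) J) 2 ((1 - δ) * edgeProb n a J δ)
      (edgeProb n a J δ) (2 * (J + 1)) (2 * (J + 1)) := by
  have ha' : (0 : ℝ) < a := by exact_mod_cast ha
  have hθ : 0 < 12 * a * (J + 1) / δ := by positivity
  have e : 2 / ((J + 1) * (12 * a * (J + 1) / δ)) * (1 / n) = edgeProb n a J δ := by
    rw [edgeProb]
    rcases eq_or_ne (n : ℝ) 0 with h | h
    · simp [h]
    · field_simp; norm_num
  have hmax := maxLe_edgeAlg L hθ J
  refine ⟨fun K hK => pr_edgeAlg_eq_zero L hθ J hK, fun K hK => ?_,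
    fun K hK => (pr_edgeAlg_le L hθ J hK).trans_eq e, by positivity,
    by have := hmax.costLe; push_cast at this; exact this, hmax⟩
  -- each of the `J + 1` steps of the walk loses three factors `1 - δ / (3 * (J + 1))`
  have h3 : (0 : ℝ) < 3 * (J + 1) := by positivity
  have hδ3 : δ / (3 * (J + 1)) < 1 := by
    rw [div_lt_one h3]
    linarith [Nat.cast_nonneg (α := ℝ) J]
  refine le_trans ?_ (le_pr_edgeAlg L (δ := δ / (3 * (J + 1))) hN hG ha (by positivity) hδ3
    (le_of_eq (by field_simp; ring)) hJ hK)
  rw [e, mul_comm]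
  refine mul_le_mul_of_nonneg_left ?_ (by rw [edgeProb]; positivity)
  have h4 := one_add_mul_le_pow (a := -(δ / (3 * (J + 1)))) (by linarith) (3 * J + 3)
  refine le_trans (le_of_eq ?_) (h4.trans_eq (by rw [sub_eq_add_neg]))
  push_cast
  field_simp
  ring

theorem exists_sampler_attempt {a k J : ℕ} {δ τ : ℝ} {N : Fin n → Finset (Fin n)}
    (hN : ∀ v, (N v).card ≤ a) (hG : ∀ u v, G.Adj u v → v ∈ N u ∨ u ∈ N v) (ha : 0 < a)
    (hn : 0 < n) (hk : 2 ≤ k) (haτ : (a : ℝ) ≤ τ) (hδ : 0 < δ) (hδ1 : 4 * k * (J + 1) * δ ≤ 1 / 2)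
    (hJ : n ^ k < 2 ^ J) :
    ∃ p q, Sampler L (attempt n a k J δ τ) k p q (attemptCost k J δ) (attemptMax n a k J δ τ) ∧
      (1 - 4 * k * (J + 1) * δ) * q ≤ p ∧ attemptProb n a k J δ τ ≤ p := by
  obtain ⟨j, hj⟩ : ∃ j, k = j + 2 := ⟨k - 2, by omega⟩
  have ha' : (1 : ℝ) ≤ a := by exact_mod_cast ha
  have hn' : (0 : ℝ) < n := by exact_mod_cast hn
  have hk' : (2 : ℝ) ≤ k := by exact_mod_cast hk
  have hJ0 : (0 : ℝ) ≤ J := Nat.cast_nonneg J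
  have hτ0 : 0 < τ := by linarith
  have hJδ : (J + 1) * δ ≤ 1 / 16 := by
    have h1 : 0 ≤ (J + 1) * δ := by positivity
    have : 2 * ((J + 1) * δ) ≤ k * ((J + 1) * δ) := mul_le_mul_of_nonneg_right hk' h1
    linarith
  have hδ2 : δ ≤ 1 / 16 := (le_mul_of_one_le_left hδ.le (by linarith)).trans hJδ
  have hJ1 : (1 : ℝ) ≤ (J + 1) ^ 2 := one_le_pow₀ (by linarith)
  have hcard : ∀ i ≤ k, (cliques G i).card < 2 ^ J := fun i hi =>
    (card_cliques_le hi hn).trans_lt hJ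
  set M := Real.sqrt (n * a) with hM
  have hMM : M * M = n * a := Real.mul_self_sqrt (by positivity)
  have hM0 : 0 < M := Real.sqrt_pos.2 (by positivity)
  set H : ℝ := 12 * (J + 1) ^ 2 / δ with hH
  have hH1 : 1 ≤ H := by
    rw [hH, le_div_iff₀ hδ]
    linarith
  set P := edgeProb n a J δ with hP
  have hP0 : 0 < P := by rw [hP, edgeProb]; positivity
  have hHM : 2 / (P * M) = H * M := by
    rw [div_eq_iff (by positivity), hP, edgeProb, hH]
    have : 12 * (J + 1 : ℝ) ^ 2 / δ * M * (δ / (6 * (J + 1) ^ 2 * a * n) * M) =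
      12 * (J + 1 : ℝ) ^ 2 / δ * (δ / (6 * (J + 1) ^ 2 * a * n)) * (M * M) := by ring
    rw [this, hMM]
    field_simp
    norm_num
  have hrH : ∀ d : ℕ, trialRate M P d ≤ H * d := fun d => by
    rw [trialRate]
    split_ifs with hd
    · exact le_mul_of_one_le_left (Nat.cast_nonneg d) hH1
    · rw [hHM]
      exact mul_le_mul_of_nonneg_left (not_le.1 hd).le (by linarith)
  have hrD : ∀ d : ℕ, trialRate M P d ≤ H * M := fun d => by
    rw [trialRate]
    split_ifs with hd
    · exact hd.trans (le_mul_of_one_le_left hM0.le hH1)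
    · rw [hHM]
  set θ := 2 * (k : ℝ) ^ 2 * τ / δ ^ 2 with hθ
  have hδsq : δ ^ 2 ≤ 1 := pow_le_one₀ hδ.le (by linarith)
  have hθk : 2 * ((k : ℝ) ^ 2 * a) ≤ θ := by
    rw [hθ, le_div_iff₀ (by positivity)]
    have h1 : 2 * ((k : ℝ) ^ 2 * a) ≤ 2 * (k : ℝ) ^ 2 * τ := by
      rw [mul_assoc]; gcongr
    exact (mul_le_of_le_one_right (by positivity) hδsq).trans h1
  have hθ0 : 0 < θ := by rw [hθ]; positivity
  have hτ' : 8 * (k : ℝ) ^ 2 * τ / δ ^ 4 = 4 * θ / δ ^ 2 := by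
    rw [hθ]; field_simp; norm_num
  set τ' := 8 * (k : ℝ) ^ 2 * τ / δ ^ 4 with hτ'def
  have hτ'0 : 0 < τ' := by positivity
  have hθτ : θ ≤ τ' := by
    rw [hτ', le_div_iff₀ (by positivity)]
    linarith [mul_le_of_le_one_right hθ0.le hδsq]
  have hbern : ∀ i : ℕ, 1 - i * δ ≤ (1 - δ) ^ i := fun i => by
    have := one_add_mul_le_pow (a := -δ) (by linarith) i
    rw [← sub_eq_add_neg] at this
    linarith
  have hδ1' : 0 < 1 - δ := by linarith
  have hu : (1 / (1 - δ)) ^ (J + 1) ≤ 2 := by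
    have := hbern (J + 1)
    push_cast at this
    rw [div_pow, one_pow, div_le_iff₀ (by positivity)]
    linarith
  have hE := sampler_edgeAlg (L := L) hN hG ha hδ (by linarith) (hcard 1 (by omega))
  have hbase : P * (2 * (n * (a : ℝ) ^ 2)) ≤ a := by
    rw [hP, edgeProb, div_mul_eq_mul_div, div_le_iff₀ (by positivity)]
    have h1 : δ * (2 * (n * (a : ℝ) ^ 2)) ≤ 1 * (2 * (n * (a : ℝ) ^ 2)) := by gcongr; linarith
    have h2 : 0 ≤ n * (a : ℝ) ^ 2 := by positivity
    linarith [mul_le_mul_of_nonneg_right hJ1 h2]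
  have hσ : 2 * ((k : ℝ) ^ 2 * a) ≤ δ * (δ * θ) := by
    have e : δ * (δ * θ) = 2 * ((k : ℝ) ^ 2 * τ) := by rw [hθ]; field_simp
    rw [e]
    gcongr
  have hZ : H * a ≤ H * θ := by
    refine mul_le_mul_of_nonneg_left (le_trans ?_ hθk) (by linarith)
    have h1 : (1 : ℝ) ≤ (k : ℝ) ^ 2 := one_le_pow₀ (by linarith)
    linarith [le_mul_of_one_le_left (by linarith : (0 : ℝ) ≤ a) h1]
  obtain ⟨h, -⟩ := sampler_cliqueAlg (θ := θ) (τ := τ') (Z := H) (H := H) (k := k) (j := j) hE hN hG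
    ha hM0 hP0 le_rfl hδ (by linarith) hθ0 hτ' hσ hcard hu hrH (by linarith) hrD (by linarith) hbase
    (hθk.trans (hθτ.trans (le_mul_of_one_le_left hτ'0.le (by linarith)))) hZ hj.ge
  rw [← hj] at h
  have hj2 : k - 2 = j := by omega
  have hjk : j ≤ k := by omega
  have hjk' : (j : ℝ) ≤ k := by exact_mod_cast hjk
  have hloss : 1 - 4 * k * (J + 1) * δ ≤ (1 - δ) * ((1 - δ) ^ (4 * J + 3)) ^ j := by
    rw [← pow_mul, ← pow_succ']
    refine le_trans ?_ (hbern _)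
    push_cast
    have h1 : ((4 * J + 3) * j + 1 : ℝ) ≤ 4 * k * (J + 1) := by
      rw [hj]
      push_cast
      linarith
    linarith [mul_le_mul_of_nonneg_right h1 hδ.le]
  have hrate := inv_pow_le_cliqueRate hτ'0 J j
  have hrate0 : 0 < cliqueRate τ' J 1 1 j := lt_of_lt_of_le (by positivity) hrate
  rw [attempt, hj2]
  refine ⟨_, _, ⟨h.pr_zero, h.le_pr, h.pr_le, ?_, ?_, ?_⟩, ?_, ?_⟩
  · rw [attemptCost]; positivity
  · refine h.costLe.mono ?_
    rw [attemptCost]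
    push_cast
    gcongr
  · refine h.maxLe.mono ?_
    rw [attemptMax]
    gcongr
  · rw [cliqueRate_eq, cliqueRate_eq τ' J ((1 - δ) * P)]
    have e : (1 - δ) ^ (3 * J + 3) = (1 - δ) ^ (4 * J + 3) * (1 / (1 - δ)) ^ J := by
      have : (1 - δ) ^ (4 * J + 3) = (1 - δ) ^ (3 * J + 3) * (1 - δ) ^ J := by
        rw [← pow_add]; congr 1; omega
      rw [this, mul_assoc, ← mul_pow, mul_one_div_cancel hδ1'.ne', one_pow, mul_one]
    rw [e, mul_pow _ _ j]
    have h1 : 0 ≤ P * ((1 / (1 - δ)) ^ J) ^ j * cliqueRate τ' J 1 1 j := by positivity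
    have h2 := mul_le_mul_of_nonneg_right hloss h1
    linarith
  · rw [cliqueRate_eq, attemptProb, hj2]
    have h1 : P / 2 ≤ (1 - δ) * P * ((1 - δ) ^ (3 * J + 3)) ^ j := by
      have h2 : ((1 - δ) ^ (4 * J + 3)) ^ j ≤ ((1 - δ) ^ (3 * J + 3)) ^ j :=
        pow_le_pow_left₀ (by positivity)
          (pow_le_pow_of_le_one hδ1'.le (by linarith) (by omega)) j
      have h3 : 1 / 2 ≤ (1 - δ) * ((1 - δ) ^ (3 * J + 3)) ^ j := by
        have := mul_le_mul_of_nonneg_left h2 hδ1'.le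
        linarith
      linarith [mul_le_mul_of_nonneg_right h3 hP0.le]
    exact mul_le_mul h1 hrate (by positivity) (le_trans (by positivity) h1)

end QueryAlg

end CliqueSampling

namespace CliqueSampling

namespace QueryAlg

variable {n : ℕ} {G : SimpleGraph (Fin n)} {L : AdjLists G}

/-! ### Estimates for the parameters -/

/-- The range of admissible `τ` is empty unless `k` is at most logarithmic in `n`. -/
theorem six_mul_le_logb {n a k : ℕ} {ε τ : ℝ} (hk : 2 ≤ k) (hε : 0 < ε) (hε1 : ε < 1)
    (ha : 0 < a) (hn : 2 ≤ n)
    (h1 : (a : ℝ) / ε * (4 * (k : ℝ) * Real.logb 2 (n : ℝ)) ^ k ≤ τ)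
    (h2 : τ ≤ Real.sqrt ((n : ℝ) * (a : ℝ))) :
    6 * (k : ℝ) ≤ Real.logb 2 n ∧ (a : ℝ) ≤ τ := by
  have hk' : (2 : ℝ) ≤ k := by exact_mod_cast hk
  have ha' : (1 : ℝ) ≤ a := by exact_mod_cast ha
  have hn' : (2 : ℝ) ≤ n := by exact_mod_cast hn
  have hx : 1 ≤ Real.logb 2 n := by
    rw [Real.le_logb_iff_rpow_le (by norm_num) (by linarith), Real.rpow_one]
    exact hn'
  set y := 4 * (k : ℝ) * Real.logb 2 n with hy
  have hy8 : 8 ≤ y := by nlinarith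
  have haε : (a : ℝ) ≤ a / ε := by
    rw [le_div_iff₀ hε]
    nlinarith
  have hyk : (1 : ℝ) ≤ y ^ k := one_le_pow₀ (by linarith)
  have hay : a * y ^ k ≤ τ := le_trans (by gcongr) h1
  refine ⟨?_, le_trans (le_mul_of_one_le_right (by linarith) hyk) hay⟩
  have h3 : y ^ (2 * k) ≤ n := by
    have h4 := hay.trans h2
    rw [Real.le_sqrt (by positivity) (by positivity)] at h4
    have h5 : a * (a * y ^ (2 * k)) ≤ a * n := by
      calc a * (a * y ^ (2 * k)) = (a * y ^ k) ^ 2 := by ring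
        _ ≤ n * a := h4
        _ = a * n := mul_comm _ _
    have h6 := le_of_mul_le_mul_left h5 (by linarith)
    exact le_trans (le_mul_of_one_le_left (by positivity) ha') h6
  rw [Real.le_logb_iff_rpow_le (by norm_num) (by linarith)]
  have h4 : (2 : ℝ) ^ (6 * (k : ℝ)) = 8 ^ (2 * k) := by
    rw [show (6 * (k : ℝ)) = ((6 * k : ℕ) : ℝ) by push_cast; ring, Real.rpow_natCast,
      show 6 * k = 3 * (2 * k) by ring, pow_mul]
    norm_num
  rw [h4]
  exact le_trans (pow_le_pow_left₀ (by norm_num) hy8 _) h3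

/-- The numbers of queries of an attempt, up to the factor `Q` that stands for the size of
`√(n * a) / τ`, are bounded by powers of `l`. -/
theorem queries_le_pow {l k j H Q : ℝ} (hl : 12 ≤ l) (hk0 : 0 ≤ k) (hk : k ≤ l / 6) (hj0 : 0 ≤ j)
    (hj : j ≤ l ^ 2) (hH0 : 0 ≤ H) (hH : H ≤ l ^ 9) (hQ : 1 ≤ Q) :
    2 * j + k * (j * (2 * k + 1 + (2 * j + 2 * k + 2) * (1 + 2 * (H * Q)))) ≤ l ^ 18 * Q := by
  have hl0 : 0 ≤ l := by linarith
  have hl1 : 1 ≤ l := by linarith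
  have hl9 : 1 ≤ l ^ 9 := one_le_pow₀ hl1
  have h1 : 1 + 2 * (H * Q) ≤ l ^ 10 * Q := by
    have e1 : H * Q ≤ l ^ 9 * Q := by gcongr
    have e2 : 1 ≤ l ^ 9 * Q := one_le_mul_of_one_le_of_one_le hl9 hQ
    have e3 : 3 * (l ^ 9 * Q) ≤ l * (l ^ 9 * Q) :=
      mul_le_mul_of_nonneg_right (by linarith) (by linarith)
    calc _ ≤ 3 * (l ^ 9 * Q) := by linarith
      _ ≤ l * (l ^ 9 * Q) := e3
      _ = _ := by ring
  have h2 : 2 * j + 2 * k + 2 ≤ l ^ 3 := by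
    have e1 : 12 * l ≤ l ^ 2 := by rw [pow_two]; exact mul_le_mul_of_nonneg_right hl hl0
    have e2 : 12 * l ^ 2 ≤ l ^ 3 := by
      rw [pow_succ' l 2]; exact mul_le_mul_of_nonneg_right hl (by positivity)
    linarith
  have h3 : (2 * j + 2 * k + 2) * (1 + 2 * (H * Q)) ≤ l ^ 13 * Q := by
    calc _ ≤ l ^ 3 * (l ^ 10 * Q) := mul_le_mul h2 h1 (by positivity) (by positivity)
      _ = _ := by ring
  have h4 : 2 * k + 1 + (2 * j + 2 * k + 2) * (1 + 2 * (H * Q)) ≤ l ^ 14 * Q := by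
    have e1 : l ≤ l ^ 13 * Q :=
      (le_self_pow₀ hl1 (by norm_num)).trans (le_mul_of_one_le_right (by positivity) hQ)
    have e2 : 2 * (l ^ 13 * Q) ≤ l * (l ^ 13 * Q) :=
      mul_le_mul_of_nonneg_right (by linarith) (by positivity)
    calc _ ≤ 2 * (l ^ 13 * Q) := by linarith
      _ ≤ l * (l ^ 13 * Q) := e2
      _ = _ := by ring
  have h5 : k * (j * (2 * k + 1 + (2 * j + 2 * k + 2) * (1 + 2 * (H * Q)))) ≤ l ^ 17 * Q := by
    calc _ ≤ l * (l ^ 2 * (l ^ 14 * Q)) :=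
          mul_le_mul (by linarith) (mul_le_mul hj h4 (by positivity) (by positivity))
            (by positivity) hl0
      _ = _ := by ring
  have h6 : l ^ 2 ≤ l ^ 17 * Q :=
    (pow_le_pow_right₀ hl1 (by norm_num)).trans (le_mul_of_one_le_right (by positivity) hQ)
  calc _ ≤ 3 * (l ^ 17 * Q) := by linarith
    _ ≤ l * (l ^ 17 * Q) := mul_le_mul_of_nonneg_right (by linarith) (by positivity)
    _ = _ := by ring

section Growth

variable {l δ τ : ℝ} {a k J : ℕ}

theorem walkFactor_le_pow (hl : 12 ≤ l) (hJ : (J : ℝ) + 1 ≤ l ^ 2) (hδ : 0 < δ)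
    (hδl : 1 / δ ≤ l ^ 4) : 12 * ((J : ℝ) + 1) ^ 2 / δ ≤ l ^ 9 := by
  calc 12 * ((J : ℝ) + 1) ^ 2 / δ = 12 * ((J : ℝ) + 1) ^ 2 * (1 / δ) := by ring
    _ ≤ l * (l ^ 2) ^ 2 * l ^ 4 := by gcongr
    _ = l ^ 9 := by ring

theorem attemptCost_le_pow (hl : 12 ≤ l) (hk : (k : ℝ) ≤ l / 6) (hJ : (J : ℝ) + 1 ≤ l ^ 2)
    (hδ : 0 < δ) (hδl : 1 / δ ≤ l ^ 4) : attemptCost k J δ ≤ l ^ 18 := by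
  have := queries_le_pow (Q := 1) hl (Nat.cast_nonneg k) hk (by positivity) hJ (by positivity)
    (walkFactor_le_pow hl hJ hδ hδl) le_rfl
  simpa only [attemptCost, mul_one] using this

theorem attemptMax_le_pow (hl : 12 ≤ l) (hk1 : 1 ≤ k) (hk : (k : ℝ) ≤ l / 6)
    (hJ : (J : ℝ) + 1 ≤ l ^ 2) (hδ : 0 < δ) (hδ1 : δ ≤ 1) (hδl : 1 / δ ≤ l ^ 4) (hτ : 0 < τ)
    (hτn : τ ≤ Real.sqrt (n * a)) :
    (attemptMax n a k J δ τ : ℝ) ≤ l ^ 18 * (Real.sqrt (n * a) / τ) := by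
  have hQ : 1 ≤ Real.sqrt (n * a) / τ := by rwa [le_div_iff₀ hτ, one_mul]
  have hH := walkFactor_le_pow hl hJ hδ hδl
  refine le_trans ?_ (queries_le_pow (k := k) (j := J + 1) hl (Nat.cast_nonneg k) hk
    (by positivity) hJ (by positivity) hH hQ)
  set H := 12 * ((J : ℝ) + 1) ^ 2 / δ with hHdef
  have hk1' : (1 : ℝ) ≤ k := by exact_mod_cast hk1
  have hθ : τ ≤ 2 * (k : ℝ) ^ 2 * τ / δ ^ 2 := by
    rw [le_div_iff₀ (by positivity)]
    have e1 : τ * δ ^ 2 ≤ τ := mul_le_of_le_one_right hτ.le (pow_le_one₀ hδ.le hδ1)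
    have e2 : τ ≤ (k : ℝ) ^ 2 * τ := le_mul_of_one_le_left hτ.le (one_le_pow₀ hk1')
    linarith
  have hfl : (⌊H * Real.sqrt (n * a) / (2 * (k : ℝ) ^ 2 * τ / δ ^ 2)⌋₊ : ℝ) ≤
      H * (Real.sqrt (n * a) / τ) := by
    refine (Nat.floor_le (by positivity)).trans ?_
    rw [mul_div_assoc]
    gcongr
  rw [attemptMax]
  push_cast
  rw [mul_comm (2 * ((J : ℝ) + 1) + 2 * k + 2), add_comm 1 (2 * (H * _))]
  gcongr

theorem inv_attemptProb_le (hl : 12 ≤ l) (hk2 : 2 ≤ k) (hk : (k : ℝ) ≤ l / 6)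
    (hJ : (J : ℝ) + 1 ≤ l ^ 2) (hδ : 0 < δ) (hδl : 1 / δ ≤ l ^ 4) (hτ : 0 < τ) :
    1 / attemptProb n a k J δ τ ≤ l ^ (21 * k) * (n * a * τ ^ (k - 2)) := by
  have hl0 : 0 < l := by linarith
  have hH := walkFactor_le_pow hl hJ hδ hδl
  have e : 1 / attemptProb n a k J δ τ =
      (12 * ((J : ℝ) + 1) ^ 2 / δ) * (n * a) *
        ((((J : ℝ) + 1) * (8 * k ^ 2 / δ ^ 4)) ^ (k - 2) * τ ^ (k - 2)) := by
    rw [attemptProb, edgeProb, ← mul_pow]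
    have e1 : ((J : ℝ) + 1) * (8 * k ^ 2 / δ ^ 4) * τ = (J + 1) * (8 * k ^ 2 * τ / δ ^ 4) := by
      ring
    rw [e1]
    rw [one_div, mul_inv, inv_div, inv_div, div_div_eq_mul_div]
    ring
  have h1 : ((J : ℝ) + 1) * (8 * k ^ 2 / δ ^ 4) ≤ l ^ 21 := by
    calc ((J : ℝ) + 1) * (8 * k ^ 2 / δ ^ 4) = 8 * ((J : ℝ) + 1) * (k ^ 2 * (1 / δ) ^ 4) := by
          ring
      _ ≤ l * l ^ 2 * (l ^ 2 * (l ^ 4) ^ 4) := by gcongr <;> linarith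
      _ = l ^ 21 := by ring
  rw [e]
  calc _ ≤ l ^ 9 * (n * a) * ((l ^ 21) ^ (k - 2) * τ ^ (k - 2)) := by gcongr
    _ = l ^ (9 + 21 * (k - 2)) * (n * a * τ ^ (k - 2)) := by rw [pow_add, pow_mul]; ring
    _ ≤ _ := by
        gcongr
        · linarith
        · omega

end Growth

theorem walkLength_le {k : ℕ} {x : ℝ} (hk : 2 ≤ k) (hkx : 6 * (k : ℝ) ≤ x)
    (hx : (Nat.log 2 n : ℝ) ≤ x) : ((k * (Nat.log 2 n + 1) : ℕ) : ℝ) + 1 ≤ x ^ 2 := by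
  have hk' : (2 : ℝ) ≤ k := by exact_mod_cast hk
  push_cast
  have h1 : (k : ℝ) * (Nat.log 2 n + 1) ≤ x / 6 * (x + 1) := by gcongr <;> linarith
  nlinarith

theorem inv_stepError_le {k J : ℕ} {x ε : ℝ} (hk : 2 ≤ k) (hkx : 6 * (k : ℝ) ≤ x)
    (hε : 0 < ε) (hε1 : ε < 1) (hJ : (J : ℝ) + 1 ≤ x ^ 2) :
    1 / (ε / (64 * k * (J + 1))) ≤ (x / ε) ^ 4 := by
  have hk' : (2 : ℝ) ≤ k := by exact_mod_cast hk
  have hx : 12 ≤ x := by linarith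
  rw [one_div_div, div_pow]
  have h1 : 64 * (k : ℝ) * (J + 1) ≤ x ^ 4 := by
    calc 64 * (k : ℝ) * (J + 1) ≤ (x * x) * x ^ 2 := by
          refine mul_le_mul (by nlinarith) hJ (by positivity) (by positivity)
      _ = x ^ 4 := by ring
  have h2 : ε ^ 4 ≤ ε := pow_le_of_le_one hε.le hε1.le (by norm_num)
  gcongr

end QueryAlg

end CliqueSampling

namespace CliqueSampling

namespace QueryAlg

variable {n : ℕ} {G : SimpleGraph (Fin n)} {L : AdjLists G}

/-! ### The algorithm -/

/-- The length of the walks: `2 ^ J` exceeds the number of cliques of each size up to `k`. -/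
def walkLength (n k : ℕ) : ℕ := k * (Nat.log 2 n + 1)

/-- The relative error allowed in each step of a walk. -/
noncomputable def stepError (n k : ℕ) (ε : ℝ) : ℝ := ε / (64 * k * (walkLength n k + 1))

/-- The number of attempts; all of them fail with probability at most `ε / 8`. -/
noncomputable def numAttempts (n a k : ℕ) (ε nbar τ : ℝ) : ℕ :=
  ⌈16 / (ε * (nbar * attemptProb n a k (walkLength n k) (stepError n k ε) τ))⌉₊

/-- The number of queries after which the algorithm gives up. By Markov's inequality, it is exceeded
with probability at most `ε / 4`. -/
noncomputable def budget (n a k : ℕ) (ε nbar τ : ℝ) : ℕ :=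
  ⌈4 * (numAttempts n a k ε nbar τ * attemptCost k (walkLength n k) (stepError n k ε)) / ε⌉₊ + 1

/-- Sample a clique of size `k` almost uniformly: if there are so few cliques that reading the whole
graph is affordable, choose one after doing so; otherwise repeat the attempts. -/
noncomputable def sampleClique (n a k : ℕ) (ε nbar τ : ℝ) : QueryAlg n (Option (Finset (Fin n))) :=
  if nbar ≤ τ ^ (k - 2) then exhaustive n k
  else loop (attempt n a k (walkLength n k) (stepError n k ε) τ) (budget n a k ε nbar τ)
    (numAttempts n a k ε nbar τ) 0

/-- The outputs of `A` are cliques of size `k`, almost uniformly distributed both before and after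
conditioning on success. -/
structure NearlyUniform (L : AdjLists G) (A : QueryAlg n (Option (Finset (Fin n)))) (k : ℕ)
    (ε : ℝ) : Prop where
  mem : ∀ C, some C ∈ (A.outputDist L).support → C ∈ G.cliqueSet k
  close : PointwiseCloseToUniform ε (G.cliqueSet k) (returnProb A L)
  closeCond : PointwiseCloseToUniform ε (G.cliqueSet k) (condReturnProb A L)

theorem nearlyUniform_of_bounds {A : QueryAlg n (Option (Finset (Fin n)))} {k : ℕ} {ε : ℝ}
    (hε : 0 < ε) (hε1 : ε < 1) (h0 : ∀ C ∉ cliques G k, pr L A (some C) = 0)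
    (hF : pr L A none ≤ ε / 2)
    (h : ∀ C ∈ cliques G k,
      (1 - ε / 16) * (1 - pr L A none) ≤ (cliques G k).card * pr L A (some C) ∧
      (1 - ε / 16) * ((cliques G k).card * pr L A (some C)) ≤ 1 - pr L A none) :
    NearlyUniform L A k ε := by
  have hF0 := pr_nonneg L A none
  have hF1 : 0 < 1 - pr L A none := by linarith
  have hcard : (G.cliqueSet k).ncard = (cliques G k).card := by
    rw [← coe_cliques, Set.ncard_coe_finset]
  have key : ∀ C ∈ G.cliqueSet k, 0 < ((cliques G k).card : ℝ) ∧
      (1 - ε) ≤ pr L A (some C) * (cliques G k).card ∧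
      pr L A (some C) * (cliques G k).card ≤ 1 + ε ∧
      (1 - ε) * (1 - pr L A none) ≤ pr L A (some C) * (cliques G k).card ∧
      pr L A (some C) * (cliques G k).card ≤ (1 + ε) * (1 - pr L A none) := by
    intro C hC
    rw [← coe_cliques, Finset.mem_coe] at hC
    obtain ⟨h1, h2⟩ := h C hC
    have hx0 : 0 ≤ (cliques G k).card * pr L A (some C) :=
      mul_nonneg (Nat.cast_nonneg _) (pr_nonneg _ _ _)
    rw [mul_comm (pr L A (some C))]
    set x := (cliques G k).card * pr L A (some C)
    set F := pr L A none
    -- `(1 - ε / 16)⁻¹ ≤ 1 + ε`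
    have h3 : 1 ≤ (1 + ε) * (1 - ε / 16) := by nlinarith
    have h4 : x ≤ (1 + ε) * (1 - F) := by
      calc x ≤ (1 + ε) * (1 - ε / 16) * x := le_mul_of_one_le_left hx0 h3
        _ = (1 + ε) * ((1 - ε / 16) * x) := by ring
        _ ≤ _ := mul_le_mul_of_nonneg_left h2 (by linarith)
    refine ⟨by exact_mod_cast Finset.card_pos.2 ⟨C, hC⟩, ?_, ?_, ?_, h4⟩
    · nlinarith
    · nlinarith
    · nlinarith
  refine ⟨fun C hC => ?_, fun C hC => ?_, fun C hC => ?_⟩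
  · rw [← coe_cliques, Finset.mem_coe]
    by_contra hcon
    have h1 : A.outputDist L (some C) = 0 := by rw [← ofReal_pr, h0 C hcon, ENNReal.ofReal_zero]
    exact (PMF.mem_support_iff _ _).1 hC h1
  · obtain ⟨hN, h1, h2, -, -⟩ := key C hC
    rw [hcard, mul_one_div, mul_one_div]
    exact ⟨(div_le_iff₀ hN).2 h1, (le_div_iff₀ hN).2 h2⟩
  · obtain ⟨hN, -, -, h1, h2⟩ := key C hC
    rw [hcard, mul_one_div, mul_one_div]
    change pr L A (some C) / (1 - pr L A none) ∈ _
    constructor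
    · rw [div_le_div_iff₀ hN hF1]; exact h1
    · rw [div_le_div_iff₀ hF1 hN]; exact h2

theorem nearlyUniform_exhaustive (L : AdjLists G) {k : ℕ} {ε : ℝ} (hε : 0 < ε) (hε1 : ε < 1)
    (hk : (cliques G k).Nonempty) : NearlyUniform L (exhaustive n k) k ε := by
  classical
  have hN : (0 : ℝ) < (cliques G k).card := by exact_mod_cast hk.card_pos
  have hF : pr L (exhaustive n k) none = 0 := by
    have h1 := sum_pr_some L (exhaustive n k)
    simp_rw [pr_exhaustive] at h1
    rw [Finset.sum_ite_mem, Finset.univ_inter, Finset.sum_const, nsmul_eq_mul,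
      mul_one_div_cancel hN.ne'] at h1
    linarith
  refine nearlyUniform_of_bounds hε hε1 (fun C hC => ?_) (by rw [hF]; linarith) fun C hC => ?_
  · rw [pr_exhaustive, if_neg hC]
  · rw [pr_exhaustive, if_pos hC, hF, mul_one_div_cancel hN.ne']
    constructor <;> linarith

theorem MaxLe.maxQueries_le {Ω : Type} {A : QueryAlg n Ω} {m : ℕ} (h : MaxLe L A m) {b : ℝ}
    (hb : (m : ℝ) ≤ b) : A.maxQueries L ≤ ENNReal.ofReal b := by
  refine iSup₂_le fun p hp => ?_
  rw [← ENNReal.ofReal_natCast]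
  exact ENNReal.ofReal_le_ofReal (le_trans (by exact_mod_cast h p hp) hb)

theorem maxLe_exhaustive_three_mul {a k : ℕ} {N : Fin n → Finset (Fin n)}
    (hN : ∀ v, (N v).card ≤ a) (hG : ∀ u v, G.Adj u v → v ∈ N u ∨ u ∈ N v) (ha : 0 < a) :
    MaxLe L (exhaustive n k) (3 * (n * a)) := by
  refine (maxLe_exhaustive L k).mono ?_
  have h1 := L.sum_dg_le hN hG
  have h2 : n ≤ n * a := Nat.le_mul_of_pos_right n ha
  omega

/-- The repetition of attempts is nearly uniform, and its numbers of queries are as claimed, when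
there are more than `τ ^ (k - 2) / 2` cliques. -/
theorem sampleClique_of_many {a k : ℕ} {ε nbar τ : ℝ} {N : Fin n → Finset (Fin n)}
    (hN : ∀ v, (N v).card ≤ a) (hG : ∀ u v, G.Adj u v → v ∈ N u ∨ u ∈ N v) (ha : 0 < a)
    (hn : 0 < n) (hk : 2 ≤ k) (hε : 0 < ε) (hε1 : ε < 1) (hx : 6 * (k : ℝ) ≤ Real.logb 2 n)
    (haτ : (a : ℝ) ≤ τ) (hτ : τ ≤ Real.sqrt (n * a)) (hne : (cliques G k).Nonempty)
    (hnbar : ((cliques G k).card : ℝ) ≤ nbar) (hnbar2 : nbar ≤ 2 * ((cliques G k).card : ℝ))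
    (hmany : τ ^ (k - 2) < nbar) :
    NearlyUniform L (sampleClique n a k ε nbar τ) k ε ∧
    CostLe L (sampleClique n a k ε nbar τ) ((Real.logb 2 n / ε) ^ (33 * k) *
      min ((n : ℝ) * a) ((n : ℝ) * a * τ ^ (k - 2) / ((cliques G k).card : ℝ))) ∧
    (sampleClique n a k ε nbar τ).maxQueries L ≤ ENNReal.ofReal ((Real.logb 2 n / ε) ^ (33 * k) *
      max (Real.sqrt ((n : ℝ) * a) / τ)
        (min ((n : ℝ) * a) ((n : ℝ) * a * τ ^ (k - 2) / ((cliques G k).card : ℝ)))) := by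
  have hk' : (2 : ℝ) ≤ k := by exact_mod_cast hk
  have ha' : (1 : ℝ) ≤ a := by exact_mod_cast ha
  have hn' : (0 : ℝ) < n := by exact_mod_cast hn
  have hτ0 : 0 < τ := by linarith
  set x := Real.logb 2 (n : ℝ) with hxdef
  set l := x / ε with hl
  have hx12 : 12 ≤ x := by linarith
  have hxl : x ≤ l := by rw [hl, le_div_iff₀ hε]; nlinarith
  have hl12 : 12 ≤ l := hx12.trans hxl
  have hl1 : 1 ≤ l := by linarith
  have hl0 : 0 < l := by linarith
  set J := walkLength n k with hJdef
  have hJx : (J : ℝ) + 1 ≤ x ^ 2 := walkLength_le hk hx (Real.natLog_le_logb n 2)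
  have hJl : (J : ℝ) + 1 ≤ l ^ 2 := hJx.trans (by gcongr)
  have hJ : n ^ k < 2 ^ J := by
    rw [hJdef, walkLength, mul_comm, pow_mul]
    exact Nat.pow_lt_pow_left (Nat.lt_pow_succ_log_self (by norm_num) n) (by omega)
  have hkl : (k : ℝ) ≤ l / 6 := by linarith
  set δ := stepError n k ε with hδdef
  have hδ : 0 < δ := by rw [hδdef, stepError]; positivity
  have hδl : 1 / δ ≤ l ^ 4 := inv_stepError_le hk hx hε hε1 hJx
  have hδη : 4 * k * (J + 1) * δ = ε / 16 := by
    rw [hδdef, stepError, ← hJdef]; field_simp; norm_num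
  have hδ1 : δ ≤ 1 := by
    have h1 : 1 * δ ≤ 4 * k * (J + 1) * δ := by
      refine mul_le_mul_of_nonneg_right ?_ hδ.le
      nlinarith [Nat.cast_nonneg (α := ℝ) J]
    linarith
  obtain ⟨p, q, hS, hpq, hrp⟩ := exists_sampler_attempt (L := L) hN hG ha hn hk haτ hδ
    (by rw [hδη]; linarith) hJ
  rw [hδη] at hpq
  set r := attemptProb n a k J δ τ with hrdef
  have hr : 0 < r := by rw [hrdef, attemptProb, edgeProb]; positivity
  set Nk : ℝ := ((cliques G k).card : ℝ) with hNk
  have hNk1 : 1 ≤ Nk := by rw [hNk]; exact_mod_cast hne.card_pos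
  have hnbar0 : 0 < nbar := by linarith
  have hNp : Nk * p ≤ 1 := by
    calc Nk * p ≤ ∑ C ∈ cliques G k, pr L (attempt n a k J δ τ) (some C) := by
          rw [hNk, ← nsmul_eq_mul]; exact Finset.card_nsmul_le_sum _ _ _ hS.le_pr
      _ ≤ ∑ C, pr L (attempt n a k J δ τ) (some C) :=
          Finset.sum_le_sum_of_subset_of_nonneg (Finset.subset_univ _) fun _ _ _ => pr_nonneg _ _ _
      _ ≤ 1 := sum_pr_some_le_one _ _
  have hnr : nbar * r ≤ 2 * (Nk * p) := by
    calc nbar * r ≤ 2 * Nk * p := mul_le_mul hnbar2 hrp hr.le (by linarith)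
      _ = _ := by ring
  set T := numAttempts n a k ε nbar τ with hTdef
  have hy1 : 1 ≤ 16 / (ε * (nbar * r)) := by
    rw [le_div_iff₀ (by positivity), one_mul]
    calc ε * (nbar * r) ≤ 1 * 2 := mul_le_mul hε1.le (by linarith) (by positivity) (by norm_num)
      _ ≤ 16 := by norm_num
  have hTlow : 16 / (ε * (nbar * r)) ≤ T := Nat.le_ceil _
  have hTupp : (T : ℝ) ≤ 32 / (ε * (nbar * r)) := by
    have h1 := (Nat.ceil_lt_add_one (zero_le_one.trans hy1)).le
    calc (T : ℝ) ≤ 16 / (ε * (nbar * r)) + 1 := h1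
      _ ≤ 16 / (ε * (nbar * r)) + 16 / (ε * (nbar * r)) := by linarith
      _ = _ := by ring
  have hT : 8 / ε ≤ T * (Nk * p) := by
    rw [div_le_iff₀ (by positivity)] at hTlow
    rw [div_le_iff₀ hε]
    have : T * (ε * (nbar * r)) ≤ T * (ε * (2 * (Nk * p))) := by gcongr
    linarith
  set c := attemptCost k J δ with hcdef
  have hc0 : 0 ≤ c := hS.cost_nonneg
  have hcl : c ≤ l ^ 18 := attemptCost_le_pow hl12 hkl hJl hδ hδl
  set B := budget n a k ε nbar τ with hBdef
  have hBlow : 4 * (T * c) / ε ≤ B := by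
    refine (Nat.le_ceil _).trans ?_
    rw [hBdef, budget]; push_cast; linarith
  have hBupp : (B : ℝ) ≤ 4 * (T * c) / ε + 2 := by
    have h1 := (Nat.ceil_lt_add_one (show 0 ≤ 4 * (T * c) / ε by positivity)).le
    rw [hBdef, budget]; push_cast; linarith
  have hB0 : 0 < B := by rw [hBdef, budget]; omega
  have halg : sampleClique n a k ε nbar τ = loop (attempt n a k J δ τ) B T 0 := by
    rw [sampleClique, if_neg (not_le.2 hmany)]
  set W := (n : ℝ) * a * τ ^ (k - 2) / Nk with hW
  have hW0 : 0 ≤ W := by positivity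
  set mn := min ((n : ℝ) * a) W with hmn
  -- there are so many cliques that the minimum is `W`, up to a factor of two
  have hWmn : W ≤ 2 * mn := by
    have h1 : W ≤ 2 * ((n : ℝ) * a) := by
      rw [hW, div_le_iff₀ (by linarith)]
      calc (n : ℝ) * a * τ ^ (k - 2) ≤ n * a * (2 * Nk) := by gcongr; linarith
        _ = _ := by ring
    rw [hmn, mul_min_of_nonneg _ _ (by norm_num)]
    exact le_min h1 (by linarith)
  have hmn0 : 0 ≤ mn := le_min (by positivity) hW0
  have hTW : (T : ℝ) ≤ l ^ (2 + 21 * k) * W := by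
    have h1 := inv_attemptProb_le (n := n) (a := a) hl12 hk hkl hJl hδ hδl hτ0
    rw [← hrdef] at h1
    have h2 : 32 / ε ≤ l ^ 2 := by
      calc 32 / ε ≤ (12 * x) / ε := by gcongr; linarith
        _ = 12 * l := by rw [hl]; ring
        _ ≤ l ^ 2 := by rw [pow_two]; gcongr
    calc (T : ℝ) ≤ 32 / (ε * (nbar * r)) := hTupp
      _ = 32 / ε * (1 / nbar * (1 / r)) := by field_simp
      _ ≤ l ^ 2 * (1 / Nk * (l ^ (21 * k) * (n * a * τ ^ (k - 2)))) := by gcongr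
      _ = _ := by rw [pow_add, hW]; ring
  have hTc : T * c ≤ l ^ (21 + 21 * k) * mn := by
    calc T * c ≤ l ^ (2 + 21 * k) * W * l ^ 18 := by gcongr
      _ ≤ l ^ (2 + 21 * k) * (2 * mn) * l ^ 18 := by gcongr
      _ = 2 * (l ^ (20 + 21 * k) * mn) := by ring
      _ ≤ l * (l ^ (20 + 21 * k) * mn) :=
          mul_le_mul_of_nonneg_right (by linarith) (by positivity)
      _ = _ := by ring
  rw [halg]
  refine ⟨?_, ?_, ?_⟩
  · obtain ⟨h0, hF, h⟩ :=
      exists_failure_bound hS (hr.trans_le hrp) hε hε1 hpq hT hB0 hBlow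
    exact nearlyUniform_of_bounds hε hε1 h0 hF h
  · rw [CostLe]
    refine (expectedQueries_loop_le hS.costLe B T 0).trans ?_
    rw [← ENNReal.ofReal_natCast, ← ENNReal.ofReal_mul (Nat.cast_nonneg _)]
    refine ENNReal.ofReal_le_ofReal (hTc.trans ?_)
    gcongr
    omega
  · refine (maxLe_loop hS.maxLe B T (Nat.zero_le B)).maxQueries_le ?_
    have hm := attemptMax_le_pow (n := n) (a := a) hl12 (by omega) hkl hJl hδ hδ1 hδl hτ0 hτ
    have hR1 : 1 ≤ Real.sqrt (n * a) / τ := by rwa [le_div_iff₀ hτ0, one_mul]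
    set mx := max (Real.sqrt ((n : ℝ) * a) / τ) mn with hmx
    have hRm : Real.sqrt ((n : ℝ) * a) / τ ≤ mx := le_max_left _ _
    have hmm : mn ≤ mx := le_max_right _ _
    have hmx1 : 1 ≤ mx := hR1.trans hRm
    have h1 : 4 * (T * c) / ε ≤ l ^ (22 + 21 * k) * mx := by
      calc 4 * (T * c) / ε = 4 / ε * (T * c) := by ring
        _ ≤ l * (l ^ (21 + 21 * k) * mn) := by
            refine mul_le_mul ?_ hTc (by positivity) hl0.le
            rw [hl]; gcongr; linarith
        _ ≤ l * (l ^ (21 + 21 * k) * mx) := by gcongr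
        _ = _ := by ring
    have h2 : l ^ 18 * (Real.sqrt (n * a) / τ) ≤ l ^ (22 + 21 * k) * mx := by
      gcongr
      omega
    have h3 : 1 ≤ l ^ (22 + 21 * k) * mx :=
      one_le_mul_of_one_le_of_one_le (one_le_pow₀ hl1) hmx1
    calc ((B - 0 + attemptMax n a k J δ τ : ℕ) : ℝ) = B + attemptMax n a k J δ τ := by
          rw [Nat.sub_zero]; push_cast; rfl
      _ ≤ 4 * (l ^ (22 + 21 * k) * mx) := by linarith
      _ ≤ l * (l ^ (22 + 21 * k) * mx) :=
          mul_le_mul_of_nonneg_right (by linarith) (by positivity)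
      _ = l ^ (23 + 21 * k) * mx := by ring
      _ ≤ l ^ (33 * k) * mx := by
          gcongr
          omega

theorem sampleClique_of_few {a k : ℕ} {ε nbar τ : ℝ} {N : Fin n → Finset (Fin n)}
    (hN : ∀ v, (N v).card ≤ a) (hG : ∀ u v, G.Adj u v → v ∈ N u ∨ u ∈ N v) (ha : 0 < a)
    (hk : 2 ≤ k) (hε : 0 < ε) (hε1 : ε < 1) (hx : 6 * (k : ℝ) ≤ Real.logb 2 n)
    (hne : (cliques G k).Nonempty)
    (hnbar : ((cliques G k).card : ℝ) ≤ nbar) (hfew : nbar ≤ τ ^ (k - 2)) :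
    NearlyUniform L (sampleClique n a k ε nbar τ) k ε ∧
    CostLe L (sampleClique n a k ε nbar τ) ((Real.logb 2 n / ε) ^ (33 * k) *
      min ((n : ℝ) * a) ((n : ℝ) * a * τ ^ (k - 2) / ((cliques G k).card : ℝ))) ∧
    (sampleClique n a k ε nbar τ).maxQueries L ≤ ENNReal.ofReal ((Real.logb 2 n / ε) ^ (33 * k) *
      max (Real.sqrt ((n : ℝ) * a) / τ)
        (min ((n : ℝ) * a) ((n : ℝ) * a * τ ^ (k - 2) / ((cliques G k).card : ℝ)))) := by
  have hk' : (2 : ℝ) ≤ k := by exact_mod_cast hk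
  have hNk : (0 : ℝ) < (cliques G k).card := by exact_mod_cast hne.card_pos
  rw [sampleClique, if_pos hfew]
  have hna : (0 : ℝ) ≤ n * a := by positivity
  have hmin : min ((n : ℝ) * a) ((n : ℝ) * a * τ ^ (k - 2) / ((cliques G k).card : ℝ)) =
      n * a := by
    refine min_eq_left ?_
    rw [le_div_iff₀ hNk]
    exact mul_le_mul_of_nonneg_left (hnbar.trans hfew) hna
  rw [hmin]
  have hl : 12 ≤ Real.logb 2 n / ε := by
    rw [le_div_iff₀ hε]
    linarith
  have hpow : 3 ≤ (Real.logb 2 n / ε) ^ (33 * k) :=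
    le_trans (by linarith) (le_self_pow₀ (by linarith) (by omega))
  have h3 : ((3 * (n * a) : ℕ) : ℝ) ≤ (Real.logb 2 n / ε) ^ (33 * k) * (n * a) := by
    push_cast
    exact mul_le_mul_of_nonneg_right hpow hna
  have hmax := maxLe_exhaustive_three_mul (L := L) (k := k) hN hG ha
  exact ⟨nearlyUniform_exhaustive L hε hε1 hne, hmax.costLe.mono h3,
    hmax.maxQueries_le (h3.trans (mul_le_mul_of_nonneg_left (le_max_right _ _) (by linarith)))⟩

end QueryAlg

end CliqueSampling
theorem mainTheorem1 :
    ∃ (c : ℕ)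
      (sampleAClique : (n α k : ℕ) → (ε nbar τ : ℝ) → QueryAlg n (Option (Finset (Fin n)))),
      ∀ (n α k : ℕ) (ε nbar τ : ℝ) (G : SimpleGraph (Fin n)) (L : AdjLists G),
        2 ≤ k → 0 < ε → ε < 1 →
        arboricity G ≤ (α : ℕ∞) →
        (G.cliqueSet k).Nonempty →
        nbar ∈ Set.Icc (numCliques G k : ℝ) (2 * (numCliques G k : ℝ)) →
        (α : ℝ) / ε * (4 * (k : ℝ) * Real.logb 2 (n : ℝ)) ^ k ≤ τ →
        τ ≤ Real.sqrt ((n : ℝ) * (α : ℝ)) →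
        (∀ C : Finset (Fin n),
          some C ∈ ((sampleAClique n α k ε nbar τ).outputDist L).support → C ∈ G.cliqueSet k) ∧
        PointwiseCloseToUniform ε (G.cliqueSet k)
          (returnProb (sampleAClique n α k ε nbar τ) L) ∧
        PointwiseCloseToUniform ε (G.cliqueSet k)
          (condReturnProb (sampleAClique n α k ε nbar τ) L) ∧
        (sampleAClique n α k ε nbar τ).expectedQueries L ≤
          ENNReal.ofReal
            ((Real.logb 2 (n : ℝ) / ε) ^ (c * k) *
              min ((n : ℝ) * α) ((n : ℝ) * α * τ ^ (k - 2) / (numCliques G k : ℝ))) ∧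
        (sampleAClique n α k ε nbar τ).maxQueries L ≤
          ENNReal.ofReal
            ((Real.logb 2 (n : ℝ) / ε) ^ (c * k) *
              max (Real.sqrt ((n : ℝ) * α) / τ)
                (min ((n : ℝ) * α)
                  ((n : ℝ) * α * τ ^ (k - 2) / (numCliques G k : ℝ)))) := by
  -- with `l = log n / ε`, the inverse of the probability of a clique in an attempt contributes
  -- `l ^ (21 * k)`, and all else at most `l ^ 23`
  refine ⟨33, QueryAlg.sampleClique, ?_⟩
  intro n α k ε nbar τ G L hk hε hε1 hα hne hnbar h1 h2
  obtain ⟨N, hN, hG⟩ := exists_orientation hα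
  obtain ⟨C, hC⟩ := hne
  rw [← coe_cliques, Finset.mem_coe] at hC
  rw [← card_cliques] at hnbar ⊢
  have hcl := mem_cliques.1 hC
  obtain ⟨u, hu, v, hv, huv⟩ := Finset.one_lt_card.1 (hcl.card_eq.symm ▸ hk : 1 < C.card)
  have hadj : G.Adj u v := hcl.isClique hu hv huv
  have ha : 0 < α := by
    rcases hG u v hadj with h | h
    · exact (Finset.card_pos.2 ⟨_, h⟩).trans_le (hN u)
    · exact (Finset.card_pos.2 ⟨_, h⟩).trans_le (hN v)
  have hn : 2 ≤ n := by
    have := hcl.card_eq ▸ Finset.card_le_univ C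
    rw [Fintype.card_fin] at this
    omega
  obtain ⟨hx, haτ⟩ := QueryAlg.six_mul_le_logb hk hε hε1 ha hn h1 h2
  rcases le_or_gt nbar (τ ^ (k - 2)) with h | h
  · obtain ⟨hu, hcost, hmax⟩ :=
      QueryAlg.sampleClique_of_few hN hG ha hk hε hε1 hx ⟨C, hC⟩ hnbar.1 h
    exact ⟨hu.mem, hu.close, hu.closeCond, hcost, hmax⟩
  · obtain ⟨hu, hcost, hmax⟩ := QueryAlg.sampleClique_of_many hN hG ha (by omega) hk hε hε1 hx haτ
      h2 ⟨C, hC⟩ hnbar.1 hnbar.2 h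
    exact ⟨hu.mem, hu.close, hu.closeCond, hcost, hmax⟩
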